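/- **Setting.** Let $\mathfrak h$ and $\mathsf k$ be complex Hilbert spaces, let $\mathcal A$ be a von Neumann algebra acting on $\mathfrak h$, and put $\widehat{\mathsf k}=\mathbb C\oplus\mathsf k$, $\widehat x=(1,x)\in\widehat{\mathsf k}$ for $x\in\mathsf k$, and $\omega=\widehat 0=(1,0)$. Let $\mathcal F$ be the Boson Fock space over $L^2(\mathbb R_+;\mathsf k)$, with exponential vectors $\varepsilon(f)$, $\langle\varepsilon(f),\varepsilon(g)\rangle=e^{\langle f,g\rangle}$, vacuum $\Omega=\varepsilon(0)$, and $\mathcal N=B(\mathcal F)$; $u\varepsilon(f)$ means $u\otimes\varepsilon(f)$. Let $P_t$ be the orthogonal projection of $\mathfrak h\otimes\mathcal F$ onto $\mathfrak h\otimes\overline{\mathrm{span}}\{\varepsilon(f): f=0 \text{ a.e. on } [t,\infty)\}$, that is, $P_t=I_{\mathfrak h}\otimes I_{\mathcal F_{[0,t)}}\otimes|\Omega_{[t,\infty)}\rangle\langle\Omega_{[t,\infty)}|$. Ultraweak tensor products are denoted $\overline\otimes$. For a vector $x$, $E_x=|x\rangle\otimes I$ is the operator $\xi\mapsto x\otimes\xi$,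 and $E^x=(E_x)^*$. Let $\Delta$ be the orthogonal projection $P_{\mathsf k}\otimes I$ on $\widehat{\mathsf k}\otimes\mathfrak h\otimes\mathcal F$, where $P_{\mathsf k}$ projects $\widehat{\mathsf k}$ onto $\mathsf k$. Let $j=(j_t)_{t\ge0}$ be a vacuum-adapted quantum stochastic flow on $\mathcal A$: each $j_t:\mathcal A\to\mathcal A\,\overline\otimes\,\mathcal N$ is a normal $*$-homomorphism with $j_t(a)=P_tj_t(a)P_t$ and $j_t(1)=P_t$; $j_0(a)=a\otimes|\Omega\rangle\langle\Omega|$; $t\mapsto j_t(a)$ is ultraweakly continuous for each $a$; and $j_{s+t}=\widehat{\jmath}_s\circ\sigma_s\circ j_t$ for all $s,t\ge0$. Here $\sigma_s:\mathcal A\,\overline\otimes\,\mathcal N\to\mathcal A\,\overline\otimes\,B(\mathcal F_{[s,\infty)})$ is the right shift by $s$, $j_{s)}:\mathcal A\to\mathcal A\,\overline\otimes\,B(\mathcal F_{[0,s)})$ is given by $j_s(a)=j_{s)}(a)\otimes|\Omega_{[s,\infty)}\rangle\langle\Omega_{[s,\infty)}|$, and $\widehat{\jmath}_s=j_{s)}\,\overline\otimes\,\mathrm{id}_{B(\mathcal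 F_{[s,\infty)})}$. Put $\widetilde{\jmath}_s=\mathrm{id}_{B(\widehat{\mathsf k})}\,\overline\otimes\,j_s$. A *process in $\mathcal A$* is a family $Z=(Z_t)_{t\ge0}$ in $\mathcal A\,\overline\otimes\,\mathcal N$ such that $t\mapsto\langle\zeta',Z_t\zeta\rangle$ is measurable for all $\zeta,\zeta'\in\mathfrak h\otimes\mathcal F$; it is *vacuum adapted* if $Z_t=P_tZ_tP_t$ for all $t$. An *integrand process* is a family $G=(G_t)_{t\ge0}$ in $B(\widehat{\mathsf k})\,\overline\otimes\,\mathcal A\,\overline\otimes\,\mathcal N$ with measurable matrix elements such that, for all $t\ge0$, $G_t=(I\otimes P_t)G_t(I\otimes P_t)$ and $$\|E^\omega GE_\omega\|_{L^1[0,t)}+\|\Delta GE_\omega\|_{L^2[0,t)}+\|E^\omega G\Delta\|_{L^2[0,t)}+\|\Delta G\Delta\|_{L^\infty[0,t)}<\infty,$$ the norms being those of the functions $s\mapsto\|E^\omega G_sE_\omega\|$, etc. The quantum stochastic integral $\int G\,d\Lambda$ of such a $G$ is the vacuum-adapted process in $\mathcal A$ determined by $$\Big\langle u\varepsilon(f),\int_0^tG_s\,d\Lambda_s\,v\varepsilon(g)\Big\rangle=\int_0^t\big\langle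 u\varepsilon(f),E^{\widehat{f(s)}}G_sE_{\widehat{g(s)}}v\varepsilon(g)\big\rangle\,ds$$ for all $t\ge0$, $u,v\in\mathfrak h$ and $f,g\in L^2(\mathbb R_+;\mathsf k)$. **Lemma.** Let $c\in|\widehat{\mathsf k}\rangle\,\overline\otimes\,\mathcal A$, where $|\widehat{\mathsf k}\rangle=B(\mathbb C;\widehat{\mathsf k})$, so that $c:\mathfrak h\to\widehat{\mathsf k}\otimes\mathfrak h$. There is a unique process $M^c=(M^c_t)_{t\ge0}$ in $\mathcal A$ such that $M^c-I$ is vacuum adapted, $\big(\widetilde{\jmath}_s(cE^\omega)(I_{\widehat{\mathsf k}}\otimes M^c_s)\big)_{s\ge0}$ is an integrand process, and $$M^c_t=I+\int_0^t\widetilde{\jmath}_s(cE^\omega)(I_{\widehat{\mathsf k}}\otimes M^c_s)\,d\Lambda_s\qquad(t\ge0).$$ This process satisfies $$\langle u\varepsilon(f),(M^c_t-I)v\varepsilon(g)\rangle=\int_0^t\langle u\varepsilon(f),j_s(E^{\widehat{f(s)}}c)M^c_sv\varepsilon(g)\rangle\,ds$$ for all $t\ge0$, $u,v\in\mathfrak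 h$ and $f,g\in L^2(\mathbb R_+;\mathsf k)$, the integrand on the right being integrable, and $t\mapsto M^c_t$ is continuous in operator norm. -/

import Mathlib

open MeasureTheory
open scoped NNReal ENNReal TensorProduct InnerProductSpace

noncomputable section

namespace VacuumQSDE

/-! ### Hilbert-space tensor products and the `E` notation -/

section Tensor

variable (H K : Type*) [NormedAddCommGroup H] [InnerProductSpace ℂ H]
  [NormedAddCommGroup K] [InnerProductSpace ℂ K]

/-- The Hilbert-space tensor product: the completion of the algebraic tensor product for the
inner product with `⟪x ⊗ y, x' ⊗ y'⟫ = ⟪x, x'⟫ * ⟪y, y'⟫`. -/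
abbrev HTensor : Type _ := UniformSpace.Completion (H ⊗[ℂ] K)

variable {H K}
variable {H' K' : Type*} [NormedAddCommGroup H'] [InnerProductSpace ℂ H']
  [NormedAddCommGroup K'] [InnerProductSpace ℂ K']

/-- The operator `E_x = |x⟩ ⊗ I`, that is, `y ↦ x ⊗ y`. Its adjoint is `E^x = ⟨x| ⊗ I`. -/
def ketLeft (x : H) : K →L[ℂ] HTensor H K :=
  UniformSpace.Completion.toComplL ∘L TensorProduct.mkL ℂ H K x

/-- The operator `I ⊗ |y⟩`, that is, `x ↦ x ⊗ y`. -/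
def ketRight (y : K) : H →L[ℂ] HTensor H K :=
  UniformSpace.Completion.toComplL ∘L (TensorProduct.mkL ℂ H K).flip y

/-- The elementary tensor `x ⊗ y`. -/
def elem (x : H) (y : K) : HTensor H K := ketLeft x y

theorem inner_elem (x x' : H) (y y' : K) :
    ⟪elem x y, elem x' y'⟫_ℂ = ⟪x, x'⟫_ℂ * ⟪y, y'⟫_ℂ := by
  simp [elem, ketLeft]

/-- The tensor product `a ⊗ b` of two bounded operators. -/
def opTensor (a : H →L[ℂ] H') (b : K →L[ℂ] K') : HTensor H K →L[ℂ] HTensor H' K' :=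
  (TensorProduct.mapL a b).completion

theorem opTensor_elem (a : H →L[ℂ] H') (b : K →L[ℂ] K') (x : H) (y : K) :
    opTensor a b (elem x y) = elem (a x) (b y) := by
  simp [opTensor, elem, ketLeft]

end Tensor

/-! ### The ultraweak topology and ultraweak tensor products -/

section Ultraweak

variable (H K : Type*) [NormedAddCommGroup H] [InnerProductSpace ℂ H]
  [NormedAddCommGroup K] [InnerProductSpace ℂ K]

/-- The ultraweak (σ-weak) topology on the bounded operators from `H` to `K`: the weakest topology
for which all functionals `T ↦ ∑ n, ⟪y n, T (x n)⟫`, with `∑ ‖x n‖ ^ 2` and `∑ ‖y n‖ ^ 2` finite,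
are continuous. -/
@[reducible] def ultraweakTopology : TopologicalSpace (H →L[ℂ] K) :=
  ⨅ (x : ℕ → H) (y : ℕ → K) (_ : Summable fun n => ‖x n‖ ^ 2) (_ : Summable fun n => ‖y n‖ ^ 2),
    TopologicalSpace.induced (fun T : H →L[ℂ] K => ∑' n, ⟪y n, T (x n)⟫_ℂ) inferInstance

variable {H K}

/-- The closure of a set of operators in the ultraweak topology. -/
def ultraweakClosure (S : Set (H →L[ℂ] K)) : Set (H →L[ℂ] K) :=
  @closure _ (ultraweakTopology H K) S

theorem continuous_ultraweak_inner (x : H) (y : K) :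
    @Continuous _ _ (ultraweakTopology H K) _ (fun T : H →L[ℂ] K => ⟪y, T x⟫_ℂ) := by
  have hx : Summable fun n : ℕ => ‖(if n = 0 then x else 0 : H)‖ ^ 2 :=
    summable_of_ne_finset_zero (s := {0}) (by intro n hn; simp at hn; simp [hn])
  have hy : Summable fun n : ℕ => ‖(if n = 0 then y else 0 : K)‖ ^ 2 :=
    summable_of_ne_finset_zero (s := {0}) (by intro n hn; simp at hn; simp [hn])
  have h : (fun T : H →L[ℂ] K => ⟪y, T x⟫_ℂ) = fun T : H →L[ℂ] K =>
      ∑' n : ℕ, ⟪(if n = 0 then y else 0 : K), T (if n = 0 then x else 0 : H)⟫_ℂ := by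
    funext T
    rw [tsum_eq_single 0 (by intro n hn; simp [hn])]
    simp
  rw [h]
  refine continuous_iInf_dom (i := fun n : ℕ => (if n = 0 then x else 0 : H)) ?_
  refine continuous_iInf_dom (i := fun n : ℕ => (if n = 0 then y else 0 : K)) ?_
  refine continuous_iInf_dom (i := hx) ?_
  refine continuous_iInf_dom (i := hy) ?_
  exact continuous_induced_dom

variable {H' K' : Type*} [NormedAddCommGroup H'] [InnerProductSpace ℂ H']
  [NormedAddCommGroup K'] [InnerProductSpace ℂ K']

/-- The ultraweak tensor product `V ⊗̄ W` of two sets (in practice, linear spaces) of operators: the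
ultraweak closure of the linear span of the operators `a ⊗ b` with `a ∈ V` and `b ∈ W`. -/
def uwTensor (V : Set (H →L[ℂ] H')) (W : Set (K →L[ℂ] K')) :
    Set (HTensor H K →L[ℂ] HTensor H' K') :=
  ultraweakClosure (Submodule.span ℂ (Set.image2 opTensor V W) : Set _)

/-- The ultraweak tensor product `|𝓗⟩ ⊗̄ W`, with `ℂ ⊗ K` identified with `K`, so that the
elementary tensor `|x⟩ ⊗ b` is the operator `y ↦ x ⊗ b y`. -/
def uwKetTensor (𝓗 : Type*) [NormedAddCommGroup 𝓗] [InnerProductSpace ℂ 𝓗]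
    (W : Set (K →L[ℂ] K')) : Set (K →L[ℂ] HTensor 𝓗 K') :=
  ultraweakClosure
    (Submodule.span ℂ (Set.image2 (fun (x : 𝓗) b => ketLeft x ∘L b) Set.univ W) : Set _)

variable {h : Type*} [NormedAddCommGroup h] [InnerProductSpace ℂ h] [CompleteSpace h]

/-- If `T ↦ R T Q` maps a set of operators into a von Neumann algebra, then it maps the ultraweakly
closed linear span of that set into the von Neumann algebra. -/
theorem comp_mem_of_mem_ultraweakClosure [CompleteSpace K] (A : VonNeumannAlgebra h)
    (Q : h →L[ℂ] H) (R : K →L[ℂ] h) (S : Set (H →L[ℂ] K)) (hS : ∀ T ∈ S, R ∘L T ∘L Q ∈ A)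
    {T : H →L[ℂ] K} (hT : T ∈ ultraweakClosure (Submodule.span ℂ S : Set _)) :
    R ∘L T ∘L Q ∈ A := by
  have hspan : ∀ T ∈ Submodule.span ℂ S, R ∘L T ∘L Q ∈ A.toStarSubalgebra := by
    intro T hT
    induction hT using Submodule.span_induction with
    | mem T hT => exact hS T hT
    | zero => simp
    | add T T' _ _ h1 h2 =>
      have : R ∘L (T + T') ∘L Q = R ∘L T ∘L Q + R ∘L T' ∘L Q := by ext; simp
      rw [this]; exact add_mem h1 h2
    | smul z T _ h1 =>
      have : R ∘L (z • T) ∘L Q = z • (R ∘L T ∘L Q) := by ext; simp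
      rw [this]; exact A.toStarSubalgebra.smul_mem h1 z
  rw [← SetLike.mem_coe, ← A.centralizer_centralizer]
  intro b hb
  ext q
  refine ext_inner_left ℂ fun p => ?_
  have key : ∀ T : H →L[ℂ] K, ⟪p, (b * (R ∘L T ∘L Q)) q⟫_ℂ =
      ⟪R.adjoint (b.adjoint p), T (Q q)⟫_ℂ := by
    intro T; simp [ContinuousLinearMap.adjoint_inner_left]
  have key' : ∀ T : H →L[ℂ] K, ⟪p, ((R ∘L T ∘L Q) * b) q⟫_ℂ =
      ⟪R.adjoint p, T (Q (b q))⟫_ℂ := by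
    intro T; simp [ContinuousLinearMap.adjoint_inner_left]
  rw [key, key']
  let _ := ultraweakTopology H K
  refine (isClosed_eq (continuous_ultraweak_inner (Q q) (R.adjoint (b.adjoint p)))
    (continuous_ultraweak_inner (Q (b q)) (R.adjoint p))).closure_subset_iff.2 ?_ hT
  intro T hT
  have := hb _ (hspan T hT)
  simp only [Set.mem_ofPred_eq]
  rw [← key, ← key', this]

end Ultraweak

/-! ### Boson Fock space -/

section Fock

open scoped ComplexOrder

variable (H : Type*) [NormedAddCommGroup H] [InnerProductSpace ℂ H]

/-- The kernel `(f, g) ↦ exp ⟪f, g⟫` (acting as a scalar on `ℂ`). -/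
def expKernel : Matrix H H (ℂ →L[ℂ] ℂ) :=
  .of fun f g => Complex.exp ⟪f, g⟫_ℂ • ContinuousLinearMap.id ℂ ℂ

theorem expKernel_pow_nonneg (n : ℕ) (w : H →₀ ℂ) :
    0 ≤ ∑ f ∈ w.support, ∑ g ∈ w.support, star (w f) * ⟪f, g⟫_ℂ ^ n * w g := by
  have hn : ∀ n : ℕ, (Matrix.of fun f g : w.support =>
      ⟪(f : H), (g : H)⟫_ℂ ^ n : Matrix _ _ ℂ).PosSemidef := by
    intro n
    induction n with
    | zero =>
      have := Matrix.posSemidef_vecMulVec_self_star (R := ℂ) (fun _ : w.support => 1)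
      convert this using 1
      ext; simp [Matrix.vecMulVec]
    | succ n ih =>
      have := ih.hadamard (Matrix.posSemidef_gram ℂ (fun f : w.support => (f : H)))
      have e : (Matrix.of fun f g : w.support => ⟪(f : H), (g : H)⟫_ℂ ^ (n + 1) : Matrix _ _ ℂ) =
          Matrix.hadamard (Matrix.of fun f g : w.support => ⟪(f : H), (g : H)⟫_ℂ ^ n)
            (Matrix.gram ℂ (fun f : w.support => (f : H))) := by
        ext; simp [pow_succ, Matrix.gram]
      rw [e]
      exact this
  have := (hn n).dotProduct_mulVec_nonneg (fun f => w f)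
  simp only [dotProduct, Matrix.mulVec, Pi.star_apply, Matrix.of_apply, Finset.mul_sum] at this
  rw [← Finset.sum_coe_sort]
  convert this using 2 with f
  rw [← Finset.sum_coe_sort]
  refine Finset.sum_congr rfl fun g _ => ?_
  ring

theorem posSemidef_expKernel : (expKernel H).PosSemidef := by
  have hiff := (RKHS.posSemidef_tfae (K := expKernel H)).out 0 2
  refine hiff.2 ⟨?_, fun w => ?_⟩
  · ext f g
    simp [expKernel, Matrix.conjTranspose_apply, ContinuousLinearMap.star_eq_adjoint,
      ← Complex.exp_conj]
    have hid : ContinuousLinearMap.adjoint (ContinuousLinearMap.id ℂ ℂ) =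
        ContinuousLinearMap.id ℂ ℂ := star_one (ℂ →L[ℂ] ℂ)
    simp [hid]
  · have h : HasSum (fun n : ℕ => ((n.factorial : ℂ))⁻¹ *
        ∑ f ∈ w.support, ∑ g ∈ w.support, star (w f) * ⟪f, g⟫_ℂ ^ n * w g)
        (∑ f ∈ w.support, ∑ g ∈ w.support, star (w f) * Complex.exp ⟪f, g⟫_ℂ * w g) := by
      simp_rw [Finset.mul_sum]
      refine hasSum_sum fun f _ => hasSum_sum fun g _ => ?_
      have := ((NormedSpace.expSeries_div_hasSum_exp (𝔸 := ℂ) ⟪f, g⟫_ℂ).mul_left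
        (star (w f))).mul_right (w g)
      rw [Complex.exp_eq_exp_ℂ]
      refine Eq.mp (congrArg (fun F : ℕ → ℂ => HasSum F _) (funext fun n => ?_)) this
      rw [div_eq_mul_inv]
      ring
    have h2 := h.nonneg fun n => mul_nonneg (by positivity) (expKernel_pow_nonneg H n w)
    refine (Complex.le_def.1 h2).1.trans_eq ?_
    simp [expKernel, Finsupp.sum, ← Complex.exp_conj, mul_comm, mul_left_comm]

instance : Fact (expKernel H).PosSemidef := ⟨posSemidef_expKernel H⟩

/-- The Boson Fock space over `H`, as the Hilbert space generated by exponential vectors `ε(f)`,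
`f ∈ H`, with `⟪ε(f), ε(g)⟫ = exp ⟪f, g⟫`. -/
abbrev Fock : Type _ := RKHS.OfKernel (expKernel H)

variable {H}

/-- The exponential vector `ε(f)`. -/
def expVec (f : H) : Fock H := RKHS.kerFun (Fock H) f 1

theorem inner_expVec (f g : H) : ⟪expVec f, expVec g⟫_ℂ = Complex.exp ⟪f, g⟫_ℂ := by
  rw [expVec, expVec, ← RKHS.kernel_inner, RKHS.OfKernel.kernel_ofKernel]
  simp [expKernel, ← Complex.exp_conj]

theorem span_expVec_dense :
    (Submodule.span ℂ (Set.range (expVec (H := H)))).topologicalClosure = ⊤ := by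
  refine top_le_iff.1 ((RKHS.kerFun_dense (H := Fock H)).ge.trans ?_)
  refine Submodule.topologicalClosure_mono (Submodule.span_le.2 ?_)
  rintro _ ⟨f, z, rfl⟩
  have : RKHS.kerFun (Fock H) f z = z • expVec f := by
    rw [expVec, ← map_smul]; simp
  rw [this]
  exact Submodule.smul_mem _ _ (Submodule.subset_span ⟨f, rfl⟩)

end Fock

/-! ### Noise space -/

/-- Lebesgue measure on `ℝ₊ = [0, ∞)`. -/
def lebesgue : Measure ℝ≥0 := Measure.comap ((↑) : ℝ≥0 → ℝ) volume

theorem map_add_lebesgue_le (s : ℝ≥0) : lebesgue.map (· + s) ≤ lebesgue := by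
  have he : MeasurableEmbedding ((↑) : ℝ≥0 → ℝ) :=
    MeasurableEmbedding.subtype_coe measurableSet_Ici
  refine Measure.le_iff.2 fun S hS => ?_
  rw [Measure.map_apply (by fun_prop) hS, lebesgue, he.comap_apply, he.comap_apply]
  rw [← measure_preimage_add_right volume (-(s : ℝ))
    (((↑) : ℝ≥0 → ℝ) '' ((fun x => x + s) ⁻¹' S))]
  refine measure_mono ?_
  rintro r ⟨x, hx, hxr⟩
  refine ⟨x + s, hx, ?_⟩
  push_cast
  linarith

section Noise

set_option linter.unusedSectionVars false

variable (𝔨 : Type*) [NormedAddCommGroup 𝔨] [InnerProductSpace ℂ 𝔨]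

/-- The Hilbert space `L²(ℝ₊; 𝔨)`. -/
abbrev L2 : Type _ := Lp 𝔨 2 lebesgue

/-- The Fock space `𝓕` over `L²(ℝ₊; 𝔨)`. -/
abbrev Noise : Type _ := Fock (L2 𝔨)

/-- The space `𝔨̂ = ℂ ⊕ 𝔨`. -/
abbrev Hat : Type _ := WithLp 2 (ℂ × 𝔨)

variable {𝔨}

/-- The vector `x̂ = (1, x)` in `𝔨̂`. -/
def hat (x : 𝔨) : Hat 𝔨 := WithLp.toLp 2 (1, x)

variable (𝔨) in
/-- The vector `ω = (1, 0)` in `𝔨̂`. -/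
def omega : Hat 𝔨 := hat 0

variable (𝔨) in
/-- The orthogonal projection of `𝔨̂` onto `𝔨`, that is, onto the orthogonal complement of `ω`. -/
def projK : Hat 𝔨 →L[ℂ] Hat 𝔨 := (ℂ ∙ omega 𝔨)ᗮ.starProjection

/-- The truncation `1_{[0, t)} f`. -/
def trunc (t : ℝ≥0) (f : L2 𝔨) : L2 𝔨 :=
  ((Lp.memLp f).indicator (measurableSet_Iio (a := t))).toLp

theorem memLp_shift (t : ℝ≥0) (f : L2 𝔨) : MemLp (fun r => f (r + t)) 2 lebesgue :=
  ((Lp.memLp f).mono_measure (map_add_lebesgue_le t)).comp_of_map (by fun_prop)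

/-- The shift `f(· + t)`, which is the adjoint of the right shift `s_t` on `L²(ℝ₊; 𝔨)`. -/
def shift (t : ℝ≥0) (f : L2 𝔨) : L2 𝔨 := (memLp_shift t f).toLp

variable (𝔨) in
/-- The vacuum vector `Ω = ε(0)`. -/
def vacuum : Noise 𝔨 := expVec 0

variable (𝔨) in
/-- The subspace `𝓕_{[0, t)} ⊗ Ω_{[t, ∞)}` of `𝓕`: the closed linear span of the exponential vectors
`ε(f)` with `f` supported by `[0, t)`. -/
def pastSpace (t : ℝ≥0) : Submodule ℂ (Noise 𝔨) :=
  (Submodule.span ℂ {ξ | ∃ f : L2 𝔨, (∀ᵐ s ∂lebesgue, t ≤ s → f s = 0) ∧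
    ξ = expVec f}).topologicalClosure

instance (t : ℝ≥0) : CompleteSpace (pastSpace 𝔨 t) :=
  (Submodule.isClosed_topologicalClosure _).completeSpace_coe

variable (𝔥 : Type*) [NormedAddCommGroup 𝔥] [InnerProductSpace ℂ 𝔥]

variable (𝔨) in
/-- The projection `P_t = I_𝔥 ⊗ I_{𝓕_{[0, t)}} ⊗ |Ω_{[t, ∞)}⟩⟨Ω_{[t, ∞)}|` on `𝔥 ⊗ 𝓕`. -/
def vacProj (t : ℝ≥0) : HTensor 𝔥 (Noise 𝔨) →L[ℂ] HTensor 𝔥 (Noise 𝔨) :=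
  opTensor (ContinuousLinearMap.id ℂ 𝔥) (pastSpace 𝔨 t).starProjection

end Noise

/-! ### Vacuum-adapted quantum stochastic flows -/

section Flow

variable {𝔥 : Type*} [NormedAddCommGroup 𝔥] [InnerProductSpace ℂ 𝔥] [CompleteSpace 𝔥]

/-- For `T ∈ 𝓐 ⊗̄ 𝓑(X)` and `ξ, η ∈ X`, the slice `(I ⊗ ⟨ξ|) T (I ⊗ |η⟩)`, an element of `𝓐`. -/
def noiseSlice {X : Type*} [NormedAddCommGroup X] [InnerProductSpace ℂ X] [CompleteSpace X]
    (A : VonNeumannAlgebra 𝔥) (ξ η : X) {T : HTensor 𝔥 X →L[ℂ] HTensor 𝔥 X}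
    (hT : T ∈ uwTensor (A : Set (𝔥 →L[ℂ] 𝔥)) (Set.univ : Set (X →L[ℂ] X))) :
    A.toStarSubalgebra :=
  ⟨(ketRight ξ).adjoint ∘L T ∘L ketRight η,
    comp_mem_of_mem_ultraweakClosure A _ _ _ (by
      rintro _ ⟨a, ha, b, -, rfl⟩
      have : (ketRight ξ).adjoint ∘L opTensor a b ∘L ketRight η = ⟪ξ, b η⟫_ℂ • a := by
        ext q
        refine ext_inner_left ℂ fun p => ?_
        have h1 : ketRight η q = elem q η := rfl
        have h2 : ketRight ξ p = elem p ξ := rfl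
        simp [ContinuousLinearMap.adjoint_inner_right, h1, h2, opTensor_elem, inner_elem,
          inner_smul_right, mul_comm]
      rw [this]
      exact A.toStarSubalgebra.smul_mem ha _) hT⟩

/-- For `c ∈ |𝓗⟩ ⊗̄ 𝓐` and `x ∈ 𝓗`, the element `E^x c` of `𝓐`. -/
def ketSlice {𝓗 : Type*} [NormedAddCommGroup 𝓗] [InnerProductSpace ℂ 𝓗]
    (A : VonNeumannAlgebra 𝔥) (x : 𝓗) {c : 𝔥 →L[ℂ] HTensor 𝓗 𝔥}
    (hc : c ∈ uwKetTensor 𝓗 (A : Set (𝔥 →L[ℂ] 𝔥))) : A.toStarSubalgebra :=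
  ⟨(ketLeft x).adjoint ∘L c, by
    have := comp_mem_of_mem_ultraweakClosure A (ContinuousLinearMap.id ℂ 𝔥)
      (ketLeft x).adjoint _ (by
        rintro _ ⟨y, -, b, hb, rfl⟩
        have : (ketLeft x).adjoint ∘L (ketLeft y ∘L b) ∘L ContinuousLinearMap.id ℂ 𝔥 =
            ⟪x, y⟫_ℂ • b := by
          ext q
          refine ext_inner_left ℂ fun p => ?_
          have h1 : ketLeft y (b q) = elem y (b q) := rfl
          have h2 : ketLeft x p = elem x p := rfl
          simp [ContinuousLinearMap.adjoint_inner_right, h1, h2, inner_elem,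
            inner_smul_right]
        rw [this]
        exact A.toStarSubalgebra.smul_mem hb _) hc
    simpa using this⟩

variable (A : VonNeumannAlgebra 𝔥)
variable (𝔨 : Type*) [NormedAddCommGroup 𝔨] [InnerProductSpace ℂ 𝔨]

/-- The von Neumann algebra `𝓐 ⊗̄ 𝓝` of operators on `𝔥 ⊗ 𝓕`, where `𝓝 = 𝓑(𝓕)`. -/
def noiseAlg : Set (HTensor 𝔥 (Noise 𝔨) →L[ℂ] HTensor 𝔥 (Noise 𝔨)) :=
  uwTensor (A : Set (𝔥 →L[ℂ] 𝔥)) (Set.univ : Set (Noise 𝔨 →L[ℂ] Noise 𝔨))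

/-- A vacuum-adapted quantum stochastic flow `j` on the von Neumann algebra `𝓐`.

Each `j_t` has the form `j_t(a) = j_{t)}(a) ⊗ |Ω_{[t}⟩⟨Ω_{[t}|` with `j_{t)}` a normal unital
`*`-homomorphism into `𝓐 ⊗̄ 𝓝_{t)}`; in terms of `j_t` itself this says that `j_t` is a normal
`*`-homomorphism into `𝓐 ⊗̄ 𝓝` with `j_t(a) = P_t j_t(a) P_t` and `j_t(1) = P_t`. (A
`*`-homomorphism is automatically completely bounded.) -/
structure QSFlow where
  toFun : ℝ≥0 → A.toStarSubalgebra →⋆ₙₐ[ℂ]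
    (HTensor 𝔥 (Noise 𝔨) →L[ℂ] HTensor 𝔥 (Noise 𝔨))
  mem_noiseAlg : ∀ t a, toFun t a ∈ noiseAlg A 𝔨
  normal : ∀ t, @Continuous _ _
    (TopologicalSpace.induced ((↑) : A.toStarSubalgebra → 𝔥 →L[ℂ] 𝔥) (ultraweakTopology 𝔥 𝔥))
    (ultraweakTopology _ _) (toFun t)
  map_zero : ∀ a, toFun 0 a =
    opTensor (a : 𝔥 →L[ℂ] 𝔥) (InnerProductSpace.rankOne ℂ (vacuum 𝔨) (vacuum 𝔨))
  adapted : ∀ t a, toFun t a = vacProj 𝔨 𝔥 t ∘L toFun t a ∘L vacProj 𝔨 𝔥 t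
  map_one : ∀ t, toFun t 1 = vacProj 𝔨 𝔥 t
  /-- The cocycle identity `j_{s+t} = ĵ_s ∘ σ_s ∘ j_t`, where `ĵ_s = j_{s)} ⊗̄ id_{[s}` and `σ_s` is
  the right shift, through matrix elements with respect to exponential vectors
  `ε(f) = ε(f|_{[0,s)}) ⊗ S_s ε(f(· + s))`: the operator `ĵ_s(σ_s(T))` is determined by
  `⟪u ε(f), ĵ_s(σ_s(T)) v ε(g)⟫ = ⟪u ε(1_{[0,s)} f), j_s(T') v ε(1_{[0,s)} g)⟫`, where
  `T' = (I ⊗ ⟨ε(f(· + s))|) T (I ⊗ |ε(g(· + s))⟩)`. -/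
  cocycle : ∀ s t a (u v : 𝔥) (f g : L2 𝔨),
    ⟪elem u (expVec f), toFun (s + t) a (elem v (expVec g))⟫_ℂ =
      ⟪elem u (expVec (trunc s f)),
        toFun s (noiseSlice A (expVec (shift s f)) (expVec (shift s g)) (mem_noiseAlg t a))
          (elem v (expVec (trunc s g)))⟫_ℂ
  continuous : ∀ a, @Continuous _ _ _ (ultraweakTopology _ _) (fun t => toFun t a)

/-! ### Processes and the quantum stochastic integral -/

/-- A bounded process in a space of operators `V` is a family of members of `V` all of whose matrix
elements are measurable functions of time. -/
structure IsProcess {X : Type*} [NormedAddCommGroup X] [InnerProductSpace ℂ X]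
    (V : Set (X →L[ℂ] X)) (Z : ℝ≥0 → X →L[ℂ] X) : Prop where
  mem : ∀ t, Z t ∈ V
  measurable : ∀ ζ' ζ : X, Measurable fun t => ⟪ζ', Z t ζ⟫_ℂ

variable {𝔨}

/-- Vacuum adaptedness of a family of operators on `𝔥 ⊗ 𝓕`. -/
def IsVacAdapted (Z : ℝ≥0 → HTensor 𝔥 (Noise 𝔨) →L[ℂ] HTensor 𝔥 (Noise 𝔨)) : Prop :=
  ∀ t, Z t = vacProj 𝔨 𝔥 t ∘L Z t ∘L vacProj 𝔨 𝔥 t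

/-- The projection `Δ = P_𝔨 ⊗ I` on `𝔨̂ ⊗ X`. -/
def Delta (𝔨 X : Type*) [NormedAddCommGroup 𝔨] [InnerProductSpace ℂ 𝔨]
    [NormedAddCommGroup X] [InnerProductSpace ℂ X] :
    HTensor (Hat 𝔨) X →L[ℂ] HTensor (Hat 𝔨) X :=
  opTensor (projK 𝔨) (ContinuousLinearMap.id ℂ X)

/-- An integrand process: a vacuum-adapted bounded process `G` in `𝓑(𝔨̂) ⊗̄ 𝓐` whose block-matrix
form `[k, m; l, n]` with respect to `𝔨̂ = ℂ ⊕ 𝔨` satisfies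
`‖k‖_{1,t} + ‖l‖_{2,t} + ‖m‖_{2,t} + ‖n‖_{∞,t} < ∞` for all `t`. -/
structure IsIntegrand [CompleteSpace 𝔨]
    (G : ℝ≥0 → HTensor (Hat 𝔨) (HTensor 𝔥 (Noise 𝔨)) →L[ℂ]
      HTensor (Hat 𝔨) (HTensor 𝔥 (Noise 𝔨))) : Prop where
  process : IsProcess (uwTensor (Set.univ : Set (Hat 𝔨 →L[ℂ] Hat 𝔨)) (noiseAlg A 𝔨)) G
  adapted : ∀ t, G t = opTensor (ContinuousLinearMap.id ℂ (Hat 𝔨)) (vacProj 𝔨 𝔥 t) ∘L G t ∘L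
    opTensor (ContinuousLinearMap.id ℂ (Hat 𝔨)) (vacProj 𝔨 𝔥 t)
  norm_lt_top : ∀ t : ℝ≥0,
    eLpNorm (fun s => ‖(ketLeft (omega 𝔨)).adjoint ∘L G s ∘L ketLeft (omega 𝔨)‖) 1
        (lebesgue.restrict (Set.Iio t)) +
      eLpNorm (fun s => ‖Delta 𝔨 _ ∘L G s ∘L ketLeft (omega 𝔨)‖) 2
        (lebesgue.restrict (Set.Iio t)) +
      eLpNorm (fun s => ‖(ketLeft (omega 𝔨)).adjoint ∘L G s ∘L Delta 𝔨 _‖) 2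
        (lebesgue.restrict (Set.Iio t)) +
      eLpNorm (fun s => ‖Delta 𝔨 _ ∘L G s ∘L Delta 𝔨 _‖) ∞
        (lebesgue.restrict (Set.Iio t)) < ∞

/-- `Z` is the quantum stochastic integral `∫ G dΛ` of the integrand process `G`: it is a
vacuum-adapted bounded process in `𝓐` such that
`⟪u ε(f), Z_t v ε(g)⟫ = ∫_0^t ⟪u ε(f), E^{f̂(s)} G_s E_{ĝ(s)} v ε(g)⟫ ds`
for all `t`, `u`, `v`, `f` and `g`, where the integrand on the right is integrable. -/
structure IsQSIntegral [CompleteSpace 𝔨]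
    (G : ℝ≥0 → HTensor (Hat 𝔨) (HTensor 𝔥 (Noise 𝔨)) →L[ℂ]
      HTensor (Hat 𝔨) (HTensor 𝔥 (Noise 𝔨)))
    (Z : ℝ≥0 → HTensor 𝔥 (Noise 𝔨) →L[ℂ] HTensor 𝔥 (Noise 𝔨)) : Prop where
  integrand : IsIntegrand A G
  process : IsProcess (noiseAlg A 𝔨) Z
  adapted : IsVacAdapted Z
  integrable : ∀ (t : ℝ≥0) (u v : 𝔥) (f g : L2 𝔨), IntegrableOn
    (fun s => ⟪elem u (expVec f), ((ketLeft (hat (f s))).adjoint ∘L G s ∘L ketLeft (hat (g s)))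
      (elem v (expVec g))⟫_ℂ) (Set.Iio t) lebesgue
  inner_eq : ∀ (t : ℝ≥0) (u v : 𝔥) (f g : L2 𝔨),
    ⟪elem u (expVec f), Z t (elem v (expVec g))⟫_ℂ =
      ∫ s in Set.Iio t, ⟪elem u (expVec f),
        ((ketLeft (hat (f s))).adjoint ∘L G s ∘L ketLeft (hat (g s)))
          (elem v (expVec g))⟫_ℂ ∂lebesgue

/-! ### The quantum stochastic differential equation -/

variable {A}

/-- The ampliation `(id_{𝓑(𝓗)} ⊗̄ φ)(T)` of `φ` at `T`: the bounded operator `S` on `𝓗 ⊗ X` that is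
determined by `E^x S E_y = φ (E^x T E_y)` for all `x, y ∈ 𝓗`. (It exists if `T ∈ 𝓑(𝓗) ⊗̄ 𝓐` and `φ`
is a normal `*`-homomorphism.) -/
def ampliation {𝓗 X : Type*} [NormedAddCommGroup 𝓗] [InnerProductSpace ℂ 𝓗]
    [NormedAddCommGroup X] [InnerProductSpace ℂ X] [CompleteSpace X]
    (φ : A.toStarSubalgebra →⋆ₙₐ[ℂ] (X →L[ℂ] X)) (T : HTensor 𝓗 𝔥 →L[ℂ] HTensor 𝓗 𝔥) :
    HTensor 𝓗 X →L[ℂ] HTensor 𝓗 X :=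
  open Classical in
  if hS : ∃ S : HTensor 𝓗 X →L[ℂ] HTensor 𝓗 X, ∀ x y : 𝓗, ∃ a : A.toStarSubalgebra,
      (a : 𝔥 →L[ℂ] 𝔥) = (ketLeft x).adjoint ∘L T ∘L ketLeft y ∧
      (ketLeft x).adjoint ∘L S ∘L ketLeft y = φ a
  then hS.choose else 0

/-- `M` is a process in `𝓐` such that `M - I` is vacuum adapted and
`M_t = I + ∫_0^t j̃_s(c E^ω) (I ⊗ M_s) dΛ_s` for all `t`, where `j̃_s = id_{𝓑(𝔨̂)} ⊗̄ j_s`. -/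
structure IsSolution [CompleteSpace 𝔨] (j : QSFlow A 𝔨) (c : 𝔥 →L[ℂ] HTensor (Hat 𝔨) 𝔥)
    (M : ℝ≥0 → HTensor 𝔥 (Noise 𝔨) →L[ℂ] HTensor 𝔥 (Noise 𝔨)) : Prop where
  process : IsProcess (noiseAlg A 𝔨) M
  adapted : IsVacAdapted fun t => M t - 1
  equation : ∃ Z, IsQSIntegral A (fun s =>
      ampliation (j.toFun s) (c ∘L (ketLeft (omega 𝔨)).adjoint) ∘L
        opTensor (ContinuousLinearMap.id ℂ (Hat 𝔨)) (M s)) Z ∧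
    ∀ t, M t = 1 + Z t

end Flow

end VacuumQSDE

end

open VacuumQSDE

/-! The integrand `j̃_s(c E^ω)(I ⊗ M_s)` ends in `E^ω`, and `⟨ω, ĝ(s)⟩ = 1`, so `ĝ(s)` disappears
from its matrix elements. The equation becomes `⟨u ε(f), (M_t - 1) η⟩ = ∫_0^t ⟨u ε(f), j_s(E^{f̂(s)}
c) M_s η⟩ ds`, a linear Volterra equation for each curve `M_t η` separately, whose right side makes
sense for arbitrary `η`, not only exponential ones.

One estimate carries the proof. Let `C_s` be the operator with `E^x C_s = j_s(E^x c)` (`column`);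
`‖C_s‖ ≤ ‖c‖` because `*`-homomorphisms are contractive. Since `j_s(a) = P_s j_s(a)`, the integrand
is `⟨f̂(s) ⊗ P_s u ε(f), C_s z_s⟩` with `z_s = M_s η`. For a finite combination `ξ` of vectors `u_i
ε(f_i)`, let `Ξ_s` be the same combination of the vectors `f̂_i(s) ⊗ P_s u_i ε(f_i)`. The Gram
kernel of `P_s ξ` is `⟨u, v⟩ exp ∫_0^s ⟨f, g⟩`, so that `‖Ξ_s‖² = ‖P_s ξ‖² + d/ds ‖P_s ξ‖²` for
almost every `s`, and therefore `∫_0^t ‖Ξ_s‖² ds ≤ (t + 1) ‖ξ‖²` (`norm_sq_hatElem_combination`).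
Cauchy–Schwarz in `s` bounds the vector defined by the integrals over `[r, t)` by `‖c‖ √(t + 1)
(∫_r^t ‖z_s‖² ds)^{1/2}` (`norm_le_of_inner_eq_integral`).

This makes the integral operator well defined on norm-continuous curves, gives its values Hölder-½
continuity in norm on bounded intervals, and halves norms weighted by `e^{lt}` once `l` is large
(`contraction_bound`). Hence the iterated integrals of `1` sum to a norm-continuous solution.
Membership in `𝓐 ⊗̄ 𝓝` is commutation with `𝓐' ⊗ I` (`mem_uwTensor_iff_commutes`), a condition that
survives the integral and the sum; so does the adaptedness from the right that is needed.

For uniqueness, an arbitrary solution is not known to be locally bounded. The `L¹` and `L²`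
conditions on its integrand, used after splitting `𝔨̂` along `ω` and `𝔨`, show that `(M_t - 1) v
ε(g)` is bounded on bounded intervals (`IsSolution.exists_norm_apply_le`). The halving estimate then
forces the difference of two solutions to vanish, and continuity passes from the constructed
solution to every solution. -/

noncomputable section

namespace VacuumQSDE

/-! ### Total families of vectors -/

section Total

variable {ι H K : Type*} [NormedAddCommGroup H] [InnerProductSpace ℂ H]
  [NormedAddCommGroup K] [InnerProductSpace ℂ K]

/-- The family `e` has dense linear span. -/
def IsTotal (e : ι → H) : Prop := (Submodule.span ℂ (Set.range e)).topologicalClosure = ⊤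

theorem IsTotal.denseRange {e : ι → H} (he : IsTotal e) :
    DenseRange (Finsupp.linearCombination ℂ e) := by
  rw [DenseRange, ← LinearMap.coe_range, Finsupp.range_linearCombination]
  exact Submodule.dense_iff_topologicalClosure_eq_top.2 he

theorem IsTotal.mem_of_closed {e : ι → H} (he : IsTotal e) (V : Submodule ℂ H)
    (hV : IsClosed (V : Set H)) (h : ∀ i, e i ∈ V) (x : H) : x ∈ V := by
  have := Submodule.topologicalClosure_minimal (Submodule.span ℂ (Set.range e))
    (Submodule.span_le.2 (Set.range_subset_iff.2 h)) hV
  rw [he] at this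
  exact this trivial

theorem IsTotal.eq_of_inner {e : ι → H} (he : IsTotal e) {x y : H}
    (h : ∀ i, ⟪e i, x⟫_ℂ = ⟪e i, y⟫_ℂ) : x = y := by
  refine ext_inner_left ℂ fun z => ?_
  have := he.mem_of_closed (LinearMap.ker (innerSL ℂ (x - y) : H →L[ℂ] ℂ).toLinearMap)
    (ContinuousLinearMap.isClosed_ker (innerSL ℂ (x - y))) (fun i => by
      have : ⟪x - y, e i⟫_ℂ = 0 := by
        rw [← inner_conj_symm, inner_sub_right, h i, sub_self, map_zero]
      simpa using this) z
  have h2 : ⟪x - y, z⟫_ℂ = 0 := by simpa using this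
  rw [← sub_eq_zero, ← inner_sub_right, ← inner_conj_symm, h2, map_zero]

theorem IsTotal.ext_clm {e : ι → H} (he : IsTotal e) {S T : H →L[ℂ] K}
    (h : ∀ i, S (e i) = T (e i)) : S = T := by
  ext x
  have := he.mem_of_closed (LinearMap.ker (S - T).toLinearMap)
    (ContinuousLinearMap.isClosed_ker (S - T)) (fun i => by simp [h i]) x
  simpa [sub_eq_zero] using this

/-- By density the bound holds against every vector, and testing against `z` itself gives `‖z‖² ≤ C
‖z‖`. -/
theorem IsTotal.norm_le_of_inner {e : ι → H} (he : IsTotal e) {z : H} {C : ℝ} (hC : 0 ≤ C)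
    (h : ∀ w : ι →₀ ℂ, ‖⟪Finsupp.linearCombination ℂ e w, z⟫_ℂ‖ ≤
      C * ‖Finsupp.linearCombination ℂ e w‖) : ‖z‖ ≤ C := by
  have h1 : ∀ x : H, ‖⟪x, z⟫_ℂ‖ ≤ C * ‖x‖ := fun x =>
    he.denseRange.induction_on x (isClosed_le (by fun_prop) (by fun_prop)) h
  have h2 := h1 z
  rw [inner_self_eq_norm_sq_to_K] at h2
  rcases (norm_nonneg z).eq_or_lt with h0 | h0
  · exact h0 ▸ hC
  · simp only [norm_pow] at h2
    have : ‖((‖z‖ : ℝ) : ℂ)‖ = ‖z‖ := by simp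
    erw [this] at h2
    nlinarith

/-- A bounded antilinear functional on a total family is represented by a vector. -/
theorem IsTotal.exists_inner_eq [CompleteSpace H] {e : ι → H} (he : IsTotal e) (q : ι → ℂ)
    {C : ℝ} (h : ∀ w : ι →₀ ℂ, ‖w.sum fun i a => (starRingEnd ℂ) a * q i‖ ≤
      C * ‖Finsupp.linearCombination ℂ e w‖) : ∃ z : H, ∀ i, ⟪e i, z⟫_ℂ = q i := by
  -- Conjugating `q` makes the functional linear. The norm bound makes its value depend only on the
  -- vector and not on its coefficients, so it extends to `H` and Riesz representation applies.
  let f : (ι →₀ ℂ) →ₗ[ℂ] ℂ := Finsupp.linearCombination ℂ fun i => (starRingEnd ℂ) (q i)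
  have hf : ∀ w, f w = (starRingEnd ℂ) (w.sum fun i a => (starRingEnd ℂ) a * q i) := by
    intro w
    simp [f, Finsupp.linearCombination_apply, Finsupp.sum]
  have hb : ∀ w, ‖f w‖ ≤ C * ‖Finsupp.linearCombination ℂ e w‖ := by
    intro w
    rw [hf, RCLike.norm_conj]
    exact h w
  let F := f.extendOfNorm (Finsupp.linearCombination ℂ e)
  refine ⟨(InnerProductSpace.toDual ℂ H).symm F, fun i => ?_⟩
  rw [← inner_conj_symm, InnerProductSpace.toDual_symm_apply]
  have := LinearMap.extendOfNorm_eq (f := f) he.denseRange ⟨C, hb⟩ (Finsupp.single i 1)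
  simp only [Finsupp.linearCombination_single, one_smul] at this
  rw [show F (e i) = f (Finsupp.single i 1) from this]
  simp [f]

theorem inner_linearCombination_left (e : ι → H) (w : ι →₀ ℂ) (z : H) :
    ⟪Finsupp.linearCombination ℂ e w, z⟫_ℂ =
      w.sum fun i a => (starRingEnd ℂ) a * ⟪e i, z⟫_ℂ := by
  simp [Finsupp.linearCombination_apply, Finsupp.sum, mul_comm]

/-- Bounded matrix elements on a total family determine a bounded operator. -/
theorem IsTotal.exists_clm [CompleteSpace H] {e : ι → H} (he : IsTotal e) (q : ι → K →ₗ[ℂ] ℂ)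
    {C : ℝ} (hC : 0 ≤ C) (h : ∀ (w : ι →₀ ℂ) (η : K), ‖w.sum fun i a => (starRingEnd ℂ) a * q i η‖ ≤
      C * ‖η‖ * ‖Finsupp.linearCombination ℂ e w‖) :
    ∃ Z : K →L[ℂ] H, ‖Z‖ ≤ C ∧ ∀ i η, ⟪e i, Z η⟫_ℂ = q i η := by
  have hex : ∀ η, ∃ z : H, ∀ i, ⟪e i, z⟫_ℂ = q i η := fun η =>
    he.exists_inner_eq (fun i => q i η) fun w => h w η
  choose F hF using hex
  let Z : K →ₗ[ℂ] H :=
    { toFun := F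
      map_add' := fun η η' => he.eq_of_inner fun i => by
        rw [inner_add_right, hF, hF, hF, map_add]
      map_smul' := fun a η => he.eq_of_inner fun i => by
        rw [RingHom.id_apply, inner_smul_right, hF, hF, map_smul, smul_eq_mul] }
  have hZ : ∀ η, ‖Z η‖ ≤ C * ‖η‖ := fun η => by
    refine he.norm_le_of_inner (by positivity) fun w => ?_
    rw [inner_linearCombination_left]
    refine le_trans (le_of_eq ?_) (h w η)
    congr 1
    exact Finset.sum_congr rfl fun i _ => congrArg _ (hF η i)
  exact ⟨Z.mkContinuous C hZ, Z.mkContinuous_norm_le hC hZ, fun i η => hF η i⟩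

end Total

/-! ### Tensor products of Hilbert spaces -/

section Tensor

variable {H K H' K' H'' K'' : Type*} [NormedAddCommGroup H] [InnerProductSpace ℂ H]
  [NormedAddCommGroup K] [InnerProductSpace ℂ K]
  [NormedAddCommGroup H'] [InnerProductSpace ℂ H']
  [NormedAddCommGroup K'] [InnerProductSpace ℂ K']
  [NormedAddCommGroup H''] [InnerProductSpace ℂ H'']
  [NormedAddCommGroup K''] [InnerProductSpace ℂ K'']

theorem ketLeft_apply (x : H) (y : K) : ketLeft x y = elem x y := rfl

theorem ketRight_apply (x : H) (y : K) : ketRight y x = elem x y := rfl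

theorem elem_smul_left (z : ℂ) (x : H) (y : K) : elem (z • x) y = z • elem x y := by
  simp only [← ketRight_apply, map_smul]

theorem elem_smul_right (z : ℂ) (x : H) (y : K) : elem x (z • y) = z • elem x y := by
  simp only [← ketLeft_apply, map_smul]

theorem norm_elem (x : H) (y : K) : ‖elem x y‖ = ‖x‖ * ‖y‖ := by
  simp [elem, ketLeft]

theorem isTotal_elem_all : IsTotal fun p : H × K => elem p.1 p.2 := by
  refine Submodule.dense_iff_topologicalClosure_eq_top.1 ?_
  refine (UniformSpace.Completion.denseRange_coe (α := H ⊗[ℂ] K)).mono ?_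
  rintro _ ⟨t, rfl⟩
  induction t with
  | zero => rw [UniformSpace.Completion.coe_zero]; exact zero_mem _
  | tmul x y => exact Submodule.subset_span ⟨(x, y), rfl⟩
  | add s t hs ht =>
    rw [UniformSpace.Completion.coe_add]
    exact add_mem hs ht

theorem IsTotal.elem {ι κ : Type*} {e : ι → H} {f : κ → K} (he : IsTotal e) (hf : IsTotal f) :
    IsTotal fun p : ι × κ => elem (e p.1) (f p.2) := by
  set V := (Submodule.span ℂ (Set.range fun p : ι × κ =>
    VacuumQSDE.elem (e p.1) (f p.2))).topologicalClosure with hV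
  have hVc : IsClosed (V : Set (HTensor H K)) := Submodule.isClosed_topologicalClosure _
  have h1 : ∀ i y, VacuumQSDE.elem (e i) y ∈ V := fun i y =>
    hf.mem_of_closed (V.comap (ketLeft (e i)).toLinearMap)
      (hVc.preimage (ketLeft (e i)).continuous)
      (fun k => Submodule.le_topologicalClosure _ (Submodule.subset_span ⟨(i, k), rfl⟩)) y
  have h2 : ∀ x y, VacuumQSDE.elem x y ∈ V := fun x y =>
    he.mem_of_closed (V.comap (ketRight y).toLinearMap)
      (hVc.preimage (ketRight y).continuous) (fun i => h1 i y) x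
  exact top_le_iff.1 fun x _ => isTotal_elem_all.mem_of_closed V hVc (fun p => h2 p.1 p.2) x

theorem norm_ketLeft_le (x : H) : ‖(ketLeft x : K →L[ℂ] HTensor H K)‖ ≤ ‖x‖ :=
  ContinuousLinearMap.opNorm_le_bound _ (norm_nonneg _) fun y => by
    rw [ketLeft_apply, norm_elem]

theorem norm_opTensor_le (a : H →L[ℂ] H') (b : K →L[ℂ] K') :
    ‖opTensor a b‖ ≤ ‖a‖ * ‖b‖ := by
  refine ContinuousLinearMap.opNorm_le_bound _ (by positivity) fun x => ?_
  refine UniformSpace.Completion.induction_on x (isClosed_le (by fun_prop) (by fun_prop)) ?_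
  intro t
  have h : opTensor a b (t : HTensor H K) = ((TensorProduct.mapL a b t : H' ⊗[ℂ] K') :
    HTensor H' K') := by simp [opTensor]
  rw [h, UniformSpace.Completion.norm_coe, UniformSpace.Completion.norm_coe]
  exact (ContinuousLinearMap.le_opNorm _ _).trans
    (mul_le_mul_of_nonneg_right (TensorProduct.norm_mapL_le a b) (norm_nonneg _))

theorem opTensor_comp (a : H →L[ℂ] H') (b : K →L[ℂ] K') (a' : H' →L[ℂ] H'')
    (b' : K' →L[ℂ] K'') : opTensor a' b' ∘L opTensor a b = opTensor (a' ∘L a) (b' ∘L b) :=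
  isTotal_elem_all.ext_clm fun p => by simp [opTensor_elem]

theorem opTensor_adjoint [CompleteSpace H] [CompleteSpace K] [CompleteSpace H']
    [CompleteSpace K'] (a : H →L[ℂ] H') (b : K →L[ℂ] K') :
    (opTensor a b).adjoint = opTensor a.adjoint b.adjoint :=
  isTotal_elem_all.ext_clm fun p => isTotal_elem_all.eq_of_inner fun q => by
    simp [ContinuousLinearMap.adjoint_inner_right, opTensor_elem, inner_elem]

theorem ketLeft_adjoint_elem [CompleteSpace K] (x y : H) (z : K) :
    (ketLeft x).adjoint (elem y z) = ⟪x, y⟫_ℂ • z := by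
  refine ext_inner_left ℂ fun p => ?_
  rw [ContinuousLinearMap.adjoint_inner_right, ketLeft_apply, inner_elem, inner_smul_right]

theorem ketLeft_adjoint_comp_ketLeft [CompleteSpace K] (x y : H) :
    (ketLeft x).adjoint ∘L ketLeft y = ⟪x, y⟫_ℂ • ContinuousLinearMap.id ℂ K := by
  ext z
  simp [ketLeft_apply, ketLeft_adjoint_elem]

end Tensor

/-! ### Membership in ultraweak closures -/

section Ultraweak

open Filter Topology

variable {H K : Type*} [NormedAddCommGroup H] [InnerProductSpace ℂ H]
  [NormedAddCommGroup K] [InnerProductSpace ℂ K]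

/-- A bounded net that converges weakly converges ultraweakly. -/
theorem mem_ultraweakClosure_of_tendsto {α : Type*} {l : Filter α} [l.NeBot]
    {F : α → H →L[ℂ] K} {T : H →L[ℂ] K} {S : Set (H →L[ℂ] K)} {C : ℝ} (hC : ∀ a, ‖F a‖ ≤ C)
    (hF : ∀ x y, Tendsto (fun a => ⟪y, F a x⟫_ℂ) l (𝓝 ⟪y, T x⟫_ℂ)) (hS : ∀ a, F a ∈ S) :
    T ∈ ultraweakClosure S := by
  let _ := ultraweakTopology H K
  refine mem_closure_of_tendsto (f := F) (b := l) ?_ (Eventually.of_forall hS)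
  rw [nhds_iInf, tendsto_iInf]
  intro x
  rw [nhds_iInf, tendsto_iInf]
  intro y
  rw [nhds_iInf, tendsto_iInf]
  intro hx
  rw [nhds_iInf, tendsto_iInf]
  intro hy
  rw [nhds_induced, tendsto_comap_iff]
  -- The uniform bound and `‖x‖ ‖y‖ ≤ ‖x‖² + ‖y‖²` give a dominating series for the exchange of
  -- limit and sum.
  have hxy : Summable fun n => C * (‖x n‖ * ‖y n‖) := by
    refine Summable.mul_left _ ?_
    refine Summable.of_nonneg_of_le (fun n => by positivity) (fun n => ?_) (hx.add hy)
    nlinarith [sq_nonneg (‖x n‖ - ‖y n‖), sq_nonneg ‖x n‖, sq_nonneg ‖y n‖]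
  refine tendsto_tsum_of_dominated_convergence hxy (fun n => hF (x n) (y n)) ?_
  refine Eventually.of_forall fun a n => ?_
  calc ‖⟪y n, F a (x n)⟫_ℂ‖ ≤ ‖y n‖ * ‖F a (x n)‖ := norm_inner_le_norm _ _
    _ ≤ ‖y n‖ * (C * ‖x n‖) := by
      gcongr
      exact (F a).le_of_opNorm_le (hC a) _
    _ = _ := by ring

/-- The vectors at which `Q a x → x` form a subspace, closed by an `ε/3` argument because the `Q a`
are contractions. -/
theorem IsTotal.tendsto_of_norm_le_one {ι α : Type*} {l : Filter α} {e : ι → H} (he : IsTotal e)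
    {Q : α → H →L[ℂ] H} (hQ : ∀ a, ‖Q a‖ ≤ 1)
    (h : ∀ i, Tendsto (fun a => Q a (e i)) l (𝓝 (e i))) (x : H) :
    Tendsto (fun a => Q a x) l (𝓝 x) := by
  let V : Submodule ℂ H :=
    { carrier := {x | Tendsto (fun a => Q a x) l (𝓝 x)}
      add_mem' := fun {x y} hx hy => by
        simp only [Set.mem_ofPred_eq, map_add] at *
        exact hx.add hy
      zero_mem' := by
        simp only [Set.mem_ofPred_eq, map_zero]
        exact tendsto_const_nhds
      smul_mem' := fun z x hx => by
        simp only [Set.mem_ofPred_eq, map_smul] at *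
        exact hx.const_smul z }
  refine he.mem_of_closed V ?_ h x
  refine isClosed_of_closure_subset fun x hx => ?_
  refine Metric.tendsto_nhds.2 fun ε hε => ?_
  obtain ⟨y, hy, hxy⟩ := Metric.mem_closure_iff.1 hx (ε / 3) (by positivity)
  filter_upwards [Metric.tendsto_nhds.1 (show Tendsto (fun a => Q a y) l (𝓝 y) from hy) (ε / 3)
    (by positivity)] with a ha
  have h1 : dist (Q a x) (Q a y) ≤ dist x y := by
    rw [dist_eq_norm, dist_eq_norm, ← map_sub]
    simpa using (Q a).le_of_opNorm_le (hQ a) (x - y)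
  calc dist (Q a x) x ≤ dist (Q a x) (Q a y) + dist (Q a y) y + dist y x := dist_triangle4 _ _ _ _
    _ < ε := by rw [dist_comm y x]; linarith

/-- The compressions `Q T Q` are bounded by `‖T‖` and converge weakly to `T`: self-adjointness moves
one `Q` to the other argument, and both arguments converge in norm. -/
theorem mem_ultraweakClosure_of_compressions [CompleteSpace H] {ι α : Type*} {l : Filter α}
    [l.NeBot] {e : ι → H} (he : IsTotal e) {Q : α → H →L[ℂ] H} (hQ : ∀ a, ‖Q a‖ ≤ 1)
    (hQs : ∀ a, (Q a).adjoint = Q a) (h : ∀ i, Tendsto (fun a => Q a (e i)) l (𝓝 (e i)))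
    {T : H →L[ℂ] H} {S : Set (H →L[ℂ] H)} (hS : ∀ a, Q a ∘L T ∘L Q a ∈ S) :
    T ∈ ultraweakClosure S := by
  refine mem_ultraweakClosure_of_tendsto (l := l) (F := fun a => Q a ∘L T ∘L Q a) (C := ‖T‖)
    (fun a => ?_) (fun x y => ?_) hS
  · calc ‖Q a ∘L T ∘L Q a‖ ≤ ‖Q a‖ * (‖T‖ * ‖Q a‖) :=
          (ContinuousLinearMap.opNorm_comp_le _ _).trans
            (by gcongr; exact ContinuousLinearMap.opNorm_comp_le _ _)
      _ ≤ 1 * (‖T‖ * 1) := by gcongr <;> exact hQ a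
      _ = ‖T‖ := by ring
  · have h1 := he.tendsto_of_norm_le_one hQ h
    have h2 : ∀ a, ⟪y, (Q a ∘L T ∘L Q a) x⟫_ℂ = ⟪Q a y, T (Q a x)⟫_ℂ := fun a => by
      nth_rw 2 [← hQs a]
      simp [← ContinuousLinearMap.adjoint_inner_right, hQs]
    simp only [h2]
    exact (h1 y).inner ((T.continuous.tendsto x).comp (h1 x))

end Ultraweak

/-! ### Finite-rank coordinate projections -/

section CoordProj

open Filter Topology InnerProductSpace

variable {κ X : Type*} [NormedAddCommGroup X] [InnerProductSpace ℂ X]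

/-- The projection onto the span of finitely many members of an orthonormal family. -/
def coordProj (e : κ → X) (F : Finset κ) : X →L[ℂ] X :=
  ∑ k ∈ F, rankOne ℂ (e k) (e k)

theorem coordProj_apply (e : κ → X) (F : Finset κ) (x : X) :
    coordProj e F x = ∑ k ∈ F, ⟪e k, x⟫_ℂ • e k := by
  simp [coordProj]

theorem norm_coordProj_le {e : κ → X} (he : Orthonormal ℂ e) (F : Finset κ) : ‖coordProj e F‖ ≤ 1 := by
  refine ContinuousLinearMap.opNorm_le_bound _ zero_le_one fun x => ?_
  rw [one_mul, coordProj_apply]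
  refine (sq_le_sq₀ (norm_nonneg _) (norm_nonneg _)).1 ?_
  refine le_trans (le_of_eq ?_) (he.sum_inner_products_le x (s := F))
  rw [norm_sq_eq_re_inner (𝕜 := ℂ), he.inner_sum, map_sum]
  refine Finset.sum_congr rfl fun k _ => ?_
  rw [RCLike.conj_mul]
  norm_cast

theorem coordProj_adjoint [CompleteSpace X] (e : κ → X) (F : Finset κ) :
    (coordProj e F).adjoint = coordProj e F := by
  refine ContinuousLinearMap.ext fun x => ext_inner_left ℂ fun y => ?_
  rw [ContinuousLinearMap.adjoint_inner_right, coordProj_apply, coordProj_apply]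
  simp [sum_inner, inner_sum, inner_smul_left, inner_smul_right, mul_comm]

theorem tendsto_coordProj (e : HilbertBasis κ ℂ X) (x : X) :
    Tendsto (fun F => coordProj e F x) atTop (𝓝 x) := by
  simp only [coordProj_apply]
  have := e.hasSum_repr x
  simpa [HasSum, HilbertBasis.repr_apply_apply] using this

end CoordProj

/-! ### Ultraweak tensor products with the algebra of all bounded operators -/

section Slices

open Filter Topology InnerProductSpace

variable {h X : Type*} [NormedAddCommGroup h] [InnerProductSpace ℂ h] [CompleteSpace h]
  [NormedAddCommGroup X] [InnerProductSpace ℂ X] [CompleteSpace X]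

/-- Compression by a finite-rank coordinate projection in the first leg turns `T` into the finite
sum of `|e_k⟩⟨e_l| ⊗ E^{e_k} T E_{e_l}`, which lies in the algebraic span. -/
theorem mem_uwTensor_univ_of_slices {V : Set (X →L[ℂ] X)}
    {T : HTensor h X →L[ℂ] HTensor h X}
    (hT : ∀ x y : h, (ketLeft x).adjoint ∘L T ∘L ketLeft y ∈ V) :
    T ∈ uwTensor (Set.univ : Set (h →L[ℂ] h)) V := by
  obtain ⟨w, e, -⟩ := exists_hilbertBasis ℂ h
  refine mem_ultraweakClosure_of_compressions (l := atTop) isTotal_elem_all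
    (Q := fun F => opTensor (coordProj e F) (ContinuousLinearMap.id ℂ X)) (fun F => ?_)
    (fun F => ?_) (fun p => ?_) fun F => ?_
  · refine (norm_opTensor_le _ _).trans ?_
    exact mul_le_one₀ (norm_coordProj_le e.orthonormal F) (norm_nonneg _) ContinuousLinearMap.norm_id_le
  · rw [opTensor_adjoint, coordProj_adjoint, ContinuousLinearMap.adjoint_id]
  · simp only [opTensor_elem]
    exact ((ketRight p.2).continuous.tendsto p.1).comp (tendsto_coordProj e p.1)
  · have : opTensor (coordProj e F) (ContinuousLinearMap.id ℂ X) ∘L T ∘L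
        opTensor (coordProj e F) (ContinuousLinearMap.id ℂ X) =
        ∑ k ∈ F, ∑ l ∈ F, opTensor (rankOne ℂ (e k) (e l))
          ((ketLeft (e k)).adjoint ∘L T ∘L ketLeft (e l)) := by
      refine isTotal_elem_all.ext_clm fun p => isTotal_elem_all.eq_of_inner fun q => ?_
      have hQ : ∀ p : h × X, opTensor (coordProj e F) (ContinuousLinearMap.id ℂ X)
          (elem p.1 p.2) = ∑ k ∈ F, ⟪e k, p.1⟫_ℂ • elem (e k) p.2 := by
        intro p
        rw [opTensor_elem, coordProj_apply, ← ketRight_apply]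
        simp [ketRight_apply]
      have h1 : ⟪elem q.1 q.2, (opTensor (coordProj e F) (ContinuousLinearMap.id ℂ X) ∘L T ∘L
          opTensor (coordProj e F) (ContinuousLinearMap.id ℂ X)) (elem p.1 p.2)⟫_ℂ =
          ⟪opTensor (coordProj e F) (ContinuousLinearMap.id ℂ X) (elem q.1 q.2),
            T (opTensor (coordProj e F) (ContinuousLinearMap.id ℂ X) (elem p.1 p.2))⟫_ℂ := by
        rw [← ContinuousLinearMap.adjoint_inner_right, opTensor_adjoint, coordProj_adjoint,
          ContinuousLinearMap.adjoint_id]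
        rfl
      rw [h1, hQ, hQ]
      simp only [map_sum, map_smul, sum_inner, inner_sum, inner_smul_left, inner_smul_right,
        sum_apply, opTensor_elem, rankOne_apply, elem_smul_left, inner_elem,
        ContinuousLinearMap.comp_apply, ContinuousLinearMap.adjoint_inner_right, ketLeft_apply,
        inner_conj_symm, Finset.mul_sum]
      rw [Finset.sum_comm]
    rw [this]
    exact Submodule.sum_mem _ fun k _ => Submodule.sum_mem _ fun l _ =>
      Submodule.subset_span ⟨_, trivial, _, hT _ _, rfl⟩

/-- The same compression argument, carried out in the second leg. -/
theorem mem_uwTensor_of_slices {V : Set (h →L[ℂ] h)}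
    {T : HTensor h X →L[ℂ] HTensor h X}
    (hT : ∀ x y : X, (ketRight x).adjoint ∘L T ∘L ketRight y ∈ V) :
    T ∈ uwTensor V (Set.univ : Set (X →L[ℂ] X)) := by
  obtain ⟨w, e, -⟩ := exists_hilbertBasis ℂ X
  refine mem_ultraweakClosure_of_compressions (l := atTop) isTotal_elem_all
    (Q := fun F => opTensor (ContinuousLinearMap.id ℂ h) (coordProj e F)) (fun F => ?_)
    (fun F => ?_) (fun p => ?_) fun F => ?_
  · refine (norm_opTensor_le _ _).trans ?_
    exact mul_le_one₀ ContinuousLinearMap.norm_id_le (norm_nonneg _) (norm_coordProj_le e.orthonormal F)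
  · rw [opTensor_adjoint, coordProj_adjoint, ContinuousLinearMap.adjoint_id]
  · simp only [opTensor_elem]
    exact ((ketLeft p.1).continuous.tendsto p.2).comp (tendsto_coordProj e p.2)
  · have : opTensor (ContinuousLinearMap.id ℂ h) (coordProj e F) ∘L T ∘L
        opTensor (ContinuousLinearMap.id ℂ h) (coordProj e F) =
        ∑ k ∈ F, ∑ l ∈ F, opTensor ((ketRight (e k)).adjoint ∘L T ∘L ketRight (e l))
          (rankOne ℂ (e k) (e l)) := by
      refine isTotal_elem_all.ext_clm fun p => isTotal_elem_all.eq_of_inner fun q => ?_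
      have hQ : ∀ p : h × X, opTensor (ContinuousLinearMap.id ℂ h) (coordProj e F)
          (elem p.1 p.2) = ∑ k ∈ F, ⟪e k, p.2⟫_ℂ • elem p.1 (e k) := by
        intro p
        rw [opTensor_elem, coordProj_apply, ← ketLeft_apply]
        simp [ketLeft_apply]
      have h1 : ⟪elem q.1 q.2, (opTensor (ContinuousLinearMap.id ℂ h) (coordProj e F) ∘L T ∘L
          opTensor (ContinuousLinearMap.id ℂ h) (coordProj e F)) (elem p.1 p.2)⟫_ℂ =
          ⟪opTensor (ContinuousLinearMap.id ℂ h) (coordProj e F) (elem q.1 q.2),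
            T (opTensor (ContinuousLinearMap.id ℂ h) (coordProj e F) (elem p.1 p.2))⟫_ℂ := by
        rw [← ContinuousLinearMap.adjoint_inner_right, opTensor_adjoint, coordProj_adjoint,
          ContinuousLinearMap.adjoint_id]
        rfl
      rw [h1, hQ, hQ]
      simp only [map_sum, map_smul, sum_inner, inner_sum, inner_smul_left, inner_smul_right,
        sum_apply, opTensor_elem, rankOne_apply, elem_smul_right, inner_elem,
        ContinuousLinearMap.comp_apply, ContinuousLinearMap.adjoint_inner_right, ketRight_apply,
        inner_conj_symm, Finset.mul_sum]
      rw [Finset.sum_comm]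
      refine Finset.sum_congr rfl fun k _ => Finset.sum_congr rfl fun l _ => ?_
      ring
    rw [this]
    exact Submodule.sum_mem _ fun k _ => Submodule.sum_mem _ fun l _ =>
      Submodule.subset_span ⟨_, hT _ _, _, trivial, rfl⟩

/-- The commutation theorem for `𝓐 ⊗̄ 𝓑(X)`: it is the commutant of `𝓐' ⊗ I`. -/
theorem mem_uwTensor_iff_commutes (A : VonNeumannAlgebra h)
    {T : HTensor h X →L[ℂ] HTensor h X} :
    T ∈ uwTensor (A : Set (h →L[ℂ] h)) (Set.univ : Set (X →L[ℂ] X)) ↔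
      ∀ b ∈ A.commutant, opTensor b (ContinuousLinearMap.id ℂ X) ∘L T =
        T ∘L opTensor b (ContinuousLinearMap.id ℂ X) := by
  refine ⟨fun hT b hb => ?_, fun hT => ?_⟩
  -- Commutation with `b ⊗ I` is linear in `T` and is expressed by ultraweakly continuous
  -- functionals, so it passes from elementary tensors to the closure.
  · have hspan : ∀ T ∈ Submodule.span ℂ (Set.image2 opTensor (A : Set (h →L[ℂ] h))
        (Set.univ : Set (X →L[ℂ] X))), opTensor b (ContinuousLinearMap.id ℂ X) ∘L T =
        T ∘L opTensor b (ContinuousLinearMap.id ℂ X) := by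
      intro T hT
      induction hT using Submodule.span_induction with
      | mem T hT =>
        obtain ⟨a, ha, d, -, rfl⟩ := hT
        rw [opTensor_comp, opTensor_comp]
        have := VonNeumannAlgebra.mem_commutant_iff.1 hb a ha
        congr 1
        exact this.symm
      | zero => simp
      | add T T' _ _ h1 h2 => rw [ContinuousLinearMap.comp_add, h1, h2, ContinuousLinearMap.add_comp]
      | smul z T _ h1 => rw [ContinuousLinearMap.comp_smul, h1, ContinuousLinearMap.smul_comp]
    refine ContinuousLinearMap.ext fun q => ext_inner_left ℂ fun p => ?_
    set B := opTensor b (ContinuousLinearMap.id ℂ X)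
    have key : ∀ T : HTensor h X →L[ℂ] HTensor h X, ⟪p, (B ∘L T) q⟫_ℂ = ⟪B.adjoint p, T q⟫_ℂ :=
      fun T => by rw [ContinuousLinearMap.adjoint_inner_left]; rfl
    have key' : ∀ T : HTensor h X →L[ℂ] HTensor h X, ⟪p, (T ∘L B) q⟫_ℂ = ⟪p, T (B q)⟫_ℂ :=
      fun T => rfl
    rw [key, key']
    let _ := ultraweakTopology (HTensor h X) (HTensor h X)
    refine (isClosed_eq (continuous_ultraweak_inner q (B.adjoint p))
      (continuous_ultraweak_inner (B q) p)).closure_subset_iff.2 ?_ hT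
    intro T hT
    simp only [Set.mem_ofPred_eq]
    rw [← key, ← key', hspan T hT]
  · refine mem_uwTensor_of_slices fun x y => ?_
    -- Slices of `T` in the second leg commute with `𝓐'`, hence lie in `𝓐` by the double commutant
    -- property.
    rw [← A.centralizer_centralizer]
    intro b hb
    have hb' : b ∈ A.commutant := VonNeumannAlgebra.mem_commutant_iff.2 hb
    have hT' := hT b hb'
    refine ContinuousLinearMap.ext fun q => ext_inner_left ℂ fun p => ?_
    have h1 : ketRight y (b q) = opTensor b (ContinuousLinearMap.id ℂ X) (ketRight y q) := by
      simp [ketRight_apply, opTensor_elem]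
    have h2 : ketRight x (b.adjoint p) =
        (opTensor b (ContinuousLinearMap.id ℂ X)).adjoint (ketRight x p) := by
      rw [opTensor_adjoint, ContinuousLinearMap.adjoint_id]
      simp [ketRight_apply, opTensor_elem]
    change ⟪p, b ((ketRight x).adjoint (T (ketRight y q)))⟫_ℂ =
      ⟪p, (ketRight x).adjoint (T (ketRight y (b q)))⟫_ℂ
    rw [← ContinuousLinearMap.adjoint_inner_left, ContinuousLinearMap.adjoint_inner_right,
      ContinuousLinearMap.adjoint_inner_right, h1, h2, ContinuousLinearMap.adjoint_inner_left]
    exact congrArg (fun S : HTensor h X →L[ℂ] HTensor h X => ⟪ketRight x p, S (ketRight y q)⟫_ℂ) hT'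

end Slices

/-! ### Lebesgue measure on the half-line -/

section Lebesgue

open Set

variable {E : Type*} [NormedAddCommGroup E]

theorem measurableEmbedding_coe : MeasurableEmbedding ((↑) : ℝ≥0 → ℝ) :=
  MeasurableEmbedding.subtype_coe measurableSet_Ici

theorem map_coe_lebesgue : lebesgue.map ((↑) : ℝ≥0 → ℝ) = volume.restrict (Ici 0) := by
  rw [lebesgue, measurableEmbedding_coe.map_comap]
  congr 1
  ext x
  exact ⟨fun ⟨y, hy⟩ => hy ▸ y.coe_nonneg, fun hx => ⟨⟨x, hx⟩, rfl⟩⟩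

theorem map_coe_lebesgue_restrict (t : ℝ≥0) :
    (lebesgue.restrict (Iio t)).map ((↑) : ℝ≥0 → ℝ) = volume.restrict (Ico 0 (t : ℝ)) := by
  have h : (Iio t : Set ℝ≥0) = ((↑) : ℝ≥0 → ℝ) ⁻¹' Iio (t : ℝ) := by
    ext; simp
  rw [h, ← measurableEmbedding_coe.restrict_map, map_coe_lebesgue,
    Measure.restrict_restrict measurableSet_Iio, inter_comm, Ici_inter_Iio]

/-- Transfers integrals to the real line, where the fundamental theorem of calculus is available. -/
theorem setIntegral_Iio [NormedSpace ℝ E] (t : ℝ≥0) (φ : ℝ≥0 → E) :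
    ∫ s in Iio t, φ s ∂lebesgue = ∫ x in (0 : ℝ)..t, φ x.toNNReal := by
  rw [intervalIntegral.integral_of_le t.coe_nonneg, ← integral_Ico_eq_integral_Ioc,
    ← map_coe_lebesgue_restrict, measurableEmbedding_coe.integral_map]
  simp

theorem integrableOn_Iio_iff (t : ℝ≥0) (φ : ℝ≥0 → E) :
    IntegrableOn φ (Iio t) lebesgue ↔
      IntervalIntegrable (fun x : ℝ => φ x.toNNReal) volume 0 t := by
  rw [intervalIntegrable_iff_integrableOn_Ico_of_le t.coe_nonneg, IntegrableOn, IntegrableOn,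
    ← map_coe_lebesgue_restrict, measurableEmbedding_coe.integrable_map_iff]
  have : (fun x : ℝ => φ x.toNNReal) ∘ ((↑) : ℝ≥0 → ℝ) = φ := by
    ext; simp
  rw [this]

theorem lebesgue_Ico (r t : ℝ≥0) : lebesgue (Ico r t) = ENNReal.ofReal (t - r) := by
  rw [lebesgue, measurableEmbedding_coe.comap_apply, ← Real.volume_Ico]
  congr 1
  ext x
  constructor
  · rintro ⟨s, hs, rfl⟩
    exact ⟨NNReal.coe_le_coe.2 hs.1, NNReal.coe_lt_coe.2 hs.2⟩
  · intro hx
    exact ⟨⟨x, r.coe_nonneg.trans hx.1⟩, ⟨hx.1, hx.2⟩, rfl⟩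

theorem Iio_eq_Ico (t : ℝ≥0) : (Iio t : Set ℝ≥0) = Ico 0 t := by
  ext; simp

theorem lebesgue_Iio (t : ℝ≥0) : lebesgue (Iio t) = t := by
  rw [Iio_eq_Ico, lebesgue_Ico]; simp

instance (t : ℝ≥0) : IsFiniteMeasure (lebesgue.restrict (Iio t)) :=
  ⟨by rw [Measure.restrict_apply_univ, lebesgue_Iio]; exact ENNReal.coe_lt_top⟩

end Lebesgue

/-! ### The exponential of an indefinite integral -/

section FTC

open Set Filter Topology AbsolutelyContinuousOnInterval

theorem AbsolutelyContinuousOnInterval.of_dist_le {X Y : Type*} [PseudoMetricSpace X]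
    [PseudoMetricSpace Y] {f : ℝ → X} {g : ℝ → Y} {a b C : ℝ}
    (hf : AbsolutelyContinuousOnInterval f a b)
    (h : ∀ x ∈ uIcc a b, ∀ y ∈ uIcc a b, dist (g x) (g y) ≤ C * dist (f x) (f y)) :
    AbsolutelyContinuousOnInterval g a b := by
  rw [absolutelyContinuousOnInterval_iff] at hf ⊢
  intro ε hε
  -- The constant `|C| + 1` dominates `C` and is positive even when `C ≤ 0`.
  obtain ⟨δ, hδ, H⟩ := hf (ε / (|C| + 1)) (by positivity)
  refine ⟨δ, hδ, fun E hE hd => ?_⟩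
  have h1 := H E hE hd
  calc ∑ i ∈ Finset.range E.1, dist (g (E.2 i).1) (g (E.2 i).2)
      ≤ ∑ i ∈ Finset.range E.1, (|C| + 1) * dist (f (E.2 i).1) (f (E.2 i).2) := by
        refine Finset.sum_le_sum fun i hi => ?_
        refine (h _ (hE.1 i hi).1 _ (hE.1 i hi).2).trans ?_
        gcongr
        linarith [le_abs_self C]
    _ < ε := by
        rw [← Finset.mul_sum]
        rwa [lt_div_iff₀' (by positivity)] at h1

/-- Here `φ` is merely integrable, so the chain rule for `exp Φ`, `Φ = ∫ φ`, holds only almost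
everywhere. The difference of `exp Φ` and `∫ φ exp Φ` is absolutely continuous with derivative zero
almost everywhere, hence constant. -/
theorem integral_mul_exp_integral {φ : ℝ → ℂ} {T : ℝ} (hT : 0 ≤ T)
    (hφ : IntervalIntegrable φ volume 0 T) :
    IntervalIntegrable (fun x => φ x * Complex.exp (∫ y in (0 : ℝ)..x, φ y)) volume 0 T ∧
    ∫ x in (0 : ℝ)..T, φ x * Complex.exp (∫ y in (0 : ℝ)..x, φ y) =
      Complex.exp (∫ y in (0 : ℝ)..T, φ y) - 1 := by
  set Φ : ℝ → ℂ := fun x => ∫ y in (0 : ℝ)..x, φ y with hΦ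
  set R : ℝ := ∫ y in (0 : ℝ)..T, ‖φ y‖ with hR
  have hsub : ∀ x ∈ uIcc 0 T, ∀ y ∈ uIcc 0 T, IntervalIntegrable φ volume x y :=
    fun x hx y hy => hφ.mono_set (uIcc_subset_uIcc hx hy)
  have hdiff : ∀ {f : ℝ → ℂ}, IntervalIntegrable f volume 0 T → ∀ x ∈ uIcc 0 T, ∀ y ∈ uIcc 0 T,
      (∫ v in (0 : ℝ)..x, f v) - ∫ v in (0 : ℝ)..y, f v = ∫ v in y..x, f v := by
    intro f hf x hx y hy
    exact intervalIntegral.integral_interval_sub_left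
      (hf.mono_set (uIcc_subset_uIcc left_mem_uIcc hx))
      (hf.mono_set (uIcc_subset_uIcc left_mem_uIcc hy))
  have hdiffn : ∀ x ∈ uIcc 0 T, ∀ y ∈ uIcc 0 T,
      (∫ v in (0 : ℝ)..x, ‖φ v‖) - ∫ v in (0 : ℝ)..y, ‖φ v‖ = ∫ v in y..x, ‖φ v‖ := by
    intro x hx y hy
    exact intervalIntegral.integral_interval_sub_left
      (hφ.norm.mono_set (uIcc_subset_uIcc left_mem_uIcc hx))
      (hφ.norm.mono_set (uIcc_subset_uIcc left_mem_uIcc hy))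
  have hΦd : ∀ x ∈ uIcc 0 T, ∀ y ∈ uIcc 0 T, ‖Φ x - Φ y‖ ≤
      dist (∫ v in (0 : ℝ)..x, ‖φ v‖) (∫ v in (0 : ℝ)..y, ‖φ v‖) := by
    intro x hx y hy
    rw [hΦ, hdiff hφ x hx y hy, Real.dist_eq, hdiffn x hx y hy]
    exact intervalIntegral.norm_integral_le_abs_integral_norm
  have hΦb : ∀ x ∈ uIcc 0 T, ‖Φ x‖ ≤ R := by
    intro x hx
    rw [uIcc_of_le hT] at hx
    calc ‖Φ x‖ ≤ ∫ v in (0 : ℝ)..x, ‖φ v‖ :=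
          intervalIntegral.norm_integral_le_integral_norm hx.1
      _ ≤ R := by
          refine intervalIntegral.integral_mono_interval le_rfl hx.1 hx.2 ?_ hφ.norm
          exact Eventually.of_forall fun _ => norm_nonneg _
  have hexp : ∀ z ∈ Metric.closedBall (0 : ℂ) R, ∀ w ∈ Metric.closedBall (0 : ℂ) R,
      ‖Complex.exp z - Complex.exp w‖ ≤ Real.exp R * ‖z - w‖ := by
    intro z hz w hw
    refine Convex.norm_image_sub_le_of_norm_deriv_le (f := Complex.exp)
      (fun x _ => Complex.differentiable_exp x) (fun x hx => ?_) (convex_closedBall 0 R) hw hz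
    rw [Complex.deriv_exp, Complex.norm_exp]
    exact Real.exp_le_exp.2 ((Complex.re_le_norm x).trans (by simpa using hx))
  have hΦc : ContinuousOn Φ (uIcc 0 T) :=
    intervalIntegral.continuousOn_primitive_interval' hφ left_mem_uIcc
  set ψ : ℝ → ℂ := fun x => φ x * Complex.exp (Φ x) with hψ
  have hψi : IntervalIntegrable ψ volume 0 T :=
    hφ.mul_continuousOn (Complex.continuous_exp.comp_continuousOn hΦc)
  refine ⟨hψi, ?_⟩
  have hψn : ∀ x ∈ uIcc 0 T, ‖ψ x‖ ≤ Real.exp R * ‖φ x‖ := by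
    intro x hx
    rw [hψ, norm_mul, mul_comm, Complex.norm_exp]
    gcongr
    exact (Complex.re_le_norm _).trans (hΦb x hx)
  have hψd : ∀ x ∈ uIcc 0 T, ∀ y ∈ uIcc 0 T, ‖∫ v in y..x, ψ v‖ ≤
      Real.exp R * dist (∫ v in (0 : ℝ)..x, ‖φ v‖) (∫ v in (0 : ℝ)..y, ‖φ v‖) := by
    intro x hx y hy
    rw [Real.dist_eq, hdiffn x hx y hy]
    refine (intervalIntegral.norm_integral_le_abs_of_norm_le (g := fun v => Real.exp R * ‖φ v‖)
      ?_ ((hsub y hy x hx).norm.const_mul _)).trans_eq ?_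
    · refine (ae_restrict_iff' measurableSet_uIoc).2 (Eventually.of_forall fun v hv => hψn v ?_)
      exact uIcc_subset_uIcc hy hx (uIoc_subset_uIcc hv)
    · rw [intervalIntegral.integral_const_mul, abs_mul, Real.abs_exp]
  have hac : AbsolutelyContinuousOnInterval
      (fun x => Complex.exp (Φ x) - ∫ v in (0 : ℝ)..x, ψ v) 0 T := by
    -- Increments are compared with those of `∫ ‖φ‖`. One `exp R` is the Lipschitz constant of `exp`
    -- on the ball of radius `R` that contains the values of `Φ`; the other bounds the factor `exp
    -- Φ` in `ψ`.
    refine AbsolutelyContinuousOnInterval.of_dist_le (C := 2 * Real.exp R)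
      (hφ.norm.absolutelyContinuousOnInterval_intervalIntegral left_mem_uIcc) ?_
    intro x hx y hy
    rw [dist_eq_norm]
    have e0 : (Complex.exp (Φ x) - ∫ v in (0 : ℝ)..x, ψ v) -
        (Complex.exp (Φ y) - ∫ v in (0 : ℝ)..y, ψ v) =
        (Complex.exp (Φ x) - Complex.exp (Φ y)) - ∫ v in y..x, ψ v := by
      rw [← hdiff hψi x hx y hy]; ring
    have e1 := norm_sub_le (Complex.exp (Φ x) - Complex.exp (Φ y)) (∫ v in y..x, ψ v)
    have e2 := hexp _ (by simpa using hΦb x hx) _ (by simpa using hΦb y hy)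
    have e3 := mul_le_mul_of_nonneg_left (hΦd x hx y hy) (Real.exp_pos R).le
    rw [e0]
    linarith [hψd x hx y hy]
  obtain ⟨c, hc⟩ := hac.const_of_ae_hasDerivAt_zero (by
    filter_upwards [hφ.ae_hasDerivAt_integral, hψi.ae_hasDerivAt_integral] with x h1 h2 hx
    have h3 := (h1 hx 0 left_mem_uIcc).cexp.sub (h2 hx 0 left_mem_uIcc)
    exact h3.congr_deriv (by simp only [hψ, hΦ]; ring))
  have h0 := hc 0 left_mem_uIcc
  have h1 := hc T right_mem_uIcc
  simp only [hΦ, intervalIntegral.integral_same, Complex.exp_zero, sub_zero] at h0 h1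
  rw [← h0] at h1
  linear_combination -h1

end FTC

/-! ### Exponential vectors and the vacuum projections -/

section Exponential

open Set Filter

set_option linter.unusedSectionVars false

variable {𝔥 𝔨 : Type*} [NormedAddCommGroup 𝔥] [InnerProductSpace ℂ 𝔥]
  [NormedAddCommGroup 𝔨] [InnerProductSpace ℂ 𝔨]

theorem coeFn_trunc (t : ℝ≥0) (f : L2 𝔨) :
    trunc t f =ᵐ[lebesgue] (Iio t).indicator f := MemLp.coeFn_toLp _

theorem inner_trunc_left [CompleteSpace 𝔨] (t : ℝ≥0) (f g : L2 𝔨) :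
    ⟪trunc t f, g⟫_ℂ = ∫ s in Iio t, ⟪f s, g s⟫_ℂ ∂lebesgue := by
  rw [L2.inner_def, ← integral_indicator measurableSet_Iio]
  refine integral_congr_ae ?_
  filter_upwards [coeFn_trunc t f] with s hs
  rw [hs]
  by_cases h : s ∈ Iio t <;> simp [h]

theorem inner_trunc_trunc [CompleteSpace 𝔨] (t : ℝ≥0) (f g : L2 𝔨) :
    ⟪trunc t f, trunc t g⟫_ℂ = ∫ s in Iio t, ⟪f s, g s⟫_ℂ ∂lebesgue := by
  rw [inner_trunc_left]
  refine setIntegral_congr_ae measurableSet_Iio ?_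
  filter_upwards [coeFn_trunc t g] with s hs h
  rw [hs]
  simp [h]

theorem trunc_trunc (s t : ℝ≥0) (f : L2 𝔨) : trunc s (trunc t f) = trunc (min s t) f := by
  refine Lp.ext ?_
  filter_upwards [coeFn_trunc s (trunc t f), coeFn_trunc t f, coeFn_trunc (min s t) f]
    with r h1 h2 h3
  rw [h1, h3, indicator_apply, h2, indicator_apply, indicator_apply]
  by_cases hs : r < s <;> by_cases ht : r < t <;> simp [hs, ht]

theorem isTotal_expVec : IsTotal (expVec : L2 𝔨 → Noise 𝔨) := span_expVec_dense

/-- The exponential vectors `u ε(f)` in `𝔥 ⊗ 𝓕`. -/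
def expElem (i : 𝔥 × L2 𝔨) : HTensor 𝔥 (Noise 𝔨) := elem i.1 (expVec i.2)

theorem isTotal_id : IsTotal (fun x : 𝔥 => x) := by
  rw [IsTotal]
  have : Set.range (fun x : 𝔥 => x) = Set.univ := Set.range_id
  rw [this, Submodule.span_univ]
  exact top_le_iff.1 (Submodule.le_topologicalClosure _)

theorem isTotal_expElem : IsTotal (expElem : 𝔥 × L2 𝔨 → HTensor 𝔥 (Noise 𝔨)) :=
  isTotal_id.elem isTotal_expVec

/-- If `g` lives on `[0, t)`, then `⟨f, g⟩` sees only the truncation of `f`, so `ε(f) - ε(1_{[0,t)}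
f)` is orthogonal to every such `ε(g)`. -/
theorem starProjection_pastSpace_expVec [CompleteSpace 𝔨] (t : ℝ≥0) (f : L2 𝔨) :
    (pastSpace 𝔨 t).starProjection (expVec f) = expVec (trunc t f) := by
  refine Submodule.eq_starProjection_of_mem_of_inner_eq_zero ?_ ?_
  · refine Submodule.le_topologicalClosure _ (Submodule.subset_span ⟨_, ?_, rfl⟩)
    filter_upwards [coeFn_trunc t f] with s hs hts
    rw [hs]
    simp [hts]
  · intro ξ hξ
    have hle : pastSpace 𝔨 t ≤ LinearMap.ker
        (innerSL ℂ (expVec f - expVec (trunc t f)) : Noise 𝔨 →L[ℂ] ℂ).toLinearMap := by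
      refine Submodule.topologicalClosure_minimal _ (Submodule.span_le.2 ?_)
        (ContinuousLinearMap.isClosed_ker (innerSL ℂ (expVec f - expVec (trunc t f))))
      rintro _ ⟨g, hg, rfl⟩
      have h1 : ⟪f, g⟫_ℂ = ⟪trunc t f, g⟫_ℂ := by
        rw [inner_trunc_left, L2.inner_def, ← integral_indicator measurableSet_Iio]
        refine integral_congr_ae ?_
        filter_upwards [hg] with s hs
        by_cases h : s ∈ Iio t
        · simp [h]
        · simp [h, hs (not_lt.1 h)]
      simp [inner_expVec, h1]
    simpa [inner_sub_left] using hle hξ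

theorem vacProj_expElem [CompleteSpace 𝔨] (t : ℝ≥0) (i : 𝔥 × L2 𝔨) :
    vacProj 𝔨 𝔥 t (expElem i) = expElem (i.1, trunc t i.2) := by
  rw [expElem, vacProj, opTensor_elem, starProjection_pastSpace_expVec]
  rfl

theorem norm_vacProj_le (t : ℝ≥0) : ‖vacProj 𝔨 𝔥 t‖ ≤ 1 :=
  (norm_opTensor_le _ _).trans
    (mul_le_one₀ ContinuousLinearMap.norm_id_le (norm_nonneg _)
      (Submodule.starProjection_norm_le _))

theorem vacProj_adjoint [CompleteSpace 𝔥] (t : ℝ≥0) :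
    (vacProj 𝔨 𝔥 t).adjoint = vacProj 𝔨 𝔥 t := by
  rw [vacProj, opTensor_adjoint, ContinuousLinearMap.adjoint_id]
  congr 1
  exact (isSelfAdjoint_starProjection _)

theorem vacProj_comp_vacProj [CompleteSpace 𝔨] (s t : ℝ≥0) :
    vacProj 𝔨 𝔥 s ∘L vacProj 𝔨 𝔥 t = vacProj 𝔨 𝔥 (min s t) :=
  isTotal_expElem.ext_clm fun i => by
    simp [vacProj_expElem, trunc_trunc]

theorem inner_vacProj_expElem [CompleteSpace 𝔨] (t : ℝ≥0) (i k : 𝔥 × L2 𝔨) :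
    ⟪vacProj 𝔨 𝔥 t (expElem i), vacProj 𝔨 𝔥 t (expElem k)⟫_ℂ =
      ⟪i.1, k.1⟫_ℂ * Complex.exp (∫ s in Iio t, ⟪i.2 s, k.2 s⟫_ℂ ∂lebesgue) := by
  rw [vacProj_expElem, vacProj_expElem, expElem, expElem, inner_elem, inner_expVec,
    inner_trunc_trunc]

theorem inner_hat (x y : 𝔨) : ⟪hat x, hat y⟫_ℂ = 1 + ⟪x, y⟫_ℂ := by
  simp [hat, WithLp.prod_inner_apply]

theorem norm_hat_sq (x : 𝔨) : ‖hat x‖ ^ 2 = 1 + ‖x‖ ^ 2 := by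
  rw [← Complex.ofReal_inj]
  have h1 := inner_self_eq_norm_sq_to_K (𝕜 := ℂ) (hat x)
  have h2 := inner_self_eq_norm_sq_to_K (𝕜 := ℂ) x
  rw [inner_hat, h2] at h1
  push_cast
  exact h1.symm

theorem norm_omega : ‖omega 𝔨‖ = 1 := by
  have := norm_hat_sq (0 : 𝔨)
  rw [norm_zero] at this
  have h0 := norm_nonneg (hat (0 : 𝔨))
  have h1 : ‖hat (0 : 𝔨)‖ = 1 := by nlinarith
  exact h1

/-! ### The square function of a combination of exponential vectors -/

/-- The vectors `f̂(s) ⊗ P_s u ε(f)`. -/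
def hatElem (s : ℝ≥0) (i : 𝔥 × L2 𝔨) : HTensor (Hat 𝔨) (HTensor 𝔥 (Noise 𝔨)) :=
  elem (hat (i.2 s)) (vacProj 𝔨 𝔥 s (expElem i))

/-- The first term is the Gram kernel of the vectors `P_s u ε(f)`; the second is its derivative in
`s`, for almost every `s`. -/
theorem inner_hatElem (s : ℝ≥0) (i k : 𝔥 × L2 𝔨) :
    ⟪hatElem s i, hatElem s k⟫_ℂ =
      ⟪vacProj 𝔨 𝔥 s (expElem i), vacProj 𝔨 𝔥 s (expElem k)⟫_ℂ +
      ⟪i.2 s, k.2 s⟫_ℂ * ⟪vacProj 𝔨 𝔥 s (expElem i), vacProj 𝔨 𝔥 s (expElem k)⟫_ℂ := by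
  rw [hatElem, hatElem, inner_elem, inner_hat]
  ring

theorem integrableOn_inner_L2 (f g : L2 𝔨) (t : ℝ≥0) :
    IntegrableOn (fun s => ⟪f s, g s⟫_ℂ) (Iio t) lebesgue :=
  (L2.integrable_inner f g).integrableOn

theorem setIntegral_inner_mul_exp (f g : L2 𝔨) (t : ℝ≥0) :
    IntegrableOn (fun s => Complex.exp (∫ r in Iio s, ⟪f r, g r⟫_ℂ ∂lebesgue)) (Iio t) lebesgue ∧
    IntegrableOn (fun s => ⟪f s, g s⟫_ℂ *
      Complex.exp (∫ r in Iio s, ⟪f r, g r⟫_ℂ ∂lebesgue)) (Iio t) lebesgue ∧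
    ∫ s in Iio t, ⟪f s, g s⟫_ℂ * Complex.exp (∫ r in Iio s, ⟪f r, g r⟫_ℂ ∂lebesgue) ∂lebesgue =
      Complex.exp (∫ r in Iio t, ⟪f r, g r⟫_ℂ ∂lebesgue) - 1 := by
  have hφ := (integrableOn_Iio_iff t _).1 (integrableOn_inner_L2 f g t)
  have h := integral_mul_exp_integral t.coe_nonneg hφ
  have e : ∀ x ∈ uIcc (0 : ℝ) t, ∫ r in Iio x.toNNReal, ⟪f r, g r⟫_ℂ ∂lebesgue =
      ∫ y in (0 : ℝ)..x, ⟪f y.toNNReal, g y.toNNReal⟫_ℂ := by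
    intro x hx
    rw [uIcc_of_le t.coe_nonneg] at hx
    rw [setIntegral_Iio, Real.coe_toNNReal _ hx.1]
  have hc : ContinuousOn (fun x : ℝ => Complex.exp (∫ y in (0 : ℝ)..x,
      ⟪f y.toNNReal, g y.toNNReal⟫_ℂ)) (uIcc (0 : ℝ) t) :=
    Complex.continuous_exp.comp_continuousOn
      (intervalIntegral.continuousOn_primitive_interval' hφ left_mem_uIcc)
  refine ⟨(integrableOn_Iio_iff t _).2 ?_, (integrableOn_Iio_iff t _).2 ?_, ?_⟩
  · refine hc.intervalIntegrable.congr fun x hx => ?_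
    rw [e x (uIoc_subset_uIcc hx)]
  · refine h.1.congr fun x hx => ?_
    rw [e x (uIoc_subset_uIcc hx)]
  · rw [setIntegral_Iio, setIntegral_Iio, ← h.2]
    refine intervalIntegral.integral_congr fun x hx => ?_
    simp only [e x hx]

theorem inner_linearCombination_self {ι H : Type*} [NormedAddCommGroup H] [InnerProductSpace ℂ H]
    (v : ι → H) (w : ι →₀ ℂ) : ((‖Finsupp.linearCombination ℂ v w‖ ^ 2 : ℝ) : ℂ) =
      ∑ i ∈ w.support, ∑ k ∈ w.support, (starRingEnd ℂ) (w i) * w k * ⟪v i, v k⟫_ℂ := by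
  have := inner_self_eq_norm_sq_to_K (𝕜 := ℂ) (Finsupp.linearCombination ℂ v w)
  push_cast
  refine this.symm.trans ?_
  simp only [Finsupp.linearCombination_apply, Finsupp.sum, sum_inner, inner_sum, inner_smul_left,
    inner_smul_right]
  simp only [Finset.mul_sum]
  rw [Finset.sum_comm]
  refine Finset.sum_congr rfl fun i _ => Finset.sum_congr rfl fun k _ => ?_
  ring

set_option maxHeartbeats 1000000 in
-- Integrating the Gram kernel gives the energy identity `∫_0^t ‖Ξ_s‖² = ∫_0^t ‖P_s ξ‖² + ‖P_t ξ‖² -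
-- ‖P_0 ξ‖²`, and each `P_s` is a contraction. The bound involves only `t` and `‖ξ‖`, not the
-- functions or the number of terms in `ξ`; this is what allows it to define operators.
theorem norm_sq_hatElem_combination [CompleteSpace 𝔨] (w : 𝔥 × L2 𝔨 →₀ ℂ) (t : ℝ≥0) :
    IntegrableOn (fun s => ‖Finsupp.linearCombination ℂ (hatElem s) w‖ ^ 2) (Iio t) lebesgue ∧
    ∫ s in Iio t, ‖Finsupp.linearCombination ℂ (hatElem s) w‖ ^ 2 ∂lebesgue ≤
      (t + 1) * ‖Finsupp.linearCombination ℂ expElem w‖ ^ 2 := by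
  set ξ := Finsupp.linearCombination ℂ (expElem (𝔥 := 𝔥) (𝔨 := 𝔨)) w with hξ
  have hP : ∀ s, ‖vacProj 𝔨 𝔥 s ξ‖ ^ 2 ≤ ‖ξ‖ ^ 2 := fun s => by
    gcongr
    simpa using (vacProj 𝔨 𝔥 s).le_of_opNorm_le (norm_vacProj_le s) ξ
  have hPξ : ∀ s, ((‖vacProj 𝔨 𝔥 s ξ‖ ^ 2 : ℝ) : ℂ) = ∑ i ∈ w.support, ∑ k ∈ w.support,
      (starRingEnd ℂ) (w i) * w k *
        (⟪i.1, k.1⟫_ℂ * Complex.exp (∫ s in Iio s, ⟪i.2 s, k.2 s⟫_ℂ ∂lebesgue)) := by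
    intro s
    have : vacProj 𝔨 𝔥 s ξ = Finsupp.linearCombination ℂ
        (fun i => vacProj 𝔨 𝔥 s (expElem i)) w := by
      rw [hξ, Finsupp.linearCombination_apply, Finsupp.linearCombination_apply, Finsupp.sum,
        Finsupp.sum, map_sum]
      simp only [map_smul]
    rw [this, inner_linearCombination_self]
    simp only [inner_vacProj_expElem]
  have hΞ : ∀ s, ((‖Finsupp.linearCombination ℂ (hatElem s) w‖ ^ 2 : ℝ) : ℂ) =
      ((‖vacProj 𝔨 𝔥 s ξ‖ ^ 2 : ℝ) : ℂ) + ∑ i ∈ w.support, ∑ k ∈ w.support,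
      (starRingEnd ℂ) (w i) * w k * ⟪i.1, k.1⟫_ℂ *
        (⟪i.2 s, k.2 s⟫_ℂ * Complex.exp (∫ s in Iio s, ⟪i.2 s, k.2 s⟫_ℂ ∂lebesgue)) := by
    intro s
    rw [inner_linearCombination_self, hPξ, ← Finset.sum_add_distrib]
    refine Finset.sum_congr rfl fun i _ => ?_
    rw [← Finset.sum_add_distrib]
    refine Finset.sum_congr rfl fun k _ => ?_
    rw [inner_hatElem, inner_vacProj_expElem]
    ring
  have hI1 : IntegrableOn (fun s => ((‖vacProj 𝔨 𝔥 s ξ‖ ^ 2 : ℝ) : ℂ)) (Iio t) lebesgue := by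
    simp only [hPξ]
    exact integrable_finsetSum _ fun i _ => integrable_finsetSum _ fun k _ =>
      ((setIntegral_inner_mul_exp i.2 k.2 t).1.const_mul _).const_mul _
  have hI2 : IntegrableOn (fun s => ∑ i ∈ w.support, ∑ k ∈ w.support,
      (starRingEnd ℂ) (w i) * w k * ⟪i.1, k.1⟫_ℂ *
        (⟪i.2 s, k.2 s⟫_ℂ * Complex.exp (∫ s in Iio s, ⟪i.2 s, k.2 s⟫_ℂ ∂lebesgue)))
      (Iio t) lebesgue :=
    integrable_finsetSum _ fun i _ => integrable_finsetSum _ fun k _ =>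
      (setIntegral_inner_mul_exp i.2 k.2 t).2.1.const_mul _
  have hI : IntegrableOn (fun s => ((‖Finsupp.linearCombination ℂ (hatElem s) w‖ ^ 2 : ℝ) : ℂ))
      (Iio t) lebesgue := by
    simp only [hΞ]
    exact hI1.add hI2
  have hint : ((∫ s in Iio t, ‖Finsupp.linearCombination ℂ (hatElem s) w‖ ^ 2 ∂lebesgue : ℝ) : ℂ) =
      ((∫ s in Iio t, ‖vacProj 𝔨 𝔥 s ξ‖ ^ 2 ∂lebesgue : ℝ) : ℂ) +
        (((‖vacProj 𝔨 𝔥 t ξ‖ ^ 2 : ℝ) : ℂ) - ((‖vacProj 𝔨 𝔥 0 ξ‖ ^ 2 : ℝ) : ℂ)) := by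
    rw [← integral_complex_ofReal, ← integral_complex_ofReal]
    simp only [hΞ]
    rw [integral_add hI1 hI2, integral_finsetSum _ fun i _ => integrable_finsetSum _ fun k _ =>
      (setIntegral_inner_mul_exp i.2 k.2 t).2.1.const_mul _, hPξ, hPξ, ← Finset.sum_sub_distrib]
    congr 1
    refine Finset.sum_congr rfl fun i _ => ?_
    rw [integral_finsetSum _ fun k _ =>
      (setIntegral_inner_mul_exp i.2 k.2 t).2.1.const_mul _, ← Finset.sum_sub_distrib]
    refine Finset.sum_congr rfl fun k _ => ?_
    rw [integral_const_mul, (setIntegral_inner_mul_exp i.2 k.2 t).2.2]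
    have : (Iio 0 : Set ℝ≥0) = ∅ := by ext; simp
    rw [this]
    simp
    ring
  have hre : IntegrableOn (fun s => ‖vacProj 𝔨 𝔥 s ξ‖ ^ 2) (Iio t) lebesgue := by
    have := hI1.re
    simp only [RCLike.re_to_complex, Complex.ofReal_re] at this
    exact this
  have hre' := hI.re
  simp only [RCLike.re_to_complex, Complex.ofReal_re] at hre'
  refine ⟨hre', ?_⟩
  have hint' : ∫ s in Iio t, ‖Finsupp.linearCombination ℂ (hatElem s) w‖ ^ 2 ∂lebesgue =
      (∫ s in Iio t, ‖vacProj 𝔨 𝔥 s ξ‖ ^ 2 ∂lebesgue) +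
        (‖vacProj 𝔨 𝔥 t ξ‖ ^ 2 - ‖vacProj 𝔨 𝔥 0 ξ‖ ^ 2) := by exact_mod_cast hint
  have h1 : ∫ s in Iio t, ‖vacProj 𝔨 𝔥 s ξ‖ ^ 2 ∂lebesgue ≤ t * ‖ξ‖ ^ 2 := by
    refine (integral_mono hre (integrable_const (‖ξ‖ ^ 2)) hP).trans_eq ?_
    simp [Measure.real, lebesgue_Iio]
  rw [hint']
  nlinarith [hP t, sq_nonneg ‖vacProj 𝔨 𝔥 0 ξ‖]

end Exponential

/-! ### Ampliation of a column -/

section Column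

open InnerProductSpace

variable {𝔥 𝓗 X : Type*} [NormedAddCommGroup 𝔥] [InnerProductSpace ℂ 𝔥] [CompleteSpace 𝔥]
  [NormedAddCommGroup 𝓗] [InnerProductSpace ℂ 𝓗]
  [NormedAddCommGroup X] [InnerProductSpace ℂ X] [CompleteSpace X]
  {A : VonNeumannAlgebra 𝔥} (φ : A.toStarSubalgebra →⋆ₙₐ[ℂ] (X →L[ℂ] X))

theorem isClosed_vonNeumann (A : VonNeumannAlgebra 𝔥) :
    IsClosed (A.toStarSubalgebra : Set (𝔥 →L[ℂ] 𝔥)) := by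
  rw [VonNeumannAlgebra.coe_toStarSubalgebra, ← A.centralizer_centralizer]
  exact Set.isClosed_centralizer _

theorem norm_starHom_le (a : A.toStarSubalgebra) : ‖φ a‖ ≤ ‖(a : 𝔥 →L[ℂ] 𝔥)‖ := by
  -- Norm closedness makes `𝓐` a C⋆-algebra, on which `*`-homomorphisms are contractive.
  have : IsClosed (A.toStarSubalgebra : Set (𝔥 →L[ℂ] 𝔥)) := isClosed_vonNeumann A
  exact NonUnitalStarAlgHom.norm_apply_le φ a

theorem coe_ketSlice (x : 𝓗) {c : 𝔥 →L[ℂ] HTensor 𝓗 𝔥}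
    (hc : c ∈ uwKetTensor 𝓗 (A : Set (𝔥 →L[ℂ] 𝔥))) :
    (ketSlice A x hc : 𝔥 →L[ℂ] 𝔥) = (ketLeft x).adjoint ∘L c := rfl

theorem norm_starHom_ketSlice_le (x : 𝓗) {c : 𝔥 →L[ℂ] HTensor 𝓗 𝔥}
    (hc : c ∈ uwKetTensor 𝓗 (A : Set (𝔥 →L[ℂ] 𝔥))) :
    ‖φ (ketSlice A x hc)‖ ≤ ‖x‖ * ‖c‖ := by
  refine (norm_starHom_le φ _).trans ((ContinuousLinearMap.opNorm_comp_le _ _).trans ?_)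
  rw [LinearIsometryEquiv.norm_map]
  gcongr
  exact norm_ketLeft_le x

/-- The sum of the `φ(a_k)* φ(a_k)` is `φ` of the sum of the `a_k* a_k`, so contractivity of `φ`
alone controls whole columns. -/
theorem sum_norm_sq_starHom_le {κ : Type*} (F : Finset κ) (a : κ → A.toStarSubalgebra) (ψ : X) :
    ∑ k ∈ F, ‖φ (a k) ψ‖ ^ 2 ≤
      ‖∑ k ∈ F, ContinuousLinearMap.adjoint (a k : 𝔥 →L[ℂ] 𝔥) ∘L (a k : 𝔥 →L[ℂ] 𝔥)‖ *
        ‖ψ‖ ^ 2 := by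
  have h1 : ∀ k, ((‖φ (a k) ψ‖ ^ 2 : ℝ) : ℂ) = ⟪ψ, φ (star (a k) * a k) ψ⟫_ℂ := by
    intro k
    have := inner_self_eq_norm_sq_to_K (𝕜 := ℂ) (φ (a k) ψ)
    push_cast
    refine this.symm.trans ?_
    rw [map_mul, map_star, ContinuousLinearMap.star_eq_adjoint]
    exact (ContinuousLinearMap.adjoint_inner_right _ _ _).symm
  have h2 : ((∑ k ∈ F, ‖φ (a k) ψ‖ ^ 2 : ℝ) : ℂ) =
      ⟪ψ, φ (∑ k ∈ F, star (a k) * a k) ψ⟫_ℂ := by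
    rw [Complex.ofReal_sum]
    simp only [h1, map_sum, sum_apply, inner_sum]
  have h3 : ((∑ k ∈ F, star (a k) * a k : A.toStarSubalgebra) : 𝔥 →L[ℂ] 𝔥) =
      ∑ k ∈ F, ContinuousLinearMap.adjoint (a k : 𝔥 →L[ℂ] 𝔥) ∘L (a k : 𝔥 →L[ℂ] 𝔥) := by
    rw [AddSubmonoidClass.coe_finsetSum]
    rfl
  rw [← h3]
  have h4 : ‖((∑ k ∈ F, ‖φ (a k) ψ‖ ^ 2 : ℝ) : ℂ)‖ = ∑ k ∈ F, ‖φ (a k) ψ‖ ^ 2 := by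
    rw [Complex.norm_real, Real.norm_of_nonneg (by positivity)]
  rw [← h4, h2]
  calc _ ≤ ‖ψ‖ * ‖φ (∑ k ∈ F, star (a k) * a k) ψ‖ := norm_inner_le_norm _ _
    _ ≤ ‖ψ‖ * (_ * ‖ψ‖) := by
      gcongr
      exact (φ _).le_of_opNorm_le (norm_starHom_le φ _) ψ
    _ = _ := by ring

variable {φ} in
-- Bessel's inequality for columns: the sum is `c* (Q ⊗ I) c` with `Q` a coordinate projection.
theorem norm_sum_ketSlice_le {κ : Type*} {e : κ → 𝓗} (he : Orthonormal ℂ e) (F : Finset κ)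
    (c : 𝔥 →L[ℂ] HTensor 𝓗 𝔥) :
    ‖∑ k ∈ F, ContinuousLinearMap.adjoint ((ketLeft (e k)).adjoint ∘L c) ∘L
      ((ketLeft (e k)).adjoint ∘L c)‖ ≤ ‖c‖ ^ 2 := by
  have h1 : ∑ k ∈ F, ketLeft (e k) ∘L (ketLeft (e k)).adjoint =
      opTensor (coordProj e F) (ContinuousLinearMap.id ℂ 𝔥) := by
    refine isTotal_elem_all.ext_clm fun p => ?_
    rw [opTensor_elem, coordProj_apply, ← ketRight_apply (∑ k ∈ F, ⟪e k, p.1⟫_ℂ • e k),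
      map_sum]
    simp [ketRight_apply, ketLeft_adjoint_elem, ketLeft_apply, sum_apply]
  have h2 : ∑ k ∈ F, ContinuousLinearMap.adjoint ((ketLeft (e k)).adjoint ∘L c) ∘L
      ((ketLeft (e k)).adjoint ∘L c) =
      c.adjoint ∘L (∑ k ∈ F, ketLeft (e k) ∘L (ketLeft (e k)).adjoint) ∘L c := by
    ext v
    simp [ContinuousLinearMap.adjoint_comp, sum_apply]
  rw [h2, h1]
  calc _ ≤ ‖c.adjoint‖ * (‖opTensor (coordProj e F) (ContinuousLinearMap.id ℂ 𝔥)‖ * ‖c‖) :=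
        (ContinuousLinearMap.opNorm_comp_le _ _).trans
          (by gcongr; exact ContinuousLinearMap.opNorm_comp_le _ _)
    _ ≤ ‖c‖ * (1 * ‖c‖) := by
      rw [LinearIsometryEquiv.norm_map]
      gcongr
      exact (norm_opTensor_le _ _).trans (mul_le_one₀ (norm_coordProj_le he F) (norm_nonneg _)
        ContinuousLinearMap.norm_id_le)
    _ = _ := by ring

variable {c : 𝔥 →L[ℂ] HTensor 𝓗 𝔥} (hc : c ∈ uwKetTensor 𝓗 (A : Set (𝔥 →L[ℂ] 𝔥)))

/-- Only finitely many `x ∈ 𝓗` occur in `w`. In an orthonormal basis of their span the column at `ψ`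
is the finite sum `z` of the vectors `e_k ⊗ φ(E^{e_k} c) ψ`, and `‖z‖ ≤ ‖c‖ ‖ψ‖` by
`sum_norm_sq_starHom_le` and `norm_sum_ketSlice_le`. -/
theorem norm_sum_inner_starHom_le (w : 𝓗 × X →₀ ℂ) (ψ : X) :
    ‖w.sum fun p a => (starRingEnd ℂ) a * ⟪p.2, φ (ketSlice A p.1 hc) ψ⟫_ℂ‖ ≤
      ‖c‖ * ‖ψ‖ * ‖Finsupp.linearCombination ℂ (fun p : 𝓗 × X => elem p.1 p.2) w‖ := by
  classical
  let V : Submodule ℂ 𝓗 := Submodule.span ℂ ((w.support.image Prod.fst : Finset 𝓗) : Set 𝓗)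
  have : FiniteDimensional ℂ V := FiniteDimensional.span_finset ℂ _
  let b := stdOrthonormalBasis ℂ V
  let e : _ → 𝓗 := fun k => (b k : 𝓗)
  have he : Orthonormal ℂ e := b.orthonormal.comp_linearIsometry V.subtypeₗᵢ
  have hV : ∀ x ∈ V, x = ∑ k, ⟪e k, x⟫_ℂ • e k := by
    intro x hx
    have := congrArg (Subtype.val) (b.sum_repr' ⟨x, hx⟩)
    rw [Submodule.coe_sum] at this
    exact this.symm
  let z : HTensor 𝓗 X := ∑ k, elem (e k) (φ (ketSlice A (e k) hc) ψ)
  have hz : ∀ x ∈ V, ∀ p : X, ⟪elem x p, z⟫_ℂ = ⟪p, φ (ketSlice A x hc) ψ⟫_ℂ := by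
    intro x hx p
    have h1 : ketSlice A x hc = ∑ k, ⟪x, e k⟫_ℂ • ketSlice A (e k) hc := by
      refine Subtype.ext ?_
      rw [AddSubmonoidClass.coe_finsetSum]
      refine ContinuousLinearMap.ext fun v => ext_inner_left ℂ fun u => ?_
      simp only [sum_apply, inner_sum]
      have h2 : ∀ y : 𝓗, ⟪u, (ketSlice A y hc : 𝔥 →L[ℂ] 𝔥) v⟫_ℂ = ⟪elem y u, c v⟫_ℂ := by
        intro y
        rw [coe_ketSlice, ContinuousLinearMap.comp_apply,
          ContinuousLinearMap.adjoint_inner_right, ketLeft_apply]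
      rw [h2, hV x hx, ← ketRight_apply, map_sum, sum_inner]
      refine Finset.sum_congr rfl fun k _ => ?_
      rw [map_smul, inner_smul_left, inner_conj_symm, ketRight_apply, ← h2, ← hV x hx]
      exact (inner_smul_right _ _ _).symm
    rw [h1, map_sum, sum_apply, inner_sum, inner_sum]
    refine Finset.sum_congr rfl fun k _ => ?_
    rw [inner_elem, map_smul]
    exact (inner_smul_right _ _ _).symm
  have hzn : ‖z‖ ≤ ‖c‖ * ‖ψ‖ := by
    refine (sq_le_sq₀ (norm_nonneg _) (by positivity)).1 ?_
    have h1 : ‖z‖ ^ 2 = ∑ k, ‖φ (ketSlice A (e k) hc) ψ‖ ^ 2 := by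
      rw [← Complex.ofReal_inj]
      have := inner_self_eq_norm_sq_to_K (𝕜 := ℂ) z
      push_cast
      refine this.symm.trans ?_
      simp only [z, sum_inner]
      refine Finset.sum_congr rfl fun k _ => ?_
      rw [hz _ (b k).2]
      exact inner_self_eq_norm_sq_to_K (𝕜 := ℂ) _
    rw [h1, mul_pow]
    refine (sum_norm_sq_starHom_le φ _ _ ψ).trans ?_
    gcongr
    exact norm_sum_ketSlice_le he _ c
  have hsum : (w.sum fun p a => (starRingEnd ℂ) a * ⟪p.2, φ (ketSlice A p.1 hc) ψ⟫_ℂ) =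
      ⟪Finsupp.linearCombination ℂ (fun p : 𝓗 × X => elem p.1 p.2) w, z⟫_ℂ := by
    rw [inner_linearCombination_left]
    refine Finset.sum_congr rfl fun p hp => ?_
    change _ * _ = _ * ⟪elem p.1 p.2, z⟫_ℂ
    rw [hz]
    exact Submodule.subset_span (by
      simp only [Finset.coe_image]
      exact ⟨p, hp, rfl⟩)
  rw [hsum, mul_comm]
  exact (norm_inner_le_norm _ _).trans (by gcongr)

theorem exists_column : ∃ C : X →L[ℂ] HTensor 𝓗 X, ‖C‖ ≤ ‖c‖ ∧ ∀ (p : 𝓗 × X) (q : X),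
    ⟪elem p.1 p.2, C q⟫_ℂ = ⟪p.2, φ (ketSlice A p.1 hc) q⟫_ℂ :=
  isTotal_elem_all.exists_clm
    (fun p => (innerSL ℂ p.2 ∘L φ (ketSlice A p.1 hc) : X →L[ℂ] ℂ).toLinearMap)
    (norm_nonneg c) fun w ψ => norm_sum_inner_starHom_le φ hc w ψ

/-- The ampliation of `φ` at the column `c`: the operator `C` with `E^x C = φ (E^x c)` for all
`x`. -/
def column : X →L[ℂ] HTensor 𝓗 X := (exists_column φ hc).choose

theorem inner_column (x : 𝓗) (p q : X) :
    ⟪elem x p, column φ hc q⟫_ℂ = ⟪p, φ (ketSlice A x hc) q⟫_ℂ :=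
  (exists_column φ hc).choose_spec.2 (x, p) q

theorem norm_column_le : ‖column φ hc‖ ≤ ‖c‖ := (exists_column φ hc).choose_spec.1

theorem ketLeft_adjoint_comp_column (x : 𝓗) :
    (ketLeft x).adjoint ∘L column φ hc = φ (ketSlice A x hc) :=
  ContinuousLinearMap.ext fun q => ext_inner_left ℂ fun p => by
    rw [ContinuousLinearMap.comp_apply, ContinuousLinearMap.adjoint_inner_right, ketLeft_apply,
      inner_column]

theorem ampliation_column (ω : 𝓗) :
    ampliation φ (c ∘L (ketLeft ω).adjoint) = column φ hc ∘L (ketLeft ω).adjoint := by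
  have hslice : ∀ (x y : 𝓗), ((⟪ω, y⟫_ℂ • ketSlice A x hc : A.toStarSubalgebra) : 𝔥 →L[ℂ] 𝔥) =
      (ketLeft x).adjoint ∘L (c ∘L (ketLeft ω).adjoint) ∘L ketLeft y := by
    intro x y
    rw [ContinuousLinearMap.comp_assoc, ketLeft_adjoint_comp_ketLeft]
    ext v
    simp [coe_ketSlice]
  have hS : ∃ S : HTensor 𝓗 X →L[ℂ] HTensor 𝓗 X, ∀ x y : 𝓗, ∃ a : A.toStarSubalgebra,
      (a : 𝔥 →L[ℂ] 𝔥) = (ketLeft x).adjoint ∘L (c ∘L (ketLeft ω).adjoint) ∘L ketLeft y ∧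
      (ketLeft x).adjoint ∘L S ∘L ketLeft y = φ a := by
    refine ⟨column φ hc ∘L (ketLeft ω).adjoint, fun x y => ⟨_, hslice x y, ?_⟩⟩
    rw [ContinuousLinearMap.comp_assoc, ketLeft_adjoint_comp_ketLeft, map_smul,
      ← ketLeft_adjoint_comp_column]
    ext v
    simp
  -- The column provides an operator with the required slices, so the default value `0` does not
  -- arise; slices determine an operator, so the chosen one is this one.
  rw [ampliation, dif_pos hS]
  refine isTotal_elem_all.ext_clm fun p => isTotal_elem_all.eq_of_inner fun q => ?_
  obtain ⟨a, ha, h⟩ := hS.choose_spec q.1 p.1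
  have ha' : a = ⟪ω, p.1⟫_ℂ • ketSlice A q.1 hc := Subtype.ext (ha.trans (hslice _ _).symm)
  have h1 := congrArg (fun T : X →L[ℂ] X => ⟪q.2, T p.2⟫_ℂ) h
  simp only [ContinuousLinearMap.comp_apply, ContinuousLinearMap.adjoint_inner_right,
    ketLeft_apply] at h1
  rw [h1, ha', ContinuousLinearMap.comp_apply, ketLeft_adjoint_elem, map_smul, map_smul,
    inner_smul_right, inner_column]
  exact inner_smul_right _ _ _

end Column

/-! ### Measurability of weakly measurable curves -/

section Measurability

open Filter Topology

variable {α ι H : Type*} [MeasurableSpace α] [NormedAddCommGroup H] [InnerProductSpace ℂ H]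

/-- Approximating `y` by simple functions leaves `z` paired with finitely many fixed vectors at each
stage, so weak measurability of `z` suffices. -/
theorem measurable_inner_of_weak {y z : α → H} (hy : StronglyMeasurable y)
    (hz : ∀ ζ, Measurable fun a => ⟪ζ, z a⟫_ℂ) : Measurable fun a => ⟪y a, z a⟫_ℂ := by
  refine measurable_of_tendsto_metrizable (f := fun n a => ⟪hy.approx n a, z a⟫_ℂ)
    (fun n => (hy.approx n).measurable_bind (fun v a => ⟪v, z a⟫_ℂ) hz) ?_
  rw [tendsto_pi_nhds]
  exact fun a => (hy.tendsto_approx a).inner tendsto_const_nhds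

theorem IsTotal.measurable_inner {e : ι → H} (he : IsTotal e) {z : α → H}
    (hz : ∀ i, Measurable fun a => ⟪e i, z a⟫_ℂ) (ζ : H) : Measurable fun a => ⟪ζ, z a⟫_ℂ := by
  let V : Submodule ℂ H :=
    { carrier := {ζ | Measurable fun a => ⟪ζ, z a⟫_ℂ}
      add_mem' := fun {x y} hx hy => by
        simp only [Set.mem_ofPred_eq, inner_add_left] at *
        exact hx.add hy
      zero_mem' := by simp
      smul_mem' := fun w x hx => by
        simp only [Set.mem_ofPred_eq, inner_smul_left] at *
        exact hx.const_mul _ }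
  refine he.mem_of_closed V (IsSeqClosed.isClosed fun x ζ hx hζ => ?_) hz ζ
  refine measurable_of_tendsto_metrizable (f := fun n a => ⟪x n, z a⟫_ℂ) hx ?_
  rw [tendsto_pi_nhds]
  exact fun a => hζ.inner tendsto_const_nhds

theorem integral_mul_le_sqrt_mul_sqrt {μ : Measure α} {f g : α → ℝ} (hf0 : ∀ a, 0 ≤ f a)
    (hg0 : ∀ a, 0 ≤ g a) (hf : Integrable (fun a => f a ^ 2) μ)
    (hg : Integrable (fun a => g a ^ 2) μ) :
    Integrable (fun a => f a * g a) μ ∧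
      ∫ a, f a * g a ∂μ ≤ √(∫ a, f a ^ 2 ∂μ) * √(∫ a, g a ^ 2 ∂μ) := by
  have key : ∀ {f : α → ℝ}, (∀ a, 0 ≤ f a) → Integrable (fun a => f a ^ 2) μ → MemLp f 2 μ := by
    intro f hf0 hf
    refine (memLp_two_iff_integrable_sq ?_).2 hf
    -- As `f ≥ 0`, measurability of `f` is recovered from that of `f²` by taking the square root.
    have := hf.aestronglyMeasurable.aemeasurable.sqrt
    simp only [Real.sqrt_sq (hf0 _)] at this
    exact this.aestronglyMeasurable
  have h1 := key hf0 hf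
  have h2 := key hg0 hg
  refine ⟨h1.integrable_mul h2, ?_⟩
  have := integral_mul_le_Lp_mul_Lq_of_nonneg (p := 2) (q := 2) (μ := μ)
    Real.HolderConjugate.two_two (Eventually.of_forall hf0) (Eventually.of_forall hg0)
    (by simpa using h1) (by simpa using h2)
  simpa [Real.sqrt_eq_rpow] using this

end Measurability

/-! ### Norm-continuous curves of operators -/

section OperatorCurves

open Filter Topology

variable {H : Type*} [NormedAddCommGroup H] [NormedSpace ℂ H]

theorem exists_norm_le_of_continuous (Y : C(ℝ≥0, H →L[ℂ] H)) (t : ℝ≥0) :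
    ∃ B : ℝ, 0 ≤ B ∧ ∀ s ≤ t, ‖Y s‖ ≤ B := by
  obtain ⟨B, hB⟩ := (isCompact_Icc (a := (0 : ℝ≥0)) (b := t)).exists_bound_of_continuousOn
    Y.continuous.continuousOn
  exact ⟨B, (norm_nonneg _).trans (hB 0 ⟨le_rfl, zero_le⟩), fun s hs => hB s ⟨zero_le, hs⟩⟩

theorem continuous_of_norm_sub_le_sqrt {Z : ℝ≥0 → H →L[ℂ] H}
    (h : ∀ T : ℝ≥0, ∃ C : ℝ, ∀ r t, r ≤ t → t ≤ T → ‖Z t - Z r‖ ≤ C * √(t - r)) :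
    Continuous Z := by
  refine continuous_iff_continuousAt.2 fun t₀ => ?_
  obtain ⟨C, hC⟩ := h (t₀ + 1)
  rw [ContinuousAt, tendsto_iff_norm_sub_tendsto_zero]
  have hlim : Tendsto (fun t : ℝ≥0 => C * √|(t : ℝ) - t₀|) (𝓝 t₀) (𝓝 0) := by
    have : Continuous fun t : ℝ≥0 => C * √|(t : ℝ) - t₀| := by fun_prop
    simpa using this.tendsto t₀
  refine squeeze_zero' (Eventually.of_forall fun _ => norm_nonneg _) ?_ hlim
  have hlt : t₀ < t₀ + 1 := by simp
  filter_upwards [Iio_mem_nhds hlt] with t ht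
  rcases le_total t₀ t with h | h
  · rw [abs_of_nonneg (sub_nonneg.2 (NNReal.coe_le_coe.2 h))]
    exact hC _ _ h (le_of_lt ht)
  · rw [norm_sub_rev, abs_sub_comm, abs_of_nonneg (sub_nonneg.2 (NNReal.coe_le_coe.2 h))]
    exact hC _ _ h hlt.le

theorem stronglyMeasurable_apply (Y : C(ℝ≥0, H →L[ℂ] H)) (η : H) :
    StronglyMeasurable fun s => Y s η :=
  (Y.continuous.clm_apply continuous_const).stronglyMeasurable

end OperatorCurves

/-! ### The integral operator of the equation -/

section Flow

set_option linter.unusedSectionVars false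

open Set

variable {𝔥 𝔨 : Type*} [NormedAddCommGroup 𝔥] [InnerProductSpace ℂ 𝔥] [CompleteSpace 𝔥]
  [NormedAddCommGroup 𝔨] [InnerProductSpace ℂ 𝔨] [CompleteSpace 𝔨]
  {A : VonNeumannAlgebra 𝔥} (j : QSFlow A 𝔨)

theorem vacProj_comp_flow (s : ℝ≥0) (a : A.toStarSubalgebra) :
    vacProj 𝔨 𝔥 s ∘L j.toFun s a = j.toFun s a := by
  conv_lhs => rw [j.adapted s a]
  rw [← ContinuousLinearMap.comp_assoc, vacProj_comp_vacProj, min_self, ← j.adapted s a]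

theorem flow_comp_vacProj (s : ℝ≥0) (a : A.toStarSubalgebra) :
    j.toFun s a ∘L vacProj 𝔨 𝔥 s = j.toFun s a := by
  conv_lhs => rw [j.adapted s a]
  rw [ContinuousLinearMap.comp_assoc, ContinuousLinearMap.comp_assoc, vacProj_comp_vacProj,
    min_self, ← j.adapted s a]

/-- The flow is only weakly measurable in `s`, while `z` is strongly so. Moving the flow to the
fixed vector `p` as `j_s(a*)` leaves one curve of each kind. -/
theorem measurable_inner_flow (a : A.toStarSubalgebra) {z : ℝ≥0 → HTensor 𝔥 (Noise 𝔨)}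
    (hz : StronglyMeasurable z) (p : HTensor 𝔥 (Noise 𝔨)) :
    Measurable fun s => ⟪p, j.toFun s a (z s)⟫_ℂ := by
  have h1 : ∀ ζ q : HTensor 𝔥 (Noise 𝔨), Measurable fun s => ⟪ζ, j.toFun s (star a) q⟫_ℂ := by
    intro ζ q
    have := (continuous_ultraweak_inner q ζ)
    exact (@Continuous.comp _ _ _ _ (ultraweakTopology _ _) _ _ _ this
      (j.continuous (star a))).measurable
  have h2 := measurable_inner_of_weak hz fun ζ => h1 ζ p
  have h3 : (fun s => ⟪p, j.toFun s a (z s)⟫_ℂ) =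
      fun s => (starRingEnd ℂ) ⟪z s, j.toFun s (star a) p⟫_ℂ := by
    funext s
    rw [inner_conj_symm, map_star, ContinuousLinearMap.star_eq_adjoint,
      ContinuousLinearMap.adjoint_inner_left]
  rw [h3]
  exact Complex.continuous_conj.measurable.comp h2

variable {c : 𝔥 →L[ℂ] HTensor (Hat 𝔨) 𝔥} (hc : c ∈ uwKetTensor (Hat 𝔨) (A : Set (𝔥 →L[ℂ] 𝔥)))

theorem measurable_inner_column {z : ℝ≥0 → HTensor 𝔥 (Noise 𝔨)} (hz : StronglyMeasurable z)
    (ζ : HTensor (Hat 𝔨) (HTensor 𝔥 (Noise 𝔨))) :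
    Measurable fun s => ⟪ζ, column (j.toFun s) hc (z s)⟫_ℂ := by
  refine isTotal_elem_all.measurable_inner (fun p => ?_) ζ
  simp only [inner_column]
  exact measurable_inner_flow j _ hz _

/-- The matrix elements `⟪u ε(f), j_s(E^{f̂(s)} c) z⟫`. -/
def flowInner (i : 𝔥 × L2 𝔨) (z : HTensor 𝔥 (Noise 𝔨)) (s : ℝ≥0) : ℂ :=
  ⟪expElem i, j.toFun s (ketSlice A (hat (i.2 s)) hc) z⟫_ℂ

theorem flowInner_eq_inner_elem (i : 𝔥 × L2 𝔨) (z : HTensor 𝔥 (Noise 𝔨)) (s : ℝ≥0) :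
    flowInner j hc i z s = ⟪elem (hat (i.2 s)) (expElem i), column (j.toFun s) hc z⟫_ℂ := by
  rw [inner_column, flowInner]

/-- Because `j_s(a) = P_s j_s(a)`, the vector `u ε(f)` may be replaced by `P_s u ε(f)`; this brings
in the vectors to which the energy bound applies. -/
theorem flowInner_eq (i : 𝔥 × L2 𝔨) (z : HTensor 𝔥 (Noise 𝔨)) (s : ℝ≥0) :
    flowInner j hc i z s = ⟪hatElem s i, column (j.toFun s) hc z⟫_ℂ := by
  rw [hatElem, inner_column, flowInner, ← ContinuousLinearMap.adjoint_inner_right,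
    vacProj_adjoint]
  conv_lhs => rw [← vacProj_comp_flow]
  rfl

theorem continuous_hat : Continuous (hat : 𝔨 → Hat 𝔨) :=
  (WithLp.prod_continuous_toLp 2 ℂ 𝔨).comp (by fun_prop)

theorem measurable_flowInner (i : 𝔥 × L2 𝔨) {z : ℝ≥0 → HTensor 𝔥 (Noise 𝔨)}
    (hz : StronglyMeasurable z) : Measurable fun s => flowInner j hc i (z s) s := by
  simp only [flowInner_eq_inner_elem]
  refine measurable_inner_of_weak ?_ (measurable_inner_column j hc hz)
  exact ((ketRight (expElem i)).continuous.comp continuous_hat).comp_stronglyMeasurable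
    (Lp.stronglyMeasurable i.2)

theorem integrableOn_norm_hat (f : L2 𝔨) (t : ℝ≥0) :
    IntegrableOn (fun s => ‖hat (f s)‖) (Iio t) lebesgue := by
  -- A crude majorant: `2 ‖x̂‖ ≤ 1 + ‖x̂‖² = 2 + ‖x‖²`.
  have h1 : IntegrableOn (fun s => 2 + ‖f s‖ ^ 2) (Iio t) lebesgue :=
    (integrable_const (μ := lebesgue.restrict (Iio t)) (2 : ℝ)).add
      ((memLp_two_iff_integrable_sq_norm (Lp.aestronglyMeasurable f)).1 (Lp.memLp f)).integrableOn
  refine h1.mono' ?_ (Filter.Eventually.of_forall fun s => ?_)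
  · exact (continuous_hat.comp_stronglyMeasurable
      (Lp.stronglyMeasurable f)).norm.aestronglyMeasurable
  · rw [norm_norm]
    nlinarith [norm_hat_sq (f s), sq_nonneg (‖hat (f s)‖ - 1)]

theorem norm_flowInner_le (i : 𝔥 × L2 𝔨) (z : HTensor 𝔥 (Noise 𝔨)) (s : ℝ≥0) :
    ‖flowInner j hc i z s‖ ≤ ‖expElem i‖ * ‖c‖ * ‖z‖ * ‖hat (i.2 s)‖ := by
  calc _ ≤ ‖expElem i‖ * ‖j.toFun s (ketSlice A (hat (i.2 s)) hc) z‖ := norm_inner_le_norm _ _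
    _ ≤ ‖expElem i‖ * ((‖hat (i.2 s)‖ * ‖c‖) * ‖z‖) := by
      gcongr
      exact ContinuousLinearMap.le_of_opNorm_le _ (norm_starHom_ketSlice_le _ _ hc) _
    _ = _ := by ring

theorem integrableOn_flowInner (i : 𝔥 × L2 𝔨) {z : ℝ≥0 → HTensor 𝔥 (Noise 𝔨)}
    (hz : StronglyMeasurable z) {t : ℝ≥0} {B : ℝ} (hB : ∀ s < t, ‖z s‖ ≤ B) :
    IntegrableOn (fun s => flowInner j hc i (z s) s) (Iio t) lebesgue := by
  refine ((integrableOn_norm_hat i.2 t).const_mul (‖expElem i‖ * ‖c‖ * B)).mono'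
    (measurable_flowInner j hc i hz).aestronglyMeasurable ?_
  refine (ae_restrict_iff' measurableSet_Iio).2 (Filter.Eventually.of_forall fun s hs => ?_)
  refine (norm_flowInner_le j hc i (z s) s).trans ?_
  gcongr
  exact hB s hs

/-- The fundamental estimate for the quantum stochastic integral. -/
theorem norm_sum_integral_flowInner_le {z : ℝ≥0 → HTensor 𝔥 (Noise 𝔨)} {r t : ℝ≥0}
    (hint : ∀ i, IntegrableOn (fun s => flowInner j hc i (z s) s) (Iio t) lebesgue)
    {β : ℝ≥0 → ℝ} (hβ : IntegrableOn (fun s => β s ^ 2) (Iio t) lebesgue) (hβ0 : ∀ s, 0 ≤ β s)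
    (hz : ∀ s < t, ‖z s‖ ≤ β s) (w : 𝔥 × L2 𝔨 →₀ ℂ) :
    ‖w.sum fun i a => (starRingEnd ℂ) a *
        ∫ s in Ico r t, flowInner j hc i (z s) s ∂lebesgue‖ ≤
      ‖c‖ * √(t + 1) * √(∫ s in Ico r t, β s ^ 2 ∂lebesgue) *
        ‖Finsupp.linearCombination ℂ expElem w‖ := by
  have hsub : Ico r t ⊆ Iio t := fun s hs => hs.2
  -- Summing before estimating keeps the vectors `hatElem s i` together in one combination, the one
  -- bounded by the energy inequality.
  have h1 : (w.sum fun i a => (starRingEnd ℂ) a *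
      ∫ s in Ico r t, flowInner j hc i (z s) s ∂lebesgue) =
      ∫ s in Ico r t, ⟪Finsupp.linearCombination ℂ (hatElem s) w,
        column (j.toFun s) hc (z s)⟫_ℂ ∂lebesgue := by
    simp only [inner_linearCombination_left, Finsupp.sum, ← flowInner_eq]
    rw [integral_finsetSum _ fun i _ => ((hint i).mono_set hsub).const_mul _]
    simp only [integral_const_mul]
  have hΞ := norm_sq_hatElem_combination w t
  have h2 := integral_mul_le_sqrt_mul_sqrt (μ := lebesgue.restrict (Ico r t))
    (f := fun s => ‖Finsupp.linearCombination ℂ (hatElem s) w‖) (g := β)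
    (fun s => norm_nonneg _) hβ0 (hΞ.1.mono_set hsub) (hβ.mono_set hsub)
  have h3 : ∫ s in Ico r t, ‖Finsupp.linearCombination ℂ (hatElem s) w‖ ^ 2 ∂lebesgue ≤
      (t + 1) * ‖Finsupp.linearCombination ℂ expElem w‖ ^ 2 :=
    (setIntegral_mono_set hΞ.1 (Filter.Eventually.of_forall fun _ => by positivity)
      (Filter.Eventually.of_forall hsub)).trans hΞ.2
  rw [h1]
  calc _ ≤ ∫ s in Ico r t, ‖c‖ * (‖Finsupp.linearCombination ℂ (hatElem s) w‖ * β s)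
        ∂lebesgue := by
        refine norm_integral_le_of_norm_le (h2.1.const_mul _) ?_
        refine (ae_restrict_iff' measurableSet_Ico).2 (Filter.Eventually.of_forall fun s hs => ?_)
        calc _ ≤ ‖Finsupp.linearCombination ℂ (hatElem s) w‖ * ‖column (j.toFun s) hc (z s)‖ :=
              norm_inner_le_norm _ _
          _ ≤ ‖Finsupp.linearCombination ℂ (hatElem s) w‖ * (‖c‖ * β s) := by
              gcongr
              exact (ContinuousLinearMap.le_of_opNorm_le _ (norm_column_le _ hc) _).trans
                (by gcongr; exact hz s hs.2)
          _ = _ := by ring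
    _ = ‖c‖ * ∫ s in Ico r t, ‖Finsupp.linearCombination ℂ (hatElem s) w‖ * β s ∂lebesgue :=
        integral_const_mul _ _
    _ ≤ ‖c‖ * (√((t + 1) * ‖Finsupp.linearCombination ℂ expElem w‖ ^ 2) *
          √(∫ s in Ico r t, β s ^ 2 ∂lebesgue)) := by
        gcongr
        exact h2.2.trans (by gcongr)
    _ = _ := by
        rw [Real.sqrt_mul (by positivity), Real.sqrt_sq (norm_nonneg _)]
        ring

/-- The majorant `β` replaces `‖z s‖`, which need not be measurable when `z` is only weakly
measurable. -/
theorem norm_le_of_inner_eq_integral {z : ℝ≥0 → HTensor 𝔥 (Noise 𝔨)} {r t : ℝ≥0}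
    (hint : ∀ i, IntegrableOn (fun s => flowInner j hc i (z s) s) (Iio t) lebesgue)
    {β : ℝ≥0 → ℝ} (hβ : IntegrableOn (fun s => β s ^ 2) (Iio t) lebesgue) (hβ0 : ∀ s, 0 ≤ β s)
    (hz : ∀ s < t, ‖z s‖ ≤ β s) {x : HTensor 𝔥 (Noise 𝔨)}
    (hx : ∀ i, ⟪expElem i, x⟫_ℂ = ∫ s in Ico r t, flowInner j hc i (z s) s ∂lebesgue) :
    ‖x‖ ≤ ‖c‖ * √(t + 1) * √(∫ s in Ico r t, β s ^ 2 ∂lebesgue) := by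
  refine isTotal_expElem.norm_le_of_inner (by positivity) fun w => ?_
  rw [inner_linearCombination_left]
  simp only [hx]
  exact norm_sum_integral_flowInner_le j hc hint hβ hβ0 hz w

variable (Y : C(ℝ≥0, HTensor 𝔥 (Noise 𝔨) →L[ℂ] HTensor 𝔥 (Noise 𝔨)))

theorem integrableOn_flowInner_apply (i : 𝔥 × L2 𝔨) (η : HTensor 𝔥 (Noise 𝔨)) (t : ℝ≥0) :
    IntegrableOn (fun s => flowInner j hc i (Y s η) s) (Iio t) lebesgue := by
  obtain ⟨B, hB0, hB⟩ := exists_norm_le_of_continuous Y t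
  exact integrableOn_flowInner j hc i (stronglyMeasurable_apply Y η) (B := B * ‖η‖)
    fun s hs => (Y s).le_of_opNorm_le (hB s hs.le) η

theorem integrableOn_const_sq (t : ℝ≥0) (B : ℝ) :
    IntegrableOn (fun _ : ℝ≥0 => B ^ 2) (Iio t) lebesgue := integrable_const _

/-- The matrix elements of `∫ j̃_s(c E^ω) (I ⊗ Y_s) dΛ_s`. -/
def integralForm (t : ℝ≥0) (i : 𝔥 × L2 𝔨) : HTensor 𝔥 (Noise 𝔨) →ₗ[ℂ] ℂ where
  toFun η := ∫ s in Iio t, flowInner j hc i (Y s η) s ∂lebesgue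
  map_add' η η' := by
    rw [← integral_add (integrableOn_flowInner_apply j hc Y i η t)
      (integrableOn_flowInner_apply j hc Y i η' t)]
    simp only [flowInner, map_add, inner_add_right]
  map_smul' a η := by
    rw [RingHom.id_apply, smul_eq_mul, ← integral_const_mul]
    simp only [flowInner, map_smul, inner_smul_right]

/-- The fundamental estimate with constant majorant `B ‖η‖` is linear in `‖η‖`, so the matrix
elements define a bounded operator on all of `𝔥 ⊗ 𝓕` at once. -/
theorem exists_qsIntegralAt (t : ℝ≥0) :
    ∃ Z : HTensor 𝔥 (Noise 𝔨) →L[ℂ] HTensor 𝔥 (Noise 𝔨), ∀ i η, ⟪expElem i, Z η⟫_ℂ =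
      integralForm j hc Y t i η := by
  obtain ⟨B, hB0, hB⟩ := exists_norm_le_of_continuous Y t
  obtain ⟨Z, -, hZ⟩ := isTotal_expElem.exists_clm (integralForm j hc Y t)
    (C := ‖c‖ * √(t + 1) * √(∫ s in Ico 0 t, B ^ 2 ∂lebesgue)) (by positivity) fun w η => by
      have h := norm_sum_integral_flowInner_le j hc (r := 0)
        (fun i => integrableOn_flowInner_apply j hc Y i η t)
        (integrableOn_const_sq t (B * ‖η‖)) (fun _ => by positivity)
        (fun s hs => (Y s).le_of_opNorm_le (hB s hs.le) η) w
      simp only [mul_pow] at h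
      rw [integral_mul_const, Real.sqrt_mul (integral_nonneg fun _ => by positivity),
        Real.sqrt_sq (norm_nonneg _), ← Iio_eq_Ico] at h
      rw [← Iio_eq_Ico]
      refine h.trans_eq ?_
      ring
  exact ⟨Z, hZ⟩

/-- The value at time `t` of the integral `∫ j̃_s(c E^ω) (I ⊗ Y_s) dΛ_s`. -/
def qsIntegralAt (t : ℝ≥0) : HTensor 𝔥 (Noise 𝔨) →L[ℂ] HTensor 𝔥 (Noise 𝔨) :=
  (exists_qsIntegralAt j hc Y t).choose

theorem inner_qsIntegralAt (t : ℝ≥0) (i : 𝔥 × L2 𝔨) (η : HTensor 𝔥 (Noise 𝔨)) :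
    ⟪expElem i, qsIntegralAt j hc Y t η⟫_ℂ =
      ∫ s in Iio t, flowInner j hc i (Y s η) s ∂lebesgue :=
  (exists_qsIntegralAt j hc Y t).choose_spec i η

theorem norm_qsIntegralAt_sub_le {r t : ℝ≥0} (hrt : r ≤ t) {β : ℝ≥0 → ℝ}
    (hβ : IntegrableOn (fun s => β s ^ 2) (Iio t) lebesgue) (hβ0 : ∀ s, 0 ≤ β s)
    (hY : ∀ s < t, ‖Y s‖ ≤ β s) :
    ‖qsIntegralAt j hc Y t - qsIntegralAt j hc Y r‖ ≤
      ‖c‖ * √(t + 1) * √(∫ s in Ico r t, β s ^ 2 ∂lebesgue) := by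
  refine ContinuousLinearMap.opNorm_le_bound _ (by positivity) fun η => ?_
  refine (norm_le_of_inner_eq_integral j hc (r := r)
    (fun i => integrableOn_flowInner_apply j hc Y i η t) (β := fun s => β s * ‖η‖) ?_
    (fun s => mul_nonneg (hβ0 s) (norm_nonneg _))
    (fun s hs => (Y s).le_of_opNorm_le (hY s hs) η) fun i => ?_).trans_eq ?_
  · simp only [mul_pow]
    exact hβ.mul_const _
  · rw [sub_apply, inner_sub_right, inner_qsIntegralAt, inner_qsIntegralAt]
    have hI := integrableOn_flowInner_apply j hc Y i η t
    rw [sub_eq_iff_eq_add, add_comm, ← setIntegral_union ?_ measurableSet_Ico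
      (hI.mono_set (Iio_subset_Iio hrt)) (hI.mono_set fun s hs => hs.2)]
    · rw [Iio_union_Ico_eq_Iio hrt]
    · exact Set.disjoint_left.2 fun s hs hs' => absurd hs'.1 (not_le.2 hs)
  · simp only [mul_pow]
    rw [integral_mul_const, Real.sqrt_mul (integral_nonneg fun _ => by positivity),
      Real.sqrt_sq (norm_nonneg _)]
    ring

theorem qsIntegralAt_zero : qsIntegralAt j hc Y 0 = 0 :=
  ContinuousLinearMap.ext fun η => isTotal_expElem.eq_of_inner fun i => by
    have : (Iio 0 : Set ℝ≥0) = ∅ := by ext; simp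
    rw [inner_qsIntegralAt, this]
    simp

theorem norm_qsIntegralAt_le {t : ℝ≥0} {β : ℝ≥0 → ℝ}
    (hβ : IntegrableOn (fun s => β s ^ 2) (Iio t) lebesgue) (hβ0 : ∀ s, 0 ≤ β s)
    (hY : ∀ s < t, ‖Y s‖ ≤ β s) :
    ‖qsIntegralAt j hc Y t‖ ≤ ‖c‖ * √(t + 1) * √(∫ s in Iio t, β s ^ 2 ∂lebesgue) := by
  have := norm_qsIntegralAt_sub_le j hc Y zero_le hβ hβ0 hY
  rwa [qsIntegralAt_zero, sub_zero, ← Iio_eq_Ico] at this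

theorem norm_qsIntegralAt_sub_le_sqrt {r t T : ℝ≥0} (hrt : r ≤ t) (ht : t ≤ T) {B : ℝ} (hB0 : 0 ≤ B)
    (hB : ∀ s ≤ T, ‖Y s‖ ≤ B) :
    ‖qsIntegralAt j hc Y t - qsIntegralAt j hc Y r‖ ≤ ‖c‖ * √(T + 1) * B * √(t - r) := by
  refine (norm_qsIntegralAt_sub_le j hc Y hrt (integrableOn_const_sq t B) (fun _ => hB0)
    fun s hs => hB s (hs.le.trans ht)).trans ?_
  have h1 : ∫ s in Ico r t, B ^ 2 ∂lebesgue = (t - r) * B ^ 2 := by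
    have : (0 : ℝ) ≤ t - r := sub_nonneg.2 (NNReal.coe_le_coe.2 hrt)
    simp [Measure.real, lebesgue_Ico, ENNReal.toReal_ofReal this]
  have h2 : √((t - r : ℝ) * B ^ 2) = √(t - r) * B := by
    rw [Real.sqrt_mul (sub_nonneg.2 (NNReal.coe_le_coe.2 hrt)), Real.sqrt_sq hB0]
  rw [h1, h2]
  have h3 : √((t : ℝ) + 1) ≤ √(T + 1) := Real.sqrt_le_sqrt (by gcongr)
  calc _ = ‖c‖ * √((t : ℝ) + 1) * B * √(t - r) := by ring
    _ ≤ _ := by gcongr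

theorem continuous_qsIntegralAt : Continuous (qsIntegralAt j hc Y) := by
  refine continuous_of_norm_sub_le_sqrt fun T => ?_
  obtain ⟨B, hB0, hB⟩ := exists_norm_le_of_continuous Y T
  exact ⟨_, fun r t hrt ht => norm_qsIntegralAt_sub_le_sqrt j hc Y hrt ht hB0 hB⟩

/-- The integral `∫ j̃_s(c E^ω) (I ⊗ Y_s) dΛ_s` as a norm-continuous function of time. -/
def qsIntegral : C(ℝ≥0, HTensor 𝔥 (Noise 𝔨) →L[ℂ] HTensor 𝔥 (Noise 𝔨)) :=
  ⟨qsIntegralAt j hc Y, continuous_qsIntegralAt j hc Y⟩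

end Flow

/-! ### Iteration of the integral operator -/

section Iteration

open Set Filter Topology

/-- The Weierstrass test on compact sets: each lies in some `[0, T]`, where the terms are dominated
by a geometric series. -/
theorem exists_hasSum_of_geometric {H : Type*} [NormedAddCommGroup H] [NormedSpace ℂ H]
    [CompleteSpace H] (D : ℕ → C(ℝ≥0, H →L[ℂ] H))
    (hD : ∀ T : ℝ≥0, ∃ B : ℝ, ∀ n, ∀ t ≤ T, ‖D n t‖ ≤ B * (1 / 2) ^ n) :
    ∃ M : C(ℝ≥0, H →L[ℂ] H), ∀ t, HasSum (fun n => D n t) (M t) := by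
  have hs : Summable D := by
    refine ContinuousMap.summable_of_locally_summable_norm fun K => ?_
    obtain ⟨T, hT⟩ := K.isCompact.bddAbove
    obtain ⟨B, hB⟩ := hD T
    refine Summable.of_nonneg_of_le (fun n => norm_nonneg _) (fun n => ?_)
      ((summable_geometric_two).mul_left |B|)
    refine (ContinuousMap.norm_le _ (by positivity)).2 fun x => ?_
    refine (hB n x (hT x.2)).trans ?_
    gcongr
    exact le_abs_self B
  exact ⟨∑' n, D n, fun t => ContinuousMap.hasSum_apply hs.hasSum t⟩

theorem setIntegral_exp_sq_le {B l : ℝ} (hl : 0 < l) (t : ℝ≥0) :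
    IntegrableOn (fun s : ℝ≥0 => (B * Real.exp (l * s)) ^ 2) (Iio t) lebesgue ∧
    ∫ s in Iio t, (B * Real.exp (l * s)) ^ 2 ∂lebesgue ≤ (B * Real.exp (l * t)) ^ 2 / (2 * l) := by
  have hcont : Continuous fun s : ℝ≥0 => (B * Real.exp (l * s)) ^ 2 := by fun_prop
  have hderiv : ∀ x : ℝ, HasDerivAt (fun x => (B * Real.exp (l * x)) ^ 2 / (2 * l))
      ((B * Real.exp (l * x)) ^ 2) x := by
    intro x
    have h1 := ((((hasDerivAt_id x).const_mul l).exp.const_mul B).pow 2).div_const (2 * l)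
    refine h1.congr_deriv ?_
    simp
    field_simp
  have hint : IntervalIntegrable (fun x : ℝ => (B * Real.exp (l * x)) ^ 2) volume 0 t :=
    Continuous.intervalIntegrable (by fun_prop) _ _
  have e : ∀ x ∈ uIcc (0 : ℝ) t, (B * Real.exp (l * (x.toNNReal : ℝ))) ^ 2 =
      (B * Real.exp (l * x)) ^ 2 := by
    intro x hx
    rw [uIcc_of_le t.coe_nonneg] at hx
    rw [Real.coe_toNNReal _ hx.1]
  refine ⟨(integrableOn_Iio_iff t _).2 (hint.congr fun x hx => (e x (uIoc_subset_uIcc hx)).symm), ?_⟩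
  rw [setIntegral_Iio, intervalIntegral.integral_congr e,
    intervalIntegral.integral_eq_sub_of_hasDerivAt (fun x _ => hderiv x) hint]
  have : 0 ≤ (B * Real.exp (l * 0)) ^ 2 / (2 * l) := by positivity
  linarith

/-- The growth rate that makes the integral operator contract by the factor `1 / 2` on `[0, T]`. -/
def growthRate (C : ℝ) (T : ℝ≥0) : ℝ := 2 * (C * √(T + 1)) ^ 2 + 1

theorem growthRate_pos (C : ℝ) (T : ℝ≥0) : 0 < growthRate C T := by
  unfold growthRate; positivity

/-- With the weight `e^{lt}`, the square root of `∫_0^t e^{2ls} ds` gains a factor `(2l)^{-1/2}`; a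
large `l` thus gives a contraction on all of `[0, T]` without subdividing it. -/
theorem contraction_bound {C B : ℝ} (hC : 0 ≤ C) (hB : 0 ≤ B) {t T : ℝ≥0} (ht : t ≤ T) :
    C * √(t + 1) * √(∫ s in Iio t, (B * Real.exp (growthRate C T * s)) ^ 2 ∂lebesgue) ≤
      B * (1 / 2) * Real.exp (growthRate C T * t) := by
  set l := growthRate C T with hl
  have hl0 : 0 < l := growthRate_pos C T
  have h1 := (setIntegral_exp_sq_le (B := B) hl0 t).2
  have h2 : √((t : ℝ) + 1) ≤ √(T + 1) := Real.sqrt_le_sqrt (by gcongr)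
  -- The term `2 (C √(T + 1))²` in the growth rate gives `1/4`, the square of the factor `1/2`; the
  -- added `1` keeps `l` positive when `C = 0`.
  have h3 : (C * √(T + 1)) ^ 2 / (2 * l) ≤ 1 / 4 := by
    rw [div_le_iff₀ (by positivity), hl, growthRate]
    linarith
  refine (sq_le_sq₀ (by positivity) (by positivity)).1 ?_
  rw [mul_pow, Real.sq_sqrt (integral_nonneg fun _ => by positivity)]
  calc _ ≤ (C * √(T + 1)) ^ 2 * ((B * Real.exp (l * t)) ^ 2 / (2 * l)) := by gcongr
    _ = ((C * √(T + 1)) ^ 2 / (2 * l)) * (B * Real.exp (l * t)) ^ 2 := by ring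
    _ ≤ (1 / 4) * (B * Real.exp (l * t)) ^ 2 :=
      mul_le_mul_of_nonneg_right h3 (sq_nonneg _)
    _ = _ := by ring

end Iteration

/-! ### The solution as the sum of the iterated integrals -/

section Flow

set_option linter.unusedSectionVars false

open Set Filter Topology

variable {𝔥 𝔨 : Type*} [NormedAddCommGroup 𝔥] [InnerProductSpace ℂ 𝔥] [CompleteSpace 𝔥]
  [NormedAddCommGroup 𝔨] [InnerProductSpace ℂ 𝔨] [CompleteSpace 𝔨]
  {A : VonNeumannAlgebra 𝔥} (j : QSFlow A 𝔨)
  {c : 𝔥 →L[ℂ] HTensor (Hat 𝔨) 𝔥} (hc : c ∈ uwKetTensor (Hat 𝔨) (A : Set (𝔥 →L[ℂ] 𝔥)))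

/-- The iterated integrals of the identity. -/
def iteratedIntegral : ℕ → C(ℝ≥0, HTensor 𝔥 (Noise 𝔨) →L[ℂ] HTensor 𝔥 (Noise 𝔨))
  | 0 => ⟨fun _ => 1, continuous_const⟩
  | n + 1 => qsIntegral j hc (iteratedIntegral n)

theorem norm_iteratedIntegral_le (T : ℝ≥0) (n : ℕ) : ∀ t ≤ T,
    ‖iteratedIntegral j hc n t‖ ≤ (1 / 2) ^ n * Real.exp (growthRate ‖c‖ T * t) := by
  induction n with
  | zero =>
    intro t _
    rw [pow_zero, one_mul]
    exact ContinuousLinearMap.norm_id_le.trans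
      (Real.one_le_exp (mul_nonneg (growthRate_pos _ _).le t.coe_nonneg))
  | succ n ih =>
    intro t ht
    refine (norm_qsIntegralAt_le j hc (iteratedIntegral j hc n)
      (setIntegral_exp_sq_le (growthRate_pos ‖c‖ T) t).1 (fun _ => by positivity)
      fun s hs => ih s (hs.le.trans ht)).trans ?_
    rw [pow_succ]
    exact contraction_bound (norm_nonneg c) (by positivity) ht

theorem norm_iteratedIntegral_le' (T : ℝ≥0) (n : ℕ) (t : ℝ≥0) (ht : t ≤ T) :
    ‖iteratedIntegral j hc n t‖ ≤ Real.exp (growthRate ‖c‖ T * T) * (1 / 2) ^ n := by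
  refine (norm_iteratedIntegral_le j hc T n t ht).trans ?_
  rw [mul_comm]
  have := (growthRate_pos ‖c‖ T).le
  gcongr

theorem exists_solution_series : ∃ M : C(ℝ≥0, HTensor 𝔥 (Noise 𝔨) →L[ℂ] HTensor 𝔥 (Noise 𝔨)),
    ∀ t, HasSum (fun n => iteratedIntegral j hc n t) (M t) :=
  exists_hasSum_of_geometric _ fun T => ⟨_, fun n t ht => norm_iteratedIntegral_le' j hc T n t ht⟩

/-- The solution of the equation, as the sum of the iterated integrals. -/
def solution : C(ℝ≥0, HTensor 𝔥 (Noise 𝔨) →L[ℂ] HTensor 𝔥 (Noise 𝔨)) :=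
  (exists_solution_series j hc).choose

theorem hasSum_solution_apply (t : ℝ≥0) (η : HTensor 𝔥 (Noise 𝔨)) :
    HasSum (fun n => iteratedIntegral j hc n t η) (solution j hc t η) :=
  ((exists_solution_series j hc).choose_spec t).mapL
    (ContinuousLinearMap.apply ℂ (HTensor 𝔥 (Noise 𝔨)) η)

theorem hasSum_flowInner_solution (i : 𝔥 × L2 𝔨) (η : HTensor 𝔥 (Noise 𝔨)) (s : ℝ≥0) :
    HasSum (fun n => flowInner j hc i (iteratedIntegral j hc n s η) s)
      (flowInner j hc i (solution j hc s η) s) :=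
  ((hasSum_solution_apply j hc s η).mapL (j.toFun s (ketSlice A (hat (i.2 s)) hc))).mapL
    (innerSL ℂ (expElem i))

theorem inner_solution (t : ℝ≥0) (i : 𝔥 × L2 𝔨) (η : HTensor 𝔥 (Noise 𝔨)) :
    ⟪expElem i, solution j hc t η⟫_ℂ = ⟪expElem i, η⟫_ℂ +
      ∫ s in Iio t, flowInner j hc i (solution j hc s η) s ∂lebesgue := by
  have h1 : HasSum (fun n => ∫ s in Iio t, flowInner j hc i (iteratedIntegral j hc n s η) s
      ∂lebesgue) (∫ s in Iio t, flowInner j hc i (solution j hc s η) s ∂lebesgue) := by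
    set L := Real.exp (growthRate ‖c‖ t * t) with hL
    refine hasSum_integral_of_dominated_convergence
      (fun n s => (‖expElem i‖ * ‖c‖ * (L * ‖η‖) * ‖hat (i.2 s)‖) * (1 / 2) ^ n)
      (fun n => (measurable_flowInner j hc i
        (stronglyMeasurable_apply _ η)).aestronglyMeasurable) (fun n => ?_)
      (Eventually.of_forall fun s => summable_geometric_two.mul_left _) ?_
      (Eventually.of_forall fun s => hasSum_flowInner_solution j hc i η s)
    · refine (ae_restrict_iff' measurableSet_Iio).2 (Eventually.of_forall fun s hs => ?_)
      refine (norm_flowInner_le j hc i _ s).trans ?_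
      have h2 := (iteratedIntegral j hc n s).le_of_opNorm_le
        (norm_iteratedIntegral_le' j hc t n s (le_of_lt hs)) η
      calc _ ≤ ‖expElem i‖ * ‖c‖ * (L * (1 / 2) ^ n * ‖η‖) * ‖hat (i.2 s)‖ := by gcongr
        _ = _ := by ring
    · simp only [tsum_mul_left]
      exact ((integrableOn_norm_hat i.2 t).const_mul _).mul_const _
  have h3 : HasSum (fun n => ⟪expElem i, iteratedIntegral j hc n t η⟫_ℂ)
      ⟪expElem i, solution j hc t η⟫_ℂ :=
    (hasSum_solution_apply j hc t η).mapL (innerSL ℂ (expElem i))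
  have h4 : ∀ n, ⟪expElem i, iteratedIntegral j hc (n + 1) t η⟫_ℂ =
      ∫ s in Iio t, flowInner j hc i (iteratedIntegral j hc n s η) s ∂lebesgue :=
    fun n => inner_qsIntegralAt j hc _ t i η
  simp only [← h4] at h1
  -- The integrals of the iterates form the series shifted by one; restoring its zeroth term, the
  -- identity, yields the equation.
  have h5 := (hasSum_nat_add_iff (f := fun n => ⟪expElem i, iteratedIntegral j hc n t η⟫_ℂ) 1).1 h1
  rw [h3.unique h5, add_comm]
  simp only [Finset.range_one, Finset.sum_singleton]
  rfl

theorem solution_eq (t : ℝ≥0) :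
    solution j hc t = 1 + qsIntegralAt j hc (solution j hc) t :=
  ContinuousLinearMap.ext fun η => isTotal_expElem.eq_of_inner fun i => by
    rw [inner_solution, add_apply, inner_add_right, inner_qsIntegralAt]
    rfl

/-! ### Adaptedness and membership in the algebra -/

variable (Y : C(ℝ≥0, HTensor 𝔥 (Noise 𝔨) →L[ℂ] HTensor 𝔥 (Noise 𝔨)))

/-- At times `s < t` the truncation of `f` to `[0, t)` agrees with `f` almost everywhere, and `P_t`
fixes the range of `j_s(a)`. -/
theorem vacProj_comp_qsIntegralAt (t : ℝ≥0) :
    vacProj 𝔨 𝔥 t ∘L qsIntegralAt j hc Y t = qsIntegralAt j hc Y t :=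
  ContinuousLinearMap.ext fun η => isTotal_expElem.eq_of_inner fun i => by
    rw [ContinuousLinearMap.comp_apply, ← ContinuousLinearMap.adjoint_inner_left, vacProj_adjoint,
      vacProj_expElem, inner_qsIntegralAt, inner_qsIntegralAt]
    refine setIntegral_congr_ae measurableSet_Iio ?_
    filter_upwards [coeFn_trunc t i.2] with s hs hst
    have h1 : trunc t i.2 s = i.2 s := by rw [hs, indicator_of_mem hst]
    rw [flowInner, flowInner]
    simp only [h1]
    rw [← vacProj_expElem, ← ContinuousLinearMap.adjoint_inner_right, vacProj_adjoint,
      ← vacProj_comp_flow, ← ContinuousLinearMap.comp_apply, ← ContinuousLinearMap.comp_assoc,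
      vacProj_comp_vacProj, min_eq_right (le_of_lt hst)]

/-- Right adaptedness of `(j_s(a) Y_s)`. -/
def IsRightAdapted : Prop := ∀ s t : ℝ≥0, s ≤ t → ∀ a η,
  j.toFun s a (Y s (vacProj 𝔨 𝔥 t η)) = j.toFun s a (Y s η)

variable {Y}

theorem IsRightAdapted.qsIntegralAt_vacProj (hY : IsRightAdapted j Y) {s t : ℝ≥0} (hst : s ≤ t)
    (η : HTensor 𝔥 (Noise 𝔨)) :
    qsIntegralAt j hc Y s (vacProj 𝔨 𝔥 t η) = qsIntegralAt j hc Y s η :=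
  isTotal_expElem.eq_of_inner fun i => by
    rw [inner_qsIntegralAt, inner_qsIntegralAt]
    refine setIntegral_congr_fun measurableSet_Iio fun r hr => ?_
    simp only [flowInner]
    rw [hY r t ((le_of_lt hr).trans hst)]

/-- The zeroth iterate `1` is not vacuum adapted, but `j_s(a) P_t = j_s(a) P_s P_t = j_s(a)` for `s
≤ t`. Hence the property is imposed only after multiplication by `j_s(a)`, the form in which `Y`
enters the integral. -/
theorem isRightAdapted_iteratedIntegral (n : ℕ) : IsRightAdapted j (iteratedIntegral j hc n) := by
  induction n with
  | zero =>
    intro s t hst a η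
    change j.toFun s a (vacProj 𝔨 𝔥 t η) = j.toFun s a η
    rw [← flow_comp_vacProj, ContinuousLinearMap.comp_apply, ContinuousLinearMap.comp_apply]
    congr 1
    rw [← ContinuousLinearMap.comp_apply, vacProj_comp_vacProj, min_eq_left hst]
  | succ n ih =>
    intro s t hst a η
    exact congrArg _ (ih.qsIntegralAt_vacProj j hc hst η)

theorem isRightAdapted_solution : IsRightAdapted j (solution j hc) := by
  intro s t hst a η
  have h1 := (hasSum_solution_apply j hc s (vacProj 𝔨 𝔥 t η)).mapL (j.toFun s a)
  have h2 := (hasSum_solution_apply j hc s η).mapL (j.toFun s a)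
  simp only [isRightAdapted_iteratedIntegral j hc _ s t hst a η] at h1
  exact h1.unique h2

theorem isVacAdapted_qsIntegralAt_solution :
    IsVacAdapted (qsIntegralAt j hc (solution j hc)) := by
  intro t
  rw [← ContinuousLinearMap.comp_assoc, vacProj_comp_qsIntegralAt]
  exact ContinuousLinearMap.ext fun η =>
    ((isRightAdapted_solution j hc).qsIntegralAt_vacProj j hc le_rfl η).symm

theorem mem_noiseAlg_iff {T : HTensor 𝔥 (Noise 𝔨) →L[ℂ] HTensor 𝔥 (Noise 𝔨)} :
    T ∈ noiseAlg A 𝔨 ↔ ∀ b ∈ A.commutant, ∀ η,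
      opTensor b (ContinuousLinearMap.id ℂ (Noise 𝔨)) (T η) =
        T (opTensor b (ContinuousLinearMap.id ℂ (Noise 𝔨)) η) := by
  rw [noiseAlg, mem_uwTensor_iff_commutes]
  exact ⟨fun h b hb η => congrArg (fun S : _ →L[ℂ] _ => S η) (h b hb),
    fun h b hb => ContinuousLinearMap.ext fun η => h b hb η⟩

theorem one_mem_noiseAlg : 1 ∈ noiseAlg A 𝔨 := mem_noiseAlg_iff.2 fun _ _ _ => rfl

theorem smul_mem_noiseAlg (z : ℂ) {T : HTensor 𝔥 (Noise 𝔨) →L[ℂ] HTensor 𝔥 (Noise 𝔨)}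
    (hT : T ∈ noiseAlg A 𝔨) : z • T ∈ noiseAlg A 𝔨 :=
  mem_noiseAlg_iff.2 fun b hb η => by
    rw [smul_apply, smul_apply, map_smul, mem_noiseAlg_iff.1 hT b hb]

theorem comp_mem_noiseAlg {S T : HTensor 𝔥 (Noise 𝔨) →L[ℂ] HTensor 𝔥 (Noise 𝔨)}
    (hS : S ∈ noiseAlg A 𝔨) (hT : T ∈ noiseAlg A 𝔨) : S ∘L T ∈ noiseAlg A 𝔨 :=
  mem_noiseAlg_iff.2 fun b hb η => by
    rw [ContinuousLinearMap.comp_apply, ContinuousLinearMap.comp_apply,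
      mem_noiseAlg_iff.1 hS b hb, mem_noiseAlg_iff.1 hT b hb]

/-- In matrix elements `b ⊗ I` acts on `u` as `b*` and leaves `f` alone, so it passes under the
integral and there commutes with the flow and with `Y`. -/
theorem qsIntegralAt_mem_noiseAlg (hY : ∀ s, Y s ∈ noiseAlg A 𝔨) (t : ℝ≥0) :
    qsIntegralAt j hc Y t ∈ noiseAlg A 𝔨 :=
  mem_noiseAlg_iff.2 fun b hb η => isTotal_expElem.eq_of_inner fun i => by
    have h1 : ∀ z : HTensor 𝔥 (Noise 𝔨),
        ⟪expElem i, opTensor b (ContinuousLinearMap.id ℂ (Noise 𝔨)) z⟫_ℂ =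
          ⟪expElem (b.adjoint i.1, i.2), z⟫_ℂ := by
      intro z
      rw [← ContinuousLinearMap.adjoint_inner_left, opTensor_adjoint,
        ContinuousLinearMap.adjoint_id, expElem, opTensor_elem]
      rfl
    rw [h1, inner_qsIntegralAt, inner_qsIntegralAt]
    refine integral_congr_ae (Eventually.of_forall fun s => ?_)
    simp only [flowInner]
    rw [← h1, mem_noiseAlg_iff.1 (j.mem_noiseAlg s _) b hb, mem_noiseAlg_iff.1 (hY s) b hb]

theorem iteratedIntegral_mem_noiseAlg (n : ℕ) : ∀ t, iteratedIntegral j hc n t ∈ noiseAlg A 𝔨 := by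
  induction n with
  | zero => exact fun _ => one_mem_noiseAlg
  | succ n ih => exact fun t => qsIntegralAt_mem_noiseAlg j hc ih t

theorem solution_mem_noiseAlg (t : ℝ≥0) : solution j hc t ∈ noiseAlg A 𝔨 :=
  mem_noiseAlg_iff.2 fun b hb η => by
    have h1 := (hasSum_solution_apply j hc t η).mapL
      (opTensor b (ContinuousLinearMap.id ℂ (Noise 𝔨)))
    simp only [mem_noiseAlg_iff.1 (iteratedIntegral_mem_noiseAlg j hc _ t) b hb] at h1
    exact h1.unique (hasSum_solution_apply j hc t _)

end Flow

/-! ### Operators on the second leg and adaptedness of columns -/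

section Column

variable {𝓗 X Y : Type*} [NormedAddCommGroup 𝓗] [InnerProductSpace ℂ 𝓗]
  [NormedAddCommGroup X] [InnerProductSpace ℂ X] [CompleteSpace X]
  [NormedAddCommGroup Y] [InnerProductSpace ℂ Y] [CompleteSpace Y]

theorem ketLeft_adjoint_comp_opTensor (x : 𝓗) (T : X →L[ℂ] Y) :
    (ketLeft x).adjoint ∘L opTensor (ContinuousLinearMap.id ℂ 𝓗) T =
      T ∘L (ketLeft x).adjoint :=
  isTotal_elem_all.ext_clm fun p => by
    rw [ContinuousLinearMap.comp_apply, ContinuousLinearMap.comp_apply, opTensor_elem,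
      ketLeft_adjoint_elem, ketLeft_adjoint_elem, map_smul]
    rfl

theorem comp_ketLeft_adjoint_comp_opTensor (C : X →L[ℂ] HTensor 𝓗 X) (ω : 𝓗) (T : X →L[ℂ] X) :
    (C ∘L (ketLeft ω).adjoint) ∘L opTensor (ContinuousLinearMap.id ℂ 𝓗) T =
      C ∘L T ∘L (ketLeft ω).adjoint := by
  rw [ContinuousLinearMap.comp_assoc, ketLeft_adjoint_comp_opTensor]

theorem adapted_column {C : X →L[ℂ] HTensor 𝓗 X} (ω : 𝓗) {T P : X →L[ℂ] X}
    (h1 : opTensor (ContinuousLinearMap.id ℂ 𝓗) P ∘L C = C) (h2 : ∀ η, C (T (P η)) = C (T η)) :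
    C ∘L T ∘L (ketLeft ω).adjoint = opTensor (ContinuousLinearMap.id ℂ 𝓗) P ∘L
      (C ∘L T ∘L (ketLeft ω).adjoint) ∘L opTensor (ContinuousLinearMap.id ℂ 𝓗) P := by
  have h3 : (C ∘L T ∘L (ketLeft ω).adjoint) ∘L opTensor (ContinuousLinearMap.id ℂ 𝓗) P =
      C ∘L T ∘L (ketLeft ω).adjoint := by
    rw [ContinuousLinearMap.comp_assoc, ContinuousLinearMap.comp_assoc,
      ketLeft_adjoint_comp_opTensor]
    exact ContinuousLinearMap.ext fun η => h2 _
  rw [h3]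
  exact ContinuousLinearMap.ext fun η =>
    (congrArg (fun S : X →L[ℂ] HTensor 𝓗 X => S (T ((ketLeft ω).adjoint η))) h1).symm

end Column

/-! ### The splitting along `ω` and the integrand norms -/

section Hat

variable {𝔨 X : Type*} [NormedAddCommGroup 𝔨] [InnerProductSpace ℂ 𝔨]
  [NormedAddCommGroup X] [InnerProductSpace ℂ X] [CompleteSpace X]

theorem inner_omega_hat (x : 𝔨) : ⟪omega 𝔨, hat x⟫_ℂ = 1 := by
  rw [omega, inner_hat, inner_zero_left, add_zero]

theorem inner_hat_omega (x : 𝔨) : ⟪hat x, omega 𝔨⟫_ℂ = 1 := by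
  rw [omega, inner_hat, inner_zero_right, add_zero]

theorem projK_apply (x : Hat 𝔨) : projK 𝔨 x = x - ⟪omega 𝔨, x⟫_ℂ • omega 𝔨 := by
  rw [projK, Submodule.starProjection_orthogonal', sub_apply,
    Submodule.starProjection_unit_singleton ℂ norm_omega]
  rfl

theorem Delta_apply (y : HTensor (Hat 𝔨) X) :
    Delta 𝔨 X y = y - ketLeft (omega 𝔨) ((ketLeft (omega 𝔨)).adjoint y) := by
  have : Delta 𝔨 X = ContinuousLinearMap.id ℂ _ -
      ketLeft (omega 𝔨) ∘L (ketLeft (omega 𝔨)).adjoint :=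
    isTotal_elem_all.ext_clm fun p => by
      rw [Delta, opTensor_elem, projK_apply, sub_apply, ContinuousLinearMap.comp_apply,
        ketLeft_adjoint_elem, map_smul, ketLeft_apply, ← ketRight_apply, map_sub, map_smul]
      rfl
  rw [this]
  rfl

end Hat

/-- Testing on the unit ball permits estimates that are not homogeneous in `w`, such as those
obtained from `ab ≤ a² + b²`. -/
theorem IsTotal.norm_le_of_inner_unit {ι H : Type*} [NormedAddCommGroup H]
    [InnerProductSpace ℂ H] {e : ι → H} (he : IsTotal e) {z : H} {C : ℝ} (hC : 0 ≤ C)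
    (h : ∀ w : ι →₀ ℂ, ‖Finsupp.linearCombination ℂ e w‖ ≤ 1 →
      ‖⟪Finsupp.linearCombination ℂ e w, z⟫_ℂ‖ ≤ C) : ‖z‖ ≤ C := by
  refine he.norm_le_of_inner hC fun w => ?_
  rcases (norm_nonneg (Finsupp.linearCombination ℂ e w)).eq_or_lt with h0 | h0
  · rw [norm_eq_zero.1 h0.symm]
    simp
  · set n := ‖Finsupp.linearCombination ℂ e w‖ with hn
    have h1 := h (((n⁻¹ : ℝ) : ℂ) • w) (by
      rw [map_smul, norm_smul, ← hn, Complex.norm_real, norm_inv, Real.norm_of_nonneg h0.le,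
        inv_mul_cancel₀ h0.ne'])
    rw [map_smul, inner_smul_left, norm_mul, RCLike.norm_conj, Complex.norm_real, norm_inv,
      Real.norm_of_nonneg h0.le, inv_mul_le_iff₀ h0] at h1
    linarith

/-- `[0, t)` has finite measure, so a uniform bound controls every `L^p` norm. -/
theorem eLpNorm_comp_lt_top {H K L N : Type*} [NormedAddCommGroup H] [NormedSpace ℂ H]
    [NormedAddCommGroup K] [NormedSpace ℂ K] [NormedAddCommGroup L] [NormedSpace ℂ L]
    [NormedAddCommGroup N] [NormedSpace ℂ N] (R : K →L[ℂ] L) (Q : N →L[ℂ] H)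
    {G : ℝ≥0 → H →L[ℂ] K} {t : ℝ≥0} {B : ℝ} (hB : ∀ s < t, ‖G s‖ ≤ B) (p : ℝ≥0∞) :
    eLpNorm (fun s => ‖R ∘L G s ∘L Q‖) p (lebesgue.restrict (Set.Iio t)) < ∞ := by
  have h : ∀ᵐ s ∂lebesgue.restrict (Set.Iio t), ‖‖R ∘L G s ∘L Q‖‖ ≤ ‖R‖ * (B * ‖Q‖) := by
    refine (ae_restrict_iff' measurableSet_Iio).2 (Filter.Eventually.of_forall fun s hs => ?_)
    rw [norm_norm]
    calc _ ≤ ‖R‖ * (‖G s‖ * ‖Q‖) := (ContinuousLinearMap.opNorm_comp_le _ _).trans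
          (by gcongr; exact ContinuousLinearMap.opNorm_comp_le _ _)
      _ ≤ _ := by gcongr; exact hB s hs
  refine (eLpNorm_le_of_ae_bound h).trans_lt ?_
  exact ENNReal.mul_lt_top (ENNReal.rpow_lt_top_of_nonneg (by positivity) (measure_ne_top _ _))
    ENNReal.ofReal_lt_top

theorem isIntegrand_norm_lt_top {𝔨 X : Type*} [NormedAddCommGroup 𝔨] [InnerProductSpace ℂ 𝔨]
    [NormedAddCommGroup X] [InnerProductSpace ℂ X] [CompleteSpace X]
    {G : ℝ≥0 → HTensor (Hat 𝔨) X →L[ℂ] HTensor (Hat 𝔨) X}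
    (hG : ∀ t : ℝ≥0, ∃ B : ℝ, ∀ s < t, ‖G s‖ ≤ B) (t : ℝ≥0) :
    eLpNorm (fun s => ‖(ketLeft (omega 𝔨)).adjoint ∘L G s ∘L ketLeft (omega 𝔨)‖) 1
        (lebesgue.restrict (Set.Iio t)) +
      eLpNorm (fun s => ‖Delta 𝔨 _ ∘L G s ∘L ketLeft (omega 𝔨)‖) 2
        (lebesgue.restrict (Set.Iio t)) +
      eLpNorm (fun s => ‖(ketLeft (omega 𝔨)).adjoint ∘L G s ∘L Delta 𝔨 _‖) 2
        (lebesgue.restrict (Set.Iio t)) +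
      eLpNorm (fun s => ‖Delta 𝔨 _ ∘L G s ∘L Delta 𝔨 _‖) ∞
        (lebesgue.restrict (Set.Iio t)) < ∞ := by
  obtain ⟨B, hB⟩ := hG t
  exact ENNReal.add_lt_top.2 ⟨ENNReal.add_lt_top.2 ⟨ENNReal.add_lt_top.2
    ⟨eLpNorm_comp_lt_top _ _ hB _, eLpNorm_comp_lt_top _ _ hB _⟩, eLpNorm_comp_lt_top _ _ hB _⟩,
    eLpNorm_comp_lt_top _ _ hB _⟩

theorem measurable_inner_apply {H : Type*} [NormedAddCommGroup H] [InnerProductSpace ℂ H]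
    (Y : C(ℝ≥0, H →L[ℂ] H)) (ζ' ζ : H) : Measurable fun t => ⟪ζ', Y t ζ⟫_ℂ :=
  (continuous_const.inner (Y.continuous.clm_apply continuous_const)).measurable

/-! ### The integrand of the equation in closed form -/

section Flow

set_option linter.unusedSectionVars false

open Set Filter Topology

variable {𝔥 𝔨 : Type*} [NormedAddCommGroup 𝔥] [InnerProductSpace ℂ 𝔥] [CompleteSpace 𝔥]
  [NormedAddCommGroup 𝔨] [InnerProductSpace ℂ 𝔨] [CompleteSpace 𝔨]
  {A : VonNeumannAlgebra 𝔥} (j : QSFlow A 𝔨)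
  {c : 𝔥 →L[ℂ] HTensor (Hat 𝔨) 𝔥} (hc : c ∈ uwKetTensor (Hat 𝔨) (A : Set (𝔥 →L[ℂ] 𝔥)))

/-- The integrand of the equation in closed form. -/
def columnIntegrand (s : ℝ≥0) (T : HTensor 𝔥 (Noise 𝔨) →L[ℂ] HTensor 𝔥 (Noise 𝔨)) :
    HTensor (Hat 𝔨) (HTensor 𝔥 (Noise 𝔨)) →L[ℂ] HTensor (Hat 𝔨) (HTensor 𝔥 (Noise 𝔨)) :=
  column (j.toFun s) hc ∘L T ∘L (ketLeft (omega 𝔨)).adjoint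

theorem ampliation_comp_opTensor (s : ℝ≥0)
    (T : HTensor 𝔥 (Noise 𝔨) →L[ℂ] HTensor 𝔥 (Noise 𝔨)) :
    ampliation (j.toFun s) (c ∘L (ketLeft (omega 𝔨)).adjoint) ∘L
      opTensor (ContinuousLinearMap.id ℂ (Hat 𝔨)) T = columnIntegrand j hc s T := by
  rw [ampliation_column _ hc]
  exact comp_ketLeft_adjoint_comp_opTensor _ _ _

theorem slice_columnIntegrand (s : ℝ≥0) (T : HTensor 𝔥 (Noise 𝔨) →L[ℂ] HTensor 𝔥 (Noise 𝔨))
    (x y : Hat 𝔨) : (ketLeft x).adjoint ∘L columnIntegrand j hc s T ∘L ketLeft y =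
      ⟪omega 𝔨, y⟫_ℂ • (j.toFun s (ketSlice A x hc) ∘L T) := by
  rw [← ketLeft_adjoint_comp_column (j.toFun s) hc x]
  ext η
  simp [columnIntegrand, ketLeft_apply, ketLeft_adjoint_elem]

theorem columnIntegrand_ketLeft_omega (s : ℝ≥0)
    (T : HTensor 𝔥 (Noise 𝔨) →L[ℂ] HTensor 𝔥 (Noise 𝔨)) (η : HTensor 𝔥 (Noise 𝔨)) :
    columnIntegrand j hc s T (ketLeft (omega 𝔨) η) = column (j.toFun s) hc (T η) := by
  simp only [columnIntegrand, ContinuousLinearMap.comp_apply, ketLeft_apply, ketLeft_adjoint_elem]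
  rw [show ⟪omega 𝔨, omega 𝔨⟫_ℂ = 1 from inner_omega_hat 0, one_smul]

/-- Here `⟨ω, ĝ(s)⟩ = 1` removes `ĝ(s)`, and the equation becomes a Volterra equation for the curve
`M_s v ε(g)`. -/
theorem inner_slice_columnIntegrand (s : ℝ≥0)
    (T : HTensor 𝔥 (Noise 𝔨) →L[ℂ] HTensor 𝔥 (Noise 𝔨)) (u v : 𝔥) (f g : L2 𝔨) :
    ⟪elem u (expVec f), ((ketLeft (hat (f s))).adjoint ∘L columnIntegrand j hc s T ∘L
      ketLeft (hat (g s))) (elem v (expVec g))⟫_ℂ =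
      flowInner j hc (u, f) (T (expElem (v, g))) s := by
  rw [slice_columnIntegrand, inner_omega_hat, one_smul]
  rfl

/-! ### Existence -/

theorem vacProj_comp_column (s : ℝ≥0) :
    opTensor (ContinuousLinearMap.id ℂ (Hat 𝔨)) (vacProj 𝔨 𝔥 s) ∘L column (j.toFun s) hc =
      column (j.toFun s) hc :=
  ContinuousLinearMap.ext fun η => isTotal_elem_all.eq_of_inner fun p => by
    rw [ContinuousLinearMap.comp_apply, ← ContinuousLinearMap.adjoint_inner_left, opTensor_adjoint,
      ContinuousLinearMap.adjoint_id, vacProj_adjoint, opTensor_elem, inner_column, inner_column,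
      ← vacProj_adjoint, ContinuousLinearMap.adjoint_inner_left, ← ContinuousLinearMap.comp_apply,
      vacProj_comp_flow]
    rfl

theorem columnIntegrand_mem (s : ℝ≥0) {T : HTensor 𝔥 (Noise 𝔨) →L[ℂ] HTensor 𝔥 (Noise 𝔨)}
    (hT : T ∈ noiseAlg A 𝔨) : columnIntegrand j hc s T ∈
      uwTensor (Set.univ : Set (Hat 𝔨 →L[ℂ] Hat 𝔨)) (noiseAlg A 𝔨) :=
  mem_uwTensor_univ_of_slices fun x y => by
    rw [slice_columnIntegrand]
    exact smul_mem_noiseAlg _ (comp_mem_noiseAlg (j.mem_noiseAlg s _) hT)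

theorem norm_columnIntegrand_le (s : ℝ≥0)
    (T : HTensor 𝔥 (Noise 𝔨) →L[ℂ] HTensor 𝔥 (Noise 𝔨)) :
    ‖columnIntegrand j hc s T‖ ≤ ‖c‖ * ‖T‖ := by
  have h1 : ‖((ketLeft (omega 𝔨)).adjoint : HTensor (Hat 𝔨) (HTensor 𝔥 (Noise 𝔨)) →L[ℂ] _)‖ ≤ 1 := by
    rw [LinearIsometryEquiv.norm_map]
    exact (norm_ketLeft_le _).trans norm_omega.le
  calc _ ≤ ‖column (j.toFun s) hc‖ * (‖T‖ * ‖(ketLeft (omega 𝔨)).adjoint‖) :=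
        (ContinuousLinearMap.opNorm_comp_le _ _).trans
          (by gcongr; exact ContinuousLinearMap.opNorm_comp_le _ _)
    _ ≤ ‖c‖ * (‖T‖ * 1) := by
        gcongr
        exact norm_column_le _ hc
    _ = _ := by ring

theorem column_solution_vacProj (t : ℝ≥0) (η : HTensor 𝔥 (Noise 𝔨)) :
    column (j.toFun t) hc (solution j hc t (vacProj 𝔨 𝔥 t η)) =
      column (j.toFun t) hc (solution j hc t η) :=
  isTotal_elem_all.eq_of_inner fun p =>
    ((inner_column _ hc _ _ _).trans (congrArg (fun z => ⟪p.2, z⟫_ℂ)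
      (isRightAdapted_solution j hc t t le_rfl _ η))).trans (inner_column _ hc _ _ _).symm

theorem exists_norm_columnIntegrand_solution_le (t : ℝ≥0) :
    ∃ B : ℝ, ∀ s < t, ‖columnIntegrand j hc s (solution j hc s)‖ ≤ B :=
  (exists_norm_le_of_continuous (solution j hc) t).imp' (‖c‖ * ·) fun _ hB s hs =>
    (norm_columnIntegrand_le j hc s _).trans
      (mul_le_mul_of_nonneg_left (hB.2 s hs.le) (norm_nonneg c))

theorem isIntegrand_solution :
    IsIntegrand A fun s => columnIntegrand j hc s (solution j hc s) where
  process :=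
    { mem := fun s => columnIntegrand_mem j hc s (solution_mem_noiseAlg j hc s)
      measurable := fun ζ' _ =>
        measurable_inner_column j hc (stronglyMeasurable_apply (solution j hc) _) ζ' }
  adapted t := adapted_column _ (vacProj_comp_column j hc t) (column_solution_vacProj j hc t)
  norm_lt_top := isIntegrand_norm_lt_top fun t => exists_norm_columnIntegrand_solution_le j hc t

theorem isSolution_solution : IsSolution j c (solution j hc) where
  process :=
    { mem := solution_mem_noiseAlg j hc
      measurable := measurable_inner_apply (solution j hc) }
  adapted := by
    have h : (fun t => solution j hc t - 1) = qsIntegralAt j hc (solution j hc) := by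
      funext t
      conv_lhs => rw [solution_eq]
      exact add_sub_cancel_left _ _
    rw [h]
    exact isVacAdapted_qsIntegralAt_solution j hc
  equation := by
    refine ⟨qsIntegralAt j hc (solution j hc), ?_, solution_eq j hc⟩
    simp only [ampliation_comp_opTensor j hc]
    exact
      { integrand := isIntegrand_solution j hc
        process :=
          { mem := qsIntegralAt_mem_noiseAlg j hc (solution_mem_noiseAlg j hc)
            measurable := measurable_inner_apply (qsIntegral j hc (solution j hc)) }
        adapted := isVacAdapted_qsIntegralAt_solution j hc
        integrable := fun t u v f g => by
          simp only [inner_slice_columnIntegrand]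
          exact integrableOn_flowInner_apply j hc (solution j hc) (u, f) (expElem (v, g)) t
        inner_eq := fun t u v f g => by
          simp only [inner_slice_columnIntegrand]
          exact inner_qsIntegralAt j hc (solution j hc) t (u, f) (expElem (v, g)) }

end Flow

/-! ### Uniqueness -/

section Generic

theorem ketLeft_adjoint_column_apply {𝔥 𝓗 X : Type*} [NormedAddCommGroup 𝔥]
    [InnerProductSpace ℂ 𝔥] [CompleteSpace 𝔥] [NormedAddCommGroup 𝓗] [InnerProductSpace ℂ 𝓗]
    [CompleteSpace 𝓗] [NormedAddCommGroup X] [InnerProductSpace ℂ X] [CompleteSpace X]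
    {A : VonNeumannAlgebra 𝔥} (φ : A.toStarSubalgebra →⋆ₙₐ[ℂ] (X →L[ℂ] X))
    {c : 𝔥 →L[ℂ] HTensor 𝓗 𝔥} (hc : c ∈ uwKetTensor 𝓗 (A : Set (𝔥 →L[ℂ] 𝔥))) (x : 𝓗) (q : X) :
    (ketLeft x).adjoint (column φ hc q) = φ (ketSlice A x hc) q :=
  congrArg (fun T : X →L[ℂ] X => T q) (ketLeft_adjoint_comp_column φ hc x)

theorem inner_elem_hat_eq_add {𝔨 X : Type*} [NormedAddCommGroup 𝔨] [InnerProductSpace ℂ 𝔨]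
    [NormedAddCommGroup X] [InnerProductSpace ℂ X] [CompleteSpace X] (x : 𝔨) (p : X)
    {y : HTensor (Hat 𝔨) X} {q : X} (hq : (ketLeft (omega 𝔨)).adjoint y = q) :
    ⟪elem (hat x) p, y⟫_ℂ = ⟪p, q⟫_ℂ + ⟪elem (hat x) p, Delta 𝔨 X y⟫_ℂ := by
  rw [Delta_apply, inner_sub_right, hq, ketLeft_apply, inner_elem, inner_hat_omega, one_mul]
  ring

variable {α H K : Type*} [MeasurableSpace α] {μ : Measure α} [NormedAddCommGroup H]
  [NormedSpace ℂ H] [NormedAddCommGroup K] [NormedSpace ℂ K] {T : α → H →L[ℂ] K}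

/-- Lower integrals are monotone without measurability; neither `‖T s‖` nor `‖T s η‖` is known to be
measurable. -/
theorem lintegral_enorm_apply_ne_top (h : eLpNorm (fun s => ‖T s‖) 1 μ < ∞) (η : H) :
    ∫⁻ s, ‖T s η‖ₑ ∂μ ≠ ∞ := by
  rw [eLpNorm_one_eq_lintegral_enorm] at h
  simp only [enorm_norm] at h
  refine ne_top_of_le_ne_top (ENNReal.mul_ne_top h.ne (enorm_ne_top (x := η))) ?_
  rw [← lintegral_mul_const' _ _ enorm_ne_top]
  exact lintegral_mono fun s => (T s).le_opENorm η

theorem lintegral_enorm_apply_sq_ne_top (h : eLpNorm (fun s => ‖T s‖) 2 μ < ∞) (η : H) :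
    ∫⁻ s, ‖T s η‖ₑ ^ 2 ∂μ ≠ ∞ := by
  have h' := lintegral_rpow_enorm_lt_top_of_eLpNorm_lt_top (by norm_num) (by norm_num) h
  simp only [enorm_norm, ENNReal.toReal_ofNat, ENNReal.rpow_ofNat] at h'
  refine ne_top_of_le_ne_top
    (ENNReal.mul_ne_top h'.ne (ENNReal.pow_ne_top (n := 2) (enorm_ne_top (x := η)))) ?_
  rw [← lintegral_mul_const' _ _ (ENNReal.pow_ne_top enorm_ne_top)]
  refine lintegral_mono fun s => ?_
  rw [← mul_pow]
  gcongr
  exact (T s).le_opENorm η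

end Generic

section Uniqueness

set_option linter.unusedSectionVars false

open Set Filter Topology

variable {𝔥 𝔨 : Type*} [NormedAddCommGroup 𝔥] [InnerProductSpace ℂ 𝔥] [CompleteSpace 𝔥]
  [NormedAddCommGroup 𝔨] [InnerProductSpace ℂ 𝔨] [CompleteSpace 𝔨]
  {A : VonNeumannAlgebra 𝔥} (j : QSFlow A 𝔨)
  {c : 𝔥 →L[ℂ] HTensor (Hat 𝔨) 𝔥} (hc : c ∈ uwKetTensor (Hat 𝔨) (A : Set (𝔥 →L[ℂ] 𝔥)))

/-- Each substitution of the bound into the equation halves the weighted norm, starting from local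
boundedness. -/
theorem eq_zero_of_inner_eq_integral {x : ℝ≥0 → HTensor 𝔥 (Noise 𝔨)}
    (hint : ∀ t i, IntegrableOn (fun s => flowInner j hc i (x s) s) (Iio t) lebesgue)
    (hx : ∀ t i, ⟪expElem i, x t⟫_ℂ = ∫ s in Iio t, flowInner j hc i (x s) s ∂lebesgue)
    (hb : ∀ T : ℝ≥0, ∃ L : ℝ, ∀ t ≤ T, ‖x t‖ ≤ L) (T : ℝ≥0) : x T = 0 := by
  obtain ⟨L, hL⟩ := hb T
  have hL0 : 0 ≤ L := (norm_nonneg _).trans (hL T le_rfl)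
  have h : ∀ (n : ℕ), ∀ t ≤ T, ‖x t‖ ≤ L * (1 / 2) ^ n * Real.exp (growthRate ‖c‖ T * t) := by
    intro n
    induction n with
    | zero =>
      intro t ht
      rw [pow_zero, mul_one]
      refine (hL t ht).trans (le_mul_of_one_le_right hL0 (Real.one_le_exp ?_))
      exact mul_nonneg (growthRate_pos _ _).le t.coe_nonneg
    | succ n ih =>
      intro t ht
      refine (norm_le_of_inner_eq_integral j hc (r := 0) (hint t)
        (setIntegral_exp_sq_le (growthRate_pos ‖c‖ T) t).1 (fun _ => by positivity)
        (fun s hs => ih s (hs.le.trans ht)) fun i => ?_).trans ?_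
      · rw [hx, Iio_eq_Ico]
      · rw [← Iio_eq_Ico, pow_succ, ← mul_assoc]
        exact contraction_bound (norm_nonneg c) (by positivity) ht
  have h1 : Tendsto (fun n : ℕ => L * (1 / 2) ^ n * Real.exp (growthRate ‖c‖ T * T)) atTop
      (𝓝 (L * 0 * Real.exp (growthRate ‖c‖ T * T))) :=
    ((tendsto_pow_atTop_nhds_zero_of_lt_one (by norm_num) (by norm_num)).const_mul L).mul_const _
  rw [mul_zero, zero_mul] at h1
  exact norm_le_zero_iff.1 (ge_of_tendsto' h1 fun n => h n T le_rfl)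

theorem inner_vacProj_flow (s : ℝ≥0) (a : A.toStarSubalgebra) (p z : HTensor 𝔥 (Noise 𝔨)) :
    ⟪vacProj 𝔨 𝔥 s p, j.toFun s a z⟫_ℂ = ⟪p, j.toFun s a z⟫_ℂ := by
  rw [← vacProj_adjoint, ContinuousLinearMap.adjoint_inner_left, ← ContinuousLinearMap.comp_apply,
    vacProj_comp_flow]

theorem flowInner_eq_add (i : 𝔥 × L2 𝔨) (z : HTensor 𝔥 (Noise 𝔨)) (s : ℝ≥0) :
    flowInner j hc i z s = ⟪expElem i, j.toFun s (ketSlice A (omega 𝔨) hc) z⟫_ℂ +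
      ⟪hatElem s i, Delta 𝔨 _ (column (j.toFun s) hc z)⟫_ℂ := by
  rw [flowInner_eq, hatElem]
  exact (inner_elem_hat_eq_add _ _ (ketLeft_adjoint_column_apply _ hc _ z)).trans
    (congrArg (· + _) (inner_vacProj_flow j s _ _ z))

theorem sum_flowInner_eq_add (w : 𝔥 × L2 𝔨 →₀ ℂ) (z : HTensor 𝔥 (Noise 𝔨)) (s : ℝ≥0) :
    (w.sum fun i a => (starRingEnd ℂ) a * flowInner j hc i z s) =
      ⟪Finsupp.linearCombination ℂ expElem w, j.toFun s (ketSlice A (omega 𝔨) hc) z⟫_ℂ +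
      ⟪Finsupp.linearCombination ℂ (hatElem s) w, Delta 𝔨 _ (column (j.toFun s) hc z)⟫_ℂ := by
  rw [inner_linearCombination_left, inner_linearCombination_left, ← Finsupp.sum_add]
  simp only [flowInner_eq_add, mul_add]

/-- The `𝔨`-part is split by `ab ≤ a² + b²`, which separates the energy of the combination from the
`L²` norm of the integrand. -/
theorem enorm_sum_flowInner_le (w : 𝔥 × L2 𝔨 →₀ ℂ) (z : HTensor 𝔥 (Noise 𝔨)) (s : ℝ≥0) :
    ‖w.sum fun i a => (starRingEnd ℂ) a * flowInner j hc i z s‖ₑ ≤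
      ‖⟪Finsupp.linearCombination ℂ expElem w, j.toFun s (ketSlice A (omega 𝔨) hc) z⟫_ℂ‖ₑ +
      (ENNReal.ofReal (‖Finsupp.linearCombination ℂ (hatElem s) w‖ ^ 2) +
        ‖Delta 𝔨 _ (column (j.toFun s) hc z)‖ₑ ^ 2) := by
  rw [sum_flowInner_eq_add]
  refine (enorm_add_le _ _).trans ?_
  gcongr
  set a := Finsupp.linearCombination ℂ (hatElem s) w
  set b := Delta 𝔨 _ (column (j.toFun s) hc z)
  rw [← ofReal_norm, ← ofReal_norm, ← ENNReal.ofReal_pow (norm_nonneg _),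
    ← ENNReal.ofReal_add (by positivity) (by positivity)]
  refine ENNReal.ofReal_le_ofReal ((norm_inner_le_norm _ _).trans ?_)
  nlinarith [sq_nonneg (‖a‖ - ‖b‖), sq_nonneg (‖a‖ + ‖b‖)]

/-- An a priori bound without any bound on `z`: the `ω`-part is controlled by an `L¹` norm, the
`𝔨`-part by an `L²` norm together with the energy inequality. -/
theorem exists_norm_le_of_inner_eq_integral {x z : ℝ≥0 → HTensor 𝔥 (Noise 𝔨)} {T : ℝ≥0}
    (hint : ∀ i, IntegrableOn (fun s => flowInner j hc i (z s) s) (Iio T) lebesgue)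
    (hx : ∀ t i, ⟪expElem i, x t⟫_ℂ = ∫ s in Iio t, flowInner j hc i (z s) s ∂lebesgue)
    (hm : ∀ ζ, Measurable fun s => ⟪ζ, j.toFun s (ketSlice A (omega 𝔨) hc) (z s)⟫_ℂ)
    (h1 : ∫⁻ s in Iio T, ‖j.toFun s (ketSlice A (omega 𝔨) hc) (z s)‖ₑ ∂lebesgue ≠ ∞)
    (h2 : ∫⁻ s in Iio T, ‖Delta 𝔨 _ (column (j.toFun s) hc (z s))‖ₑ ^ 2 ∂lebesgue ≠ ∞) :
    ∃ L : ℝ, ∀ t ≤ T, ‖x t‖ ≤ L := by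
  set I1 := ∫⁻ s in Iio T, ‖j.toFun s (ketSlice A (omega 𝔨) hc) (z s)‖ₑ ∂lebesgue with hI1
  set I2 := ∫⁻ s in Iio T, ‖Delta 𝔨 _ (column (j.toFun s) hc (z s))‖ₑ ^ 2 ∂lebesgue with hI2
  have hfin : I1 + (ENNReal.ofReal (T + 1) + I2) ≠ ∞ :=
    ENNReal.add_ne_top.2 ⟨h1, ENNReal.add_ne_top.2 ⟨ENNReal.ofReal_ne_top, h2⟩⟩
  refine ⟨(I1 + (ENNReal.ofReal (T + 1) + I2)).toReal, fun t ht => ?_⟩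
  refine isTotal_expElem.norm_le_of_inner_unit ENNReal.toReal_nonneg fun w hw => ?_
  have e : ⟪Finsupp.linearCombination ℂ expElem w, x t⟫_ℂ =
      ∫ s in Iio t, w.sum fun i a => (starRingEnd ℂ) a * flowInner j hc i (z s) s ∂lebesgue := by
    rw [inner_linearCombination_left]
    simp only [hx, Finsupp.sum]
    rw [integral_finsetSum _ fun i _ => ((hint i).mono_set (Iio_subset_Iio ht)).const_mul _]
    simp only [integral_const_mul]
  rw [e, ← toReal_enorm]
  refine ENNReal.toReal_mono hfin ((enorm_integral_le_lintegral_enorm _).trans ?_)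
  refine (lintegral_mono_set (Iio_subset_Iio ht)).trans
    ((lintegral_mono fun s => enorm_sum_flowInner_le j hc w (z s) s).trans ?_)
  have hΞ := norm_sq_hatElem_combination w T
  -- Additivity needs measurability of one summand only; the squared norm of the `𝔨`-part is always
  -- the other one.
  rw [lintegral_add_left (hm _).enorm,
    lintegral_add_left' hΞ.1.aestronglyMeasurable.aemeasurable.ennreal_ofReal]
  gcongr
  · refine lintegral_mono fun s => ?_
    rw [← ofReal_norm, ← ofReal_norm]
    exact ENNReal.ofReal_le_ofReal ((norm_inner_le_norm _ _).trans
      (mul_le_of_le_one_left (norm_nonneg _) hw))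
  · rw [← ofReal_integral_eq_lintegral_ofReal hΞ.1 (Eventually.of_forall fun s => by positivity)]
    refine ENNReal.ofReal_le_ofReal (hΞ.2.trans ?_)
    exact mul_le_of_le_one_right (by positivity) (pow_le_one₀ (norm_nonneg _) hw)

variable {M : ℝ≥0 → HTensor 𝔥 (Noise 𝔨) →L[ℂ] HTensor 𝔥 (Noise 𝔨)}

theorem IsSolution.isQSIntegral (hM : IsSolution j c M) :
    IsQSIntegral A (fun s => columnIntegrand j hc s (M s)) (fun t => M t - 1) := by
  obtain ⟨Z, hZ, hMZ⟩ := hM.equation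
  have h : (fun t => M t - 1) = Z := by
    funext t
    rw [hMZ]
    exact add_sub_cancel_left _ _
  rw [h]
  simpa only [ampliation_comp_opTensor j hc] using hZ

theorem IsSolution.integrableOn (hM : IsSolution j c M) (t : ℝ≥0) (i k : 𝔥 × L2 𝔨) :
    IntegrableOn (fun s => flowInner j hc i (M s (expElem k)) s) (Iio t) lebesgue := by
  have h := (hM.isQSIntegral j hc).integrable t i.1 k.1 i.2 k.2
  simp only [inner_slice_columnIntegrand] at h
  exact h

theorem IsSolution.inner_sub_one (hM : IsSolution j c M) (t : ℝ≥0) (i k : 𝔥 × L2 𝔨) :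
    ⟪expElem i, (M t - 1) (expElem k)⟫_ℂ =
      ∫ s in Iio t, flowInner j hc i (M s (expElem k)) s ∂lebesgue := by
  have h := (hM.isQSIntegral j hc).inner_eq t i.1 k.1 i.2 k.2
  simp only [inner_slice_columnIntegrand] at h
  exact h

theorem columnIntegrand_slice_omega_apply (s : ℝ≥0)
    (T : HTensor 𝔥 (Noise 𝔨) →L[ℂ] HTensor 𝔥 (Noise 𝔨)) (η : HTensor 𝔥 (Noise 𝔨)) :
    ((ketLeft (omega 𝔨)).adjoint ∘L columnIntegrand j hc s T ∘L ketLeft (omega 𝔨)) η =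
      j.toFun s (ketSlice A (omega 𝔨) hc) (T η) := by
  rw [slice_columnIntegrand, show ⟪omega 𝔨, omega 𝔨⟫_ℂ = 1 from inner_omega_hat 0, one_smul]
  rfl

theorem Delta_columnIntegrand_apply (s : ℝ≥0)
    (T : HTensor 𝔥 (Noise 𝔨) →L[ℂ] HTensor 𝔥 (Noise 𝔨)) (η : HTensor 𝔥 (Noise 𝔨)) :
    (Delta 𝔨 _ ∘L columnIntegrand j hc s T ∘L ketLeft (omega 𝔨)) η =
      Delta 𝔨 _ (column (j.toFun s) hc (T η)) :=
  congrArg (Delta 𝔨 _) (columnIntegrand_ketLeft_omega j hc s T η)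

theorem IsSolution.exists_norm_apply_le (hc : c ∈ uwKetTensor (Hat 𝔨) (A : Set (𝔥 →L[ℂ] 𝔥)))
    (hM : IsSolution j c M) (k : 𝔥 × L2 𝔨) (T : ℝ≥0) :
    ∃ L : ℝ, ∀ t ≤ T, ‖(M t - 1) (expElem k)‖ ≤ L := by
  have hG := (hM.isQSIntegral j hc).integrand
  have hn := (ENNReal.add_lt_top.1 (ENNReal.add_lt_top.1 (hG.norm_lt_top T)).1).1
  have h1 := lintegral_enorm_apply_ne_top (ENNReal.add_lt_top.1 hn).1 (expElem k)
  have h2 := lintegral_enorm_apply_sq_ne_top (ENNReal.add_lt_top.1 hn).2 (expElem k)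
  simp only [columnIntegrand_slice_omega_apply] at h1
  simp only [Delta_columnIntegrand_apply] at h2
  refine exists_norm_le_of_inner_eq_integral j hc (fun i => hM.integrableOn j hc T i k)
    (fun t i => hM.inner_sub_one j hc t i k) (fun ζ => ?_) h1 h2
  have h3 := hG.process.measurable (ketLeft (omega 𝔨) ζ) (ketLeft (omega 𝔨) (expElem k))
  have h4 : ∀ s, ⟪ketLeft (omega 𝔨) ζ, columnIntegrand j hc s (M s)
      (ketLeft (omega 𝔨) (expElem k))⟫_ℂ =
      ⟪ζ, j.toFun s (ketSlice A (omega 𝔨) hc) (M s (expElem k))⟫_ℂ := fun s => by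
    rw [columnIntegrand_ketLeft_omega]
    exact inner_column _ hc _ _ _
  exact (funext h4 : _ = _) ▸ h3

/-- On a fixed `v ε(g)` the difference of two solutions solves the homogeneous Volterra equation and
is locally bounded by the a priori estimate, so it vanishes. -/
theorem IsSolution.unique (hc : c ∈ uwKetTensor (Hat 𝔨) (A : Set (𝔥 →L[ℂ] 𝔥)))
    (hM : IsSolution j c M)
    {M' : ℝ≥0 → HTensor 𝔥 (Noise 𝔨) →L[ℂ] HTensor 𝔥 (Noise 𝔨)} (hM' : IsSolution j c M') :
    M = M' := by
  funext t
  refine isTotal_expElem.ext_clm fun k => sub_eq_zero.1 ?_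
  have e : ∀ s, M s (expElem k) - M' s (expElem k) =
      (M s - 1) (expElem k) - (M' s - 1) (expElem k) := fun s => by
    rw [sub_apply, sub_apply, sub_sub_sub_cancel_right]
  have hsub : ∀ i s, flowInner j hc i (M s (expElem k) - M' s (expElem k)) s =
      flowInner j hc i (M s (expElem k)) s - flowInner j hc i (M' s (expElem k)) s := fun i s => by
    rw [flowInner, flowInner, flowInner, map_sub, inner_sub_right]
  refine eq_zero_of_inner_eq_integral j hc (x := fun s => M s (expElem k) - M' s (expElem k))
    (fun t i => ?_) (fun t i => ?_) (fun T => ?_) t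
  · simp only [hsub]
    exact (hM.integrableOn j hc t i k).sub (hM'.integrableOn j hc t i k)
  · simp only [hsub]
    rw [integral_sub (hM.integrableOn j hc t i k) (hM'.integrableOn j hc t i k), e,
      inner_sub_right, hM.inner_sub_one j hc, hM'.inner_sub_one j hc]
  · obtain ⟨L, hL⟩ := hM.exists_norm_apply_le j hc k T
    obtain ⟨L', hL'⟩ := hM'.exists_norm_apply_le j hc k T
    refine ⟨L + L', fun s hs => ?_⟩
    simp only [e]
    exact (norm_sub_le _ _).trans (add_le_add (hL s hs) (hL' s hs))

end Uniqueness

end VacuumQSDE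

end

theorem lemma4p2 {𝔥 𝔨 : Type*} [NormedAddCommGroup 𝔥] [InnerProductSpace ℂ 𝔥] [CompleteSpace 𝔥]
    [NormedAddCommGroup 𝔨] [InnerProductSpace ℂ 𝔨] [CompleteSpace 𝔨]
    (A : VonNeumannAlgebra 𝔥) (j : QSFlow A 𝔨)
    (c : 𝔥 →L[ℂ] HTensor (Hat 𝔨) 𝔥) (hc : c ∈ uwKetTensor (Hat 𝔨) (A : Set (𝔥 →L[ℂ] 𝔥))) :
    (∃! M : ℝ≥0 → HTensor 𝔥 (Noise 𝔨) →L[ℂ] HTensor 𝔥 (Noise 𝔨), IsSolution j c M) ∧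
    ∀ M : ℝ≥0 → HTensor 𝔥 (Noise 𝔨) →L[ℂ] HTensor 𝔥 (Noise 𝔨), IsSolution j c M →
      Continuous M ∧
      ∀ (t : ℝ≥0) (u v : 𝔥) (f g : L2 𝔨),
        IntegrableOn (fun s => ⟪elem u (expVec f),
          j.toFun s (ketSlice A (hat (f s)) hc) (M s (elem v (expVec g)))⟫_ℂ)
          (Set.Iio t) lebesgue ∧
        ⟪elem u (expVec f), (M t - 1) (elem v (expVec g))⟫_ℂ =
          ∫ s in Set.Iio t, ⟪elem u (expVec f),
            j.toFun s (ketSlice A (hat (f s)) hc) (M s (elem v (expVec g)))⟫_ℂ ∂lebesgue := by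
  refine ⟨⟨solution j hc, isSolution_solution j hc, fun M hM =>
    hM.unique j hc (isSolution_solution j hc)⟩, fun M hM => ⟨?_, fun t u v f g =>
    ⟨hM.integrableOn j hc t (u, f) (v, g), hM.inner_sub_one j hc t (u, f) (v, g)⟩⟩⟩
  -- Norm continuity is not part of the notion of solution; uniqueness transfers it from the
  -- constructed one.
  rw [hM.unique j hc (isSolution_solution j hc)]
  exact (solution j hc).continuous
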